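/- A \emph{combinatorial order type} on $n$ points is an arbitrary mapping $\tau$ assigning a sign in $\{-1,0,+1\}$ to each triple of indices $1\le i<j<k\le n$. It is \emph{realizable} if there are points $p_1,\dots,p_n\in\mathbb{R}^2$ such that, for all $i<j<k$, $\tau(i,j,k)$ is the sign of the determinant of the matrix with rows $p_j-p_i$ and $p_k-p_i$; it is \emph{simple} if all its signs are $\pm1$. It is \emph{constructible} if no three of the first four points are collinear (i.e., form a triple with sign $0$), and for every $t>4$ the $t$-th point lies on at most two of the lines spanned by the points $1,\dots,t-1$. (Here two indices $a\ne b$ less than $t$ span a line if some index $c<t$ other than $a,b$ is not collinear with them; this line is identified with the set consisting of $a$, $b$ and all indices $c<t$ collinear with $a,b$; and it contains the $t$-th point if $a,b,t$ are collinear.) CONSTRUCTIBLE (resp. SIMPLE) ORDER-TYPE REALIZABILITY is the decision problem whose instances are the constructible (resp. simple) combinatorial order types, the question being whether the given one is realizable. As input, an order type is written as a word consisting of $n$ in unary followed by the list of the signs of all triples. \textbf{Proposition.} CONSTRUCTIBLE ORDER-TYPE REALIZABILITY is polynomial-time many-one reducible to SIMPLE ORDER-TYPE REALIZABILITY: there is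 a mapping, computable by a Turing machine in time polynomial in the length of the input, that sends every constructible combinatorial order type $\tau$ to a simple combinatorial order type $\xi$ such that $\tau$ is realizable if and only if $\xi$ is realizable. -/

import Mathlib

/-- A combinatorial order type on `n` points: an arbitrary sign for every triple `i < j < k`
of indices.  It need not be the order type of any point sequence. -/
@[ext]
structure CombOrderType (n : ℕ) where
  /-- the sign of the triple `i < j < k` -/
  sign : ∀ i j k : Fin n, i < j → j < k → SignType

/-- The sign of an ordered triple of points of the plane: the sign of the determinant of the
matrix with rows `q - p` and `r - p`. -/
noncomputable def orientation (p q r : ℝ × ℝ) : SignType :=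
  SignType.sign (Matrix.det !![q.1 - p.1, q.2 - p.2; r.1 - p.1, r.2 - p.2])

/-- The order type of a point sequence in the plane. -/
noncomputable def orderType {n : ℕ} (p : Fin n → ℝ × ℝ) : CombOrderType n where
  sign i j k _ _ := orientation (p i) (p j) (p k)

namespace CombOrderType

variable {n : ℕ}

/-- `τ` is the order type of an actual point sequence. -/
def Realizable (τ : CombOrderType n) : Prop :=
  ∃ p : Fin n → ℝ × ℝ, orderType p = τ

/-- All signs are `+1` or `-1`. -/
def Simple (τ : CombOrderType n) : Prop :=
  ∀ (i j k : Fin n) (hij : i < j) (hjk : j < k), τ.sign i j k hij hjk ≠ 0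

/-- The three (distinct) indices `a, b, c`, in whatever order, form a triple with sign `0`. -/
def Collinear (τ : CombOrderType n) (a b c : Fin n) : Prop :=
  ∃ (i j k : Fin n) (hij : i < j) (hjk : j < k),
    ({a, b, c} : Finset (Fin n)) = {i, j, k} ∧ τ.sign i j k hij hjk = 0

/-- The set of the points with index less than `t` that lie on the line spanned by the points
`a` and `b`. -/
def line (τ : CombOrderType n) (t a b : Fin n) : Set (Fin n) :=
  {c | c < t ∧ (c = a ∨ c = b ∨ τ.Collinear a b c)}

/-- The lines that are spanned by the points with index less than `t` and pass through the
point `t`; each line is represented by the set of the points with index less than `t` on it.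
A pair `a, b` spans a line only if not all of these points are collinear with `a` and `b`:
when the first points contain a non-collinear triple, this excludes exactly the pairs of
indices that stand for one and the same point of the plane. -/
def linesThrough (τ : CombOrderType n) (t : Fin n) : Set (Set (Fin n)) :=
  {L | ∃ a b : Fin n, a < t ∧ b < t ∧ a ≠ b ∧ L = τ.line t a b ∧
    (∃ c, c < t ∧ c ∉ L) ∧ τ.Collinear a b t}

/-- Constructibility in the given order: no three of the first four points are collinear, and
every later point lies on at most two of the lines spanned by the points that precede it.
(Indices start from `0`.) -/
def Constructible (τ : CombOrderType n) : Prop :=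
  (∀ (i j k : Fin n) (hij : i < j) (hjk : j < k), (k : ℕ) < 4 → τ.sign i j k hij hjk ≠ 0) ∧
  ∀ t : Fin n, 4 ≤ (t : ℕ) → (τ.linesThrough t).ncard ≤ 2

/-- The signs of all triples `i < j < k`, in the lexicographic order of the triples. -/
def signList (τ : CombOrderType n) : List SignType :=
  (List.finRange n).flatMap fun i => (List.finRange n).flatMap fun j =>
    (List.finRange n).flatMap fun k =>
      if h : i < j ∧ j < k then [τ.sign i j k h.1 h.2] else []

/-- A combinatorial order type as a word over a four-letter alphabet: the number of points in
unary (letter `none`), followed by the list of the signs. -/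
def encode (τ : CombOrderType n) : List (Option SignType) :=
  List.replicate n none ++ τ.signList.map some

end CombOrderType

/-- The signs of an order type can be read off from its list of signs. -/
theorem CombOrderType.signList_injective {n : ℕ} {τ τ' : CombOrderType n}
    (h : τ.signList = τ'.signList) : τ = τ' := by
  have key : ∀ {ι : Type} (l : List ι) (f g : ι → List SignType),
      (∀ x ∈ l, (f x).length = (g x).length) → l.flatMap f = l.flatMap g →
      ∀ x ∈ l, f x = g x := by
    intro ι l f g
    induction l with
    | nil => intro _ _ x hx; simp at hx
    | cons a l ih =>
      intro hl he x hx
      simp only [List.flatMap_cons] at he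
      obtain ⟨h1, h2⟩ := List.append_inj he (hl a (by simp))
      rcases List.mem_cons.1 hx with rfl | hx
      · exact h1
      · exact ih (fun y hy => hl y (by simp [hy])) h2 x hx
  have len : ∀ {ι : Type} (l : List ι) (f g : ι → List SignType),
      (∀ x ∈ l, (f x).length = (g x).length) →
      (l.flatMap f).length = (l.flatMap g).length := by
    intro ι l f g hl
    simp only [List.length_flatMap]
    exact congrArg List.sum (List.map_congr_left hl)
  have l1 : ∀ i j k : Fin n,
      (if h : i < j ∧ j < k then [τ.sign i j k h.1 h.2] else []).length =
      (if h : i < j ∧ j < k then [τ'.sign i j k h.1 h.2] else []).length := by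
    intro i j k
    split <;> rfl
  ext i j k hij hjk
  have e1 := key _ _ _ (fun i _ => len _ _ _ fun j _ => len _ _ _ fun k _ => l1 i j k) h i
    (List.mem_finRange i)
  have e2 := key _ _ _ (fun j _ => len _ _ _ fun k _ => l1 i j k) e1 j (List.mem_finRange j)
  have e3 := key _ _ _ (fun k _ => l1 i j k) e2 k (List.mem_finRange k)
  simpa [hij, hjk] using e3

/-- Different combinatorial order types are encoded by different words. -/
theorem CombOrderType.encode_injective :
    Function.Injective fun τ : (n : ℕ) × CombOrderType n => τ.2.encode := by
  rintro ⟨n, τ⟩ ⟨m, τ'⟩ h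
  have hc := congrArg (List.count none) h
  have z : ∀ l : List SignType, (l.map some).count (none : Option SignType) = 0 := by
    intro l
    rw [List.count_eq_zero]
    simp
  simp only [encode, List.count_append, List.count_replicate_self, z, add_zero] at hc
  subst hc
  simp only [encode, List.append_cancel_left_eq] at h
  rw [signList_injective (List.map_injective_iff.2 (Option.some_injective _) h)]

/-- A decision problem: instances, written as words over a finite alphabet, and the set of
YES-instances. -/
structure DecisionProblem where
  /-- the instances -/
  Instance : Type
  /-- the alphabet -/
  Symbol : Type
  /-- the alphabet is finite -/
  symbolFintype : Fintype Symbol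
  /-- the word that is the input for an instance -/
  encode : Instance → List Symbol
  /-- different instances are different words -/
  encode_injective : Function.Injective encode
  /-- the YES-instances -/
  IsYes : Instance → Prop

/-- Polynomial-time many-one reducibility: there is a map `f` from the instances of `A` to the
instances of `B`, computable by a Turing machine in time polynomial in the length of the input
word, such that `x` is a YES-instance of `A` iff `f x` is a YES-instance of `B`. -/
def DecisionProblem.ReducesTo (A B : DecisionProblem) : Prop :=
  ∃ f : A.Instance → B.Instance,
    Nonempty (Turing.TM2ComputableInPolyTime A.encode B.encode f) ∧
    ∀ x, A.IsYes x ↔ B.IsYes (f x)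

/-- The decision problem whose instances are the combinatorial order types, on any number of
points, with property `P`; the question is whether the given one is realizable. -/
def orderTypeRealizability (P : ∀ {n : ℕ}, CombOrderType n → Prop) : DecisionProblem where
  Instance := {τ : (n : ℕ) × CombOrderType n // P τ.2}
  Symbol := Option SignType
  symbolFintype := inferInstance
  encode τ := τ.1.2.encode
  encode_injective := CombOrderType.encode_injective.comp Subtype.val_injective
  IsYes τ := τ.1.2.Realizable

/-- CONSTRUCTIBLE ORDER-TYPE REALIZABILITY. -/
def constructibleOrderTypeRealizability : DecisionProblem :=
  orderTypeRealizability CombOrderType.Constructible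

/-- SIMPLE ORDER-TYPE REALIZABILITY. -/
def simpleOrderTypeRealizability : DecisionProblem :=
  orderTypeRealizability CombOrderType.Simple

/-! Let `p` realize the given signs `T`. For every index `k ≥ 4` choose earlier indices `a, b`, not
collinear with `k`, such that every line spanned by earlier points and passing through `p k` is the
line through `k, a` or the line through `k, b` (`Good`). Replace `p k` by four points `p k + x ε (p
a - p k) + y ε² (p b - p k)`, where the signs of `(x, y)` run over the four quadrants; the first
four points stay single. The clusters are created from the last index down, each `ε` being chosen
small relative to everything placed before it. Every orientation of cluster points then becomes
nonzero, and it is the sign of a leading coefficient that depends only on `T` and on the chosen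
pairs (`clusterSign`, `placed_step_eventually`, `exists_placed`). This defines a simple order type
even when `T` is not known to be realizable.

Conversely, take any realization of this simple order type and choose points successively, the
`k`-th one in the convex hull of the `k`-th cluster. A nonzero sign of `T` is constant on the
clusters, and convexity carries it over to the hulls. The zero signs at `k` ask for a point on at
most two lines. Each of them has cluster points on both sides, and two of them divide the cluster
into four quadrants, so that they cross inside the hull (`exists_mem_hull_of_quadrants`,
`exists_next_point`).

Being good is a condition on the signs alone. A realizable constructible order type has a good pair
at every `k ≥ 4` (`Realizes.exists_good`). If such a pair is missing somewhere, the input is not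
realizable and a fixed nonrealizable simple order type on four points is the output.

For the running time, the pair is taken to be the lexicographically first good one. Then the output
signs are given by finitely many fixed first-order formulas about the input signs. Quantifiers
become loops over the indices, and an atomic formula is evaluated by one pass over the input. The
formulas are compiled to loop commands (`Cmd`), these to stack programs (`StackProg`), and these to
a `TM2` machine, with a polynomial time bound (`Fm.exec_toCmd`, `Cmd.runs_compile`,
`Cmd.computableInPolyTime`). -/

section

open Filter Topology

/-! ### Oriented areas and antisymmetric sign functions -/

/-- Twice the signed area of a triangle. -/
def area (p q r : ℝ × ℝ) : ℝ := (q.1 - p.1) * (r.2 - p.2) - (q.2 - p.2) * (r.1 - p.1)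

theorem orientation_eq_sign_area (p q r : ℝ × ℝ) :
    orientation p q r = SignType.sign (area p q r) := by
  simp [orientation, area, Matrix.det_fin_two]

theorem area_rotate (p q r : ℝ × ℝ) : area q r p = area p q r := by
  simp only [area]; ring

theorem area_swap (p q r : ℝ × ℝ) : area q p r = -area p q r := by
  simp only [area]; ring

theorem area_self_left (p r : ℝ × ℝ) : area p p r = 0 := by
  simp only [area]; ring

theorem area_self_right (p r : ℝ × ℝ) : area r p p = 0 := by
  simp only [area]; ring

theorem area_self_outer (p r : ℝ × ℝ) : area p r p = 0 := by
  simp only [area]; ring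

/-- If three points lie on the line through two distinct points, then they are collinear. -/
theorem area_eq_zero_of_line {p q x y z : ℝ × ℝ} (h : p ≠ q) (hx : area p q x = 0)
    (hy : area p q y = 0) (hz : area p q z = 0) : area x y z = 0 := by
  simp only [area] at *
  by_cases h1 : q.1 - p.1 = 0
  · have h2 : q.2 - p.2 ≠ 0 := fun h2 => h (Prod.ext (by linarith) (by linarith))
    rw [h1] at hx hy hz
    have ex : x.1 - p.1 = 0 := by simpa [h2] using hx
    have ey : y.1 - p.1 = 0 := by simpa [h2] using hy
    have ez : z.1 - p.1 = 0 := by simpa [h2] using hz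
    rw [show y.1 - x.1 = 0 by linarith, show z.1 - x.1 = 0 by linarith]; ring
  -- Multiplied by `q.1 - p.1`, the area of `x, y, z` is a linear combination of the three vanishing
  -- areas.
  · apply mul_left_cancel₀ h1
    linear_combination (z.1 - y.1) * hx + (x.1 - z.1) * hy + (y.1 - x.1) * hz

/-- The antisymmetric extension of a sign function on increasing triples. -/
def chi (T : ℕ → ℕ → ℕ → SignType) (i j k : ℕ) : SignType :=
  if i < j ∧ j < k then T i j k else
  if j < k ∧ k < i then T j k i else
  if k < i ∧ i < j then T k i j else
  if i < k ∧ k < j then -T i k j else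
  if k < j ∧ j < i then -T k j i else
  if j < i ∧ i < k then -T j i k else 0

/-- The first `n` points of `p` have the signs `T`. -/
def Realizes (n : ℕ) (T : ℕ → ℕ → ℕ → SignType) (p : ℕ → ℝ × ℝ) : Prop :=
  ∀ i j k, i < j → j < k → k < n → SignType.sign (area (p i) (p j) (p k)) = T i j k

theorem Realizes.mono {m n : ℕ} {T p} (h : Realizes n T p) (hmn : m ≤ n) : Realizes m T p :=
  fun i j k hij hjk hk => h i j k hij hjk (hk.trans_le hmn)

theorem Realizes.chi_eq {n : ℕ} {T p} (h : Realizes n T p) {i j k : ℕ} (hi : i < n) (hj : j < n)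
    (hk : k < n) : chi T i j k = SignType.sign (area (p i) (p j) (p k)) := by
  unfold chi
  split_ifs with h1 h2 h3 h4 h5 h6
  · rw [h _ _ _ h1.1 h1.2 hk]
  · rw [← h _ _ _ h2.1 h2.2 hi, ← area_rotate (p i)]
  · rw [← h _ _ _ h3.1 h3.2 hj, ← area_rotate (p k)]
  · rw [← h _ _ _ h4.1 h4.2 hj, ← Left.sign_neg]
    congr 1; simp only [area]; ring
  · rw [← h _ _ _ h5.1 h5.2 hi, ← Left.sign_neg]
    congr 1; simp only [area]; ring
  · rw [← h _ _ _ h6.1 h6.2 hk, ← Left.sign_neg]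
    congr 1; simp only [area]; ring
  · have : i = j ∨ j = k ∨ i = k := by omega
    rcases this with rfl | rfl | rfl
    · simp [area_self_left]
    · simp [area_self_right]
    · simp [area_self_outer]

theorem Realizes.chi_eq_zero {n : ℕ} {T p} (h : Realizes n T p) {i j k : ℕ} (hi : i < n)
    (hj : j < n) (hk : k < n) : chi T i j k = 0 ↔ area (p i) (p j) (p k) = 0 := by
  rw [h.chi_eq hi hj hk, sign_eq_zero_iff]

theorem chi_of_lt {T : ℕ → ℕ → ℕ → SignType} {i j k : ℕ} (hij : i < j) (hjk : j < k) :
    chi T i j k = T i j k := by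
  simp [chi, hij, hjk]

theorem chi_swap (T : ℕ → ℕ → ℕ → SignType) (i j k : ℕ) : chi T j i k = -chi T i j k := by
  unfold chi
  split_ifs <;> first | omega | simp

/-! ### The shape of a cluster and expansions in powers of ε -/

/-- The first coordinates of the four points that replace one point. -/
def xCoord : Fin 4 → ℤ := ![-2, -1, 1, 2]

/-- The second coordinates of the four points that replace one point. -/
def yCoord : Fin 4 → ℤ := ![-1, 1, -2, 2]

/-- The position of two cluster points with respect to the centre. -/
noncomputable def crossSign (b c : Fin 4) : SignType :=
  SignType.sign (xCoord b * yCoord c - xCoord c * yCoord b)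

/-- The orientation of three cluster points. -/
noncomputable def triSign (a b c : Fin 4) : SignType :=
  SignType.sign ((xCoord b - xCoord a) * (yCoord c - yCoord a) -
    (xCoord c - xCoord a) * (yCoord b - yCoord a))

/-- The coordinates are chosen for these finite checks: no two cluster points are collinear with the
centre, no three are collinear, first coordinates increase, second coordinates differ, and the sign
patterns are the four quadrants. Hence leading coefficients do not vanish by accident. -/
theorem crossSign_ne_zero : ∀ {b c : Fin 4}, b < c → crossSign b c ≠ 0 := by decide
theorem triSign_ne_zero : ∀ {a b c : Fin 4}, a < b → b < c → triSign a b c ≠ 0 := by decide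
theorem xCoord_lt : ∀ {b c : Fin 4}, b < c → xCoord b < xCoord c := by decide
theorem sign_yCoord_sub_ne_zero : ∀ {b c : Fin 4}, b < c →
    SignType.sign (yCoord c - yCoord b) ≠ 0 := by decide
theorem xCoord_ne_zero : ∀ b : Fin 4, xCoord b ≠ 0 := by decide
theorem sign_xCoord_ne_zero : ∀ b : Fin 4, SignType.sign (xCoord b) ≠ 0 := by decide
theorem sign_yCoord_ne_zero : ∀ b : Fin 4, SignType.sign (yCoord b) ≠ 0 := by decide

theorem sign_intCast_real (z : ℤ) : SignType.sign (z : ℝ) = SignType.sign z := by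
  rcases lt_trichotomy z 0 with h | rfl | h
  · rw [sign_neg h, sign_neg (by exact_mod_cast h)]
  · simp
  · rw [sign_pos h, sign_pos (by exact_mod_cast h)]

/-- The point near `p` with coordinates `x ε, y ε²` with respect to the vectors from `p` to
`s` and `t`. -/
def nearPoint (p s t : ℝ × ℝ) (x y ε : ℝ) : ℝ × ℝ :=
  (p.1 + ε * (x * (s.1 - p.1)) + ε ^ 2 * (y * (t.1 - p.1)),
   p.2 + ε * (x * (s.2 - p.2)) + ε ^ 2 * (y * (t.2 - p.2)))

theorem nearPoint_zero (p s t : ℝ × ℝ) (x y : ℝ) : nearPoint p s t x y 0 = p := by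
  simp [nearPoint]

theorem continuous_nearPoint (p s t : ℝ × ℝ) (x y : ℝ) : Continuous (nearPoint p s t x y) := by
  unfold nearPoint; fun_prop

/-- The sign of the leading coefficient. -/
def leadSign (A B C : SignType) : SignType := if A ≠ 0 then A else if B ≠ 0 then B else C

theorem eventually_sign_of_continuous {f : ℝ → ℝ} (hf : Continuous f) (h0 : f 0 ≠ 0) :
    ∀ᶠ ε in 𝓝[>] (0 : ℝ), SignType.sign (f ε) = SignType.sign (f 0) := by
  apply Filter.Eventually.filter_mono nhdsWithin_le_nhds
  rcases lt_or_gt_of_ne h0 with h | h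
  · filter_upwards [hf.continuousAt.eventually_lt_const h] with ε he
    rw [sign_neg h, sign_neg he]
  · filter_upwards [hf.continuousAt.eventually_const_lt h] with ε he
    rw [sign_pos h, sign_pos he]

/-- Divide by the lowest power of `ε` that has a nonzero coefficient; the quotient is continuous and
nonzero at `0`. -/
theorem eventually_sign_cubic (A B C : ℝ) :
    ∀ᶠ ε in 𝓝[>] (0 : ℝ), SignType.sign (ε * A + ε ^ 2 * B + ε ^ 3 * C) =
      leadSign (SignType.sign A) (SignType.sign B) (SignType.sign C) := by
  have key : ∀ (f : ℝ → ℝ) (r : ℕ), Continuous f → f 0 ≠ 0 →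
      ∀ᶠ ε in 𝓝[>] (0 : ℝ), SignType.sign (ε ^ r * f ε) = SignType.sign (f 0) := by
    intro f r hf h0
    filter_upwards [eventually_sign_of_continuous hf h0, self_mem_nhdsWithin] with ε he hpos
    rw [sign_mul, sign_pos (pow_pos hpos r), one_mul, he]
  unfold leadSign
  by_cases hA : A = 0
  · by_cases hB : B = 0
    · by_cases hC : C = 0
      · simp [hA, hB, hC]
      · filter_upwards [key (fun _ => C) 3 (by fun_prop) hC] with ε he
        simpa [hA, hB] using he
    · filter_upwards [key (fun ε => B + ε * C) 2 (by fun_prop) (by simpa using hB)] with ε he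
      rw [show ε * A + ε ^ 2 * B + ε ^ 3 * C = ε ^ 2 * (B + ε * C) by rw [hA]; ring, he]
      simp [hA, hB, sign_eq_zero_iff]
  · filter_upwards [key (fun ε => A + ε * B + ε ^ 2 * C) 1 (by fun_prop)
      (by simpa using hA)] with ε he
    rw [show ε * A + ε ^ 2 * B + ε ^ 3 * C = ε ^ 1 * (A + ε * B + ε ^ 2 * C) by ring, he]
    simp [hA, sign_eq_zero_iff]

/-- This and the next identities expand areas with cluster points into cubics in `ε` without
constant term, so that `eventually_sign_cubic` applies. Here collinearity removes the constant term;
in the others it vanishes since the centre occurs twice or more. -/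
theorem area_nearPoint_right {P Q p : ℝ × ℝ} (h : area P Q p = 0) (s t : ℝ × ℝ) (x y ε : ℝ) :
    area P Q (nearPoint p s t x y ε) =
      ε * (x * area P Q s) + ε ^ 2 * (y * area P Q t) + ε ^ 3 * 0 := by
  simp only [area, nearPoint] at *
  linear_combination (1 - ε * x - ε ^ 2 * y) * h

theorem area_nearPoint_mid (p z s t : ℝ × ℝ) (x y ε : ℝ) :
    area p (nearPoint p s t x y ε) z =
      ε * (x * area p s z) + ε ^ 2 * (y * area p t z) + ε ^ 3 * 0 := by
  simp only [area, nearPoint]; ring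

theorem area_nearPoint_left_mid (p z s t : ℝ × ℝ) (x y x' y' ε : ℝ) :
    area (nearPoint p s t x y ε) (nearPoint p s t x' y' ε) z =
      ε * ((x' - x) * area p s z) + ε ^ 2 * ((y' - y) * area p t z) +
      ε ^ 3 * ((x * y' - x' * y) * area p s t) := by
  simp only [area, nearPoint]; ring

theorem area_nearPoint_mid_right (P p s t : ℝ × ℝ) (x y x' y' ε : ℝ) :
    area P (nearPoint p s t x y ε) (nearPoint p s t x' y' ε) =
      ε * ((x' - x) * area P p s) + ε ^ 2 * ((y' - y) * area P p t) +
      ε ^ 3 * ((x * y' - x' * y) * area s t p) := by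
  simp only [area, nearPoint]; ring

theorem area_nearPoint_all (p s t : ℝ × ℝ) (x y x' y' x'' y'' ε : ℝ) :
    area (nearPoint p s t x y ε) (nearPoint p s t x' y' ε) (nearPoint p s t x'' y'' ε) =
      ε * 0 + ε ^ 2 * 0 +
      ε ^ 3 * (((x' - x) * (y'' - y) - (x'' - x) * (y' - y)) * area s t p) := by
  simp only [area, nearPoint]; ring

/-! ### Good pairs and the prescribed signs of the clusters -/

/-- The points `a, b` before `k` are not collinear with `k`, and each line through `k` spanned by
points before `k` is the line through `k` and `a` or the line through `k` and `b`. -/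
def Good (T : ℕ → ℕ → ℕ → SignType) (k a b : ℕ) : Prop :=
  a < k ∧ b < k ∧ chi T a b k ≠ 0 ∧ ∀ i < k, ∀ j < k, i < j → chi T i j k = 0 →
    (∀ c < k, chi T i j c = 0) ∨
    (∀ c < k, chi T i j c = 0 ↔ chi T a k c = 0) ∨
    (∀ c < k, chi T i j c = 0 ↔ chi T b k c = 0)

section

variable (T : ℕ → ℕ → ℕ → SignType) (al be : ℕ → ℕ)

/-- The sign of two points and a point of the cluster of a third, later point, where the line
through the first two points is at a positive distance from its cluster. -/
noncomputable def lineSign (i j k : ℕ) (c : Fin 4) : SignType :=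
  leadSign (chi T i j k) (SignType.sign (xCoord c) * chi T i j (al k))
    (SignType.sign (yCoord c) * chi T i j (be k))

/-- The sign of three cluster points, in lexicographic order. -/
noncomputable def clusterSign (i : ℕ) (a : Fin 4) (j : ℕ) (b : Fin 4) (k : ℕ) (c : Fin 4) :
    SignType :=
  if i < j then
    if j < k then
      leadSign (lineSign T al be i j k c)
        (SignType.sign (xCoord b) * -lineSign T al be (al j) j k c) 0
    else
      leadSign (chi T i k (al k)) (SignType.sign (yCoord c - yCoord b) * chi T i k (be k))
        (crossSign b c * chi T (al k) (be k) k)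
  else
    if j < k then -lineSign T al be (al j) j k c
    else triSign a b c * chi T (al k) (be k) k

end

/-- The lexicographic order of the points of all clusters. -/
def PtLt (P Q : ℕ × Fin 4) : Prop := P.1 < Q.1 ∨ P.1 = Q.1 ∧ P.2 < Q.2

theorem leadSign_of_ne_zero {A : SignType} (h : A ≠ 0) (B C : SignType) : leadSign A B C = A := by
  simp [leadSign, h]

theorem leadSign_zero_left (B C : SignType) : leadSign 0 B C = leadSign B C 0 := by
  unfold leadSign; split_ifs <;> simp_all

theorem leadSign_eq_zero_iff {A B C : SignType} : leadSign A B C = 0 ↔ A = 0 ∧ B = 0 ∧ C = 0 := by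
  unfold leadSign; split_ifs <;> simp_all

/-! ### From a realization to clusters -/

section

variable {n : ℕ} {T : ℕ → ℕ → ℕ → SignType} {p : ℕ → ℝ × ℝ} {al be : ℕ → ℕ}

theorem Realizes.ne_of_chi_ne_zero (hp : Realizes n T p) {i j k : ℕ} (hi : i < n) (hj : j < n)
    (hk : k < n) (h : chi T i j k ≠ 0) : p i ≠ p j := by
  intro e
  rw [hp.chi_eq hi hj hk, e, area_self_left] at h
  simp at h

/-- If all three coefficients vanished, then `k`, `al k` and `be k` would lie on the line through
the distinct points `p i` and `p j`, although a good pair is not collinear with `k`. -/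
theorem lineSign_ne_zero (hp : Realizes n T p) {i j k : ℕ} (hg : Good T k (al k) (be k))
    (hij : i < j) (hjk : j < k) (hk : k < n) (hne : p i ≠ p j) (c : Fin 4) :
    lineSign T al be i j k c ≠ 0 := by
  intro h
  obtain ⟨ha, hb, hab, -⟩ := hg
  simp only [lineSign, leadSign_eq_zero_iff, mul_eq_zero, sign_xCoord_ne_zero,
    sign_yCoord_ne_zero, false_or] at h
  obtain ⟨h1, h2, h3⟩ := h
  have hj := hjk.trans hk
  have hi := hij.trans hj
  rw [hp.chi_eq_zero hi hj (by omega)] at h1 h2 h3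
  exact hab ((hp.chi_eq_zero (by omega) (by omega) hk).2 (area_eq_zero_of_line hne h2 h3 h1))

/-- Coincident points span no line. This is the case in which `clusterSign` has to fall back on the
displacement of the middle point. -/
theorem lineSign_eq_zero (hp : Realizes n T p) {i j k : ℕ} (hg : Good T k (al k) (be k))
    (hij : i < j) (hjk : j < k) (hk : k < n) (he : p i = p j) (c : Fin 4) :
    lineSign T al be i j k c = 0 := by
  obtain ⟨ha, hb, hab, -⟩ := hg
  have h : ∀ z < n, chi T i j z = 0 := fun z hz => by
    rw [hp.chi_eq_zero (by omega) (by omega) hz, he, area_self_left]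
  simp [lineSign, leadSign_eq_zero_iff, h k hk, h (al k) (by omega), h (be k) (by omega)]

variable (n T p al be) in
/-- The clusters of the points from the `m`-th one on have been placed. -/
def Placed (m : ℕ) (Q : ℕ → Fin 4 → ℝ × ℝ) : Prop :=
  (∀ k < m, ∀ c, Q k c = p k) ∧
  ∀ i a j b k c, PtLt (i, a) (j, b) → PtLt (j, b) (k, c) → k < n →
    (m ≤ j ∨ (i < j ∧ j < k ∧ (chi T i j k ≠ 0 ∨ (m ≤ k ∧ p i ≠ p j)))) →
    SignType.sign (area (Q i a) (Q j b) (Q k c)) = clusterSign T al be i a j b k c ∧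
    clusterSign T al be i a j b k c ≠ 0

/-- While all clusters are collapsed to their centres, only triples of distinct indices with nonzero
sign are covered, and there `clusterSign` is just `chi`. -/
theorem placed_base (hp : Realizes n T p) {m : ℕ} (hm : n ≤ m) :
    Placed n T p al be m fun k _ => p k := by
  refine ⟨fun _ _ _ => rfl, fun i a j b k c h1 h2 hk h => ?_⟩
  have : j ≤ k := by rcases h2 with h | h <;> simp at h <;> omega
  obtain h | ⟨hij, hjk, h | h⟩ := h
  · omega
  · have e : clusterSign T al be i a j b k c = chi T i j k := by
      have : lineSign T al be i j k c = chi T i j k := leadSign_of_ne_zero h _ _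
      simp only [clusterSign, hij, hjk, if_true]
      rw [this, leadSign_of_ne_zero h]
    rw [e]
    exact ⟨(hp.chi_eq (by omega) (by omega) hk).symm, h⟩
  · omega

/-- Triples covered at stage `m + 1` have nonzero area and keep their sign for small `ε` by
continuity. The new ones have middle index `m` (four cases, according to whether the outer indices
equal `m`), or last index `m` and collinear centres, the first two being distinct. In each case the
area is a cubic in `ε` whose leading sign is `clusterSign`. -/
theorem placed_step_eventually (hp : Realizes n T p) {m : ℕ} (hm : m < n)
    (hgood : ∀ k, m ≤ k → k < n → Good T k (al k) (be k)) {Q : ℕ → Fin 4 → ℝ × ℝ}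
    (hQ : Placed n T p al be (m + 1) Q)
    (i : ℕ) (a : Fin 4) (j : ℕ) (b : Fin 4) (k : ℕ) (c : Fin 4) (h1 : PtLt (i, a) (j, b))
    (h2 : PtLt (j, b) (k, c)) (hk : k < n)
    (hres : m ≤ j ∨ (i < j ∧ j < k ∧ (chi T i j k ≠ 0 ∨ (m ≤ k ∧ p i ≠ p j))))
    (N : ℝ → ℕ → Fin 4 → ℝ × ℝ)
    (hN : N = fun ε k c => if k = m then
      nearPoint (p m) (p (al m)) (p (be m)) (xCoord c) (yCoord c) ε else Q k c) :
    ∀ᶠ ε in 𝓝[>] (0 : ℝ),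
      SignType.sign (area (N ε i a) (N ε j b) (N ε k c)) = clusterSign T al be i a j b k c ∧
      clusterSign T al be i a j b k c ≠ 0 := by
  have hij : i ≤ j := by rcases h1 with h | h <;> simp at h <;> omega
  have hjk : j ≤ k := by rcases h2 with h | h <;> simp at h <;> omega
  have hNm : ∀ ε c, N ε m c =
      nearPoint (p m) (p (al m)) (p (be m)) (xCoord c) (yCoord c) ε := by
    intro ε c; simp [hN]
  have hNlt : ∀ ε, ∀ k < m, ∀ c, N ε k c = p k := by
    intro ε k hk c
    simp [hN, hk.ne, hQ.1 k (by omega)]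
  have hNgt : ∀ ε, ∀ k, m < k → ∀ c, N ε k c = Q k c := by
    intro ε k hk c
    simp [hN, hk.ne']
  have hN0 : ∀ k c, N 0 k c = Q k c := by
    intro k c
    by_cases e : k = m
    · subst e; rw [hNm, nearPoint_zero, hQ.1 _ (by omega)]
    · simp [hN, e]
  have hNc : ∀ k c, Continuous fun ε => N ε k c := by
    intro k c
    by_cases e : k = m
    · subst e; simp only [hNm]; exact continuous_nearPoint _ _ _ _ _
    · simp only [hN, e, if_false]; exact continuous_const
  obtain ⟨hal, hbe, hab, -⟩ := hgood m le_rfl hm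
  by_cases hold : m + 1 ≤ j ∨ (i < j ∧ j < k ∧ (chi T i j k ≠ 0 ∨ (m + 1 ≤ k ∧ p i ≠ p j)))
  · obtain ⟨e1, e2⟩ := hQ.2 i a j b k c h1 h2 hk hold
    have hcont : Continuous fun ε => area (N ε i a) (N ε j b) (N ε k c) := by
      have := hNc i a; have := hNc j b; have := hNc k c
      unfold area; fun_prop
    have h0 : area (N 0 i a) (N 0 j b) (N 0 k c) ≠ 0 := by
      rw [hN0, hN0, hN0, ← sign_ne_zero, e1]; exact e2
    filter_upwards [eventually_sign_of_continuous hcont h0] with ε he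
    rw [hN0, hN0, hN0, e1] at he
    exact ⟨he, e2⟩
  rw [not_or] at hold
  obtain ⟨ho1, ho2⟩ := hold
  -- To leading order, displacements within the cluster of `m` point along the line towards `p (al
  -- m)`. The side of this line on which a later cluster point lies was settled at the previous
  -- stage.
  have hside : ∀ k c, m < k → k < n →
      SignType.sign (area (p m) (p (al m)) (Q k c)) = -lineSign T al be (al m) m k c ∧
      lineSign T al be (al m) m k c ≠ 0 := by
    intro k c hmk hkn
    have hne : p (al m) ≠ p m := by
      intro e
      rw [Ne, hp.chi_eq_zero (by omega) (by omega) hm, e, area_self_outer] at hab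
      exact hab rfl
    have hl := lineSign_ne_zero hp (hgood k hmk.le hkn) hal hmk hkn hne c
    have := (hQ.2 (al m) 0 m 0 k c (Or.inl hal) (Or.inl hmk) hkn
      (Or.inr ⟨hal, hmk, Or.inr ⟨hmk, hne⟩⟩)).1
    rw [hQ.1 _ (by omega), hQ.1 _ (by omega)] at this
    simp only [clusterSign, hal, hmk, if_true, leadSign_of_ne_zero hl] at this
    refine ⟨?_, hl⟩
    rw [← this, ← Left.sign_neg, area_swap]
  have hx : ∀ {b c : Fin 4}, b < c → SignType.sign ((xCoord c : ℝ) - xCoord b) = 1 := by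
    intro b c hbc
    apply sign_pos
    have := xCoord_lt hbc
    have : (xCoord b : ℝ) < xCoord c := by exact_mod_cast this
    linarith
  by_cases hjm : j = m
  · subst hjm
    rcases hij.lt_or_eq with hij | rfl
    · rcases hjk.lt_or_eq with hjk | rfl
      -- For distinct points the triple would have been covered before. So the two centres coincide,
      -- and only the displacement of the middle point counts.
      · have he : p i = p j := by
          by_contra hne
          exact ho2 ⟨hij, hjk, Or.inr ⟨hjk, hne⟩⟩
        obtain ⟨s1, s2⟩ := hside k c hjk hk
        have e : clusterSign T al be i a j b k c =
            SignType.sign (xCoord b) * -lineSign T al be (al j) j k c := by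
          simp only [clusterSign, hij, hjk, if_true]
          rw [lineSign_eq_zero hp (hgood k hjk.le hk) hij hjk hk he, leadSign_zero_left,
            leadSign_of_ne_zero]
          simp [xCoord_ne_zero, s2]
        rw [e]
        simp only [hNlt _ i hij, hNgt _ k hjk, hNm, he, area_nearPoint_mid]
        filter_upwards [eventually_sign_cubic (xCoord b * area (p j) (p (al j)) (Q k c))
          (yCoord b * area (p j) (p (be j)) (Q k c)) 0] with ε hε
        rw [hε, sign_mul, s1, sign_intCast_real, leadSign_of_ne_zero]
        all_goals simp [xCoord_ne_zero, s2]
      · have hbc : b < c := by rcases h2 with h | h <;> simp at h; exact h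
        have e : clusterSign T al be i a j b j c = leadSign (chi T i j (al j))
            (SignType.sign (yCoord c - yCoord b) * chi T i j (be j))
            (crossSign b c * chi T (al j) (be j) j) := by
          simp only [clusterSign, hij, if_true, lt_irrefl, if_false]
        rw [e]
        simp only [hNlt _ i hij, hNm, area_nearPoint_mid_right]
        filter_upwards [eventually_sign_cubic ((xCoord c - xCoord b) * area (p i) (p j) (p (al j)))
          ((yCoord c - yCoord b) * area (p i) (p j) (p (be j)))
          ((xCoord b * yCoord c - xCoord c * yCoord b) * area (p (al j)) (p (be j)) (p j))]
          with ε hε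
        rw [hε, sign_mul, sign_mul, sign_mul, hx hbc, ← hp.chi_eq (by omega) hm (by omega),
          ← hp.chi_eq (by omega) hm (by omega), ← hp.chi_eq (by omega) (by omega) hm, one_mul]
        have c1 := sign_intCast_real (yCoord c - yCoord b)
        have c2 := sign_intCast_real (xCoord b * yCoord c - xCoord c * yCoord b)
        push_cast at c1 c2
        rw [c1, c2, Ne, leadSign_eq_zero_iff]
        exact ⟨rfl, fun h => by simpa [crossSign_ne_zero hbc, hab] using h.2.2⟩
    · have hablt : a < b := by rcases h1 with h | h <;> simp at h; exact h
      rcases hjk.lt_or_eq with hjk | rfl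
      · obtain ⟨s1, s2⟩ := hside k c hjk hk
        have e : clusterSign T al be i a i b k c = -lineSign T al be (al i) i k c := by
          simp only [clusterSign, hjk, if_true, lt_irrefl, if_false]
        rw [e]
        simp only [hNgt _ k hjk, hNm, area_nearPoint_left_mid]
        filter_upwards [eventually_sign_cubic
          ((xCoord b - xCoord a) * area (p i) (p (al i)) (Q k c))
          ((yCoord b - yCoord a) * area (p i) (p (be i)) (Q k c))
          ((xCoord a * yCoord b - xCoord b * yCoord a) * area (p i) (p (al i)) (p (be i)))]
          with ε hε
        rw [hε, sign_mul, hx hablt, one_mul, s1, leadSign_of_ne_zero]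
        all_goals simp [s2]
      · have hbc : b < c := by rcases h2 with h | h <;> simp at h; exact h
        have e : clusterSign T al be i a i b i c = triSign a b c * chi T (al i) (be i) i := by
          simp only [clusterSign, lt_irrefl, if_false]
        rw [e]
        simp only [hNm, area_nearPoint_all]
        filter_upwards [eventually_sign_cubic 0 0
          (((xCoord b - xCoord a) * (yCoord c - yCoord a) - (xCoord c - xCoord a) *
            (yCoord b - yCoord a)) * area (p (al i)) (p (be i)) (p i))] with ε hε
        rw [hε, sign_mul, ← hp.chi_eq (by omega) (by omega) hm]
        have c2 := sign_intCast_real ((xCoord b - xCoord a) * (yCoord c - yCoord a) -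
          (xCoord c - xCoord a) * (yCoord b - yCoord a))
        push_cast at c2
        rw [c2]
        exact ⟨by simp [leadSign, triSign], by simp [triSign_ne_zero hablt hbc, hab]⟩
  · obtain h | ⟨hij, hjk, h⟩ := hres
    · omega
    -- The remaining new triples are those whose last point is being expanded and lies on the line
    -- through the first two.
    obtain ⟨hc, hmk, hne⟩ : chi T i j k = 0 ∧ m ≤ k ∧ p i ≠ p j := by
      by_contra hcon
      apply ho2
      refine ⟨hij, hjk, ?_⟩
      by_cases hc : chi T i j k = 0
      · exact absurd (h.resolve_left (not_not.2 hc)) (fun h => hcon ⟨hc, h⟩)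
      · exact Or.inl hc
    have hkm : k = m := by
      by_contra hkm
      exact ho2 ⟨hij, hjk, Or.inr ⟨by omega, hne⟩⟩
    subst hkm
    have hl := lineSign_ne_zero hp (hgood k le_rfl hk) hij hjk hk hne c
    have e : clusterSign T al be i a j b k c = lineSign T al be i j k c := by
      simp only [clusterSign, hij, hjk, if_true, leadSign_of_ne_zero hl]
    rw [e]
    have hz := (hp.chi_eq_zero (by omega) (by omega) hk).1 hc
    simp only [hNlt _ i (hij.trans hjk), hNlt _ j hjk, hNm, area_nearPoint_right hz]
    filter_upwards [eventually_sign_cubic (xCoord c * area (p i) (p j) (p (al k)))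
      (yCoord c * area (p i) (p j) (p (be k))) 0] with ε hε
    refine ⟨?_, hl⟩
    rw [hε, sign_mul, sign_mul, ← hp.chi_eq (by omega) (by omega) (by omega),
      ← hp.chi_eq (by omega) (by omega) (by omega), sign_intCast_real, sign_intCast_real,
      lineSign, hc, leadSign_zero_left, sign_zero]

/-- Downward induction on `m`: later clusters are placed first and have their final size when the
`ε` of the cluster `m` is chosen. Only finitely many triples are involved, so one `ε` serves all of
them. -/
theorem exists_placed (hp : Realizes n T p) {m : ℕ} (hmn : m ≤ n)
    (hgood : ∀ k, m ≤ k → k < n → Good T k (al k) (be k)) : ∃ Q, Placed n T p al be m Q := by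
  induction hd : n - m generalizing m with
  | zero => exact ⟨_, placed_base hp (by omega)⟩
  | succ d ih =>
    have hm : m < n := by omega
    obtain ⟨Q, hQ⟩ := ih (m := m + 1) (by omega) (fun k hk => hgood k (by omega)) (by omega)
    set N : ℝ → ℕ → Fin 4 → ℝ × ℝ := fun ε k c => if k = m then
      nearPoint (p m) (p (al m)) (p (be m)) (xCoord c) (yCoord c) ε else Q k c with hN
    have hev : ∀ᶠ ε in 𝓝[>] (0 : ℝ), ∀ P R S : Fin n × Fin 4,
        PtLt (P.1, P.2) (R.1, R.2) → PtLt (R.1, R.2) (S.1, S.2) →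
        (m ≤ R.1 ∨ ((P.1 : ℕ) < R.1 ∧ (R.1 : ℕ) < S.1 ∧
          (chi T P.1 R.1 S.1 ≠ 0 ∨ (m ≤ S.1 ∧ p P.1 ≠ p R.1)))) →
        SignType.sign (area (N ε P.1 P.2) (N ε R.1 R.2) (N ε S.1 S.2)) =
          clusterSign T al be P.1 P.2 R.1 R.2 S.1 S.2 ∧
          clusterSign T al be P.1 P.2 R.1 R.2 S.1 S.2 ≠ 0 := by
      simp only [eventually_all]
      intro P R S h1 h2 h3
      exact placed_step_eventually hp hm hgood hQ _ _ _ _ _ _ h1 h2 S.1.2 h3 N hN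
    obtain ⟨ε, hε⟩ := hev.exists
    refine ⟨N ε, fun k hk c => ?_, fun i a j b k c h1 h2 hk h => ?_⟩
    · simp [hN, hk.ne, hQ.1 k (by omega)]
    · have hjk : j ≤ k := by rcases h2 with h | h <;> simp at h <;> omega
      have hij : i ≤ j := by rcases h1 with h | h <;> simp at h <;> omega
      exact hε (⟨i, by omega⟩, a) (⟨j, by omega⟩, b) (⟨k, hk⟩, c) h1 h2 h

end

/-! ### From clusters back to points: convexity -/

/-- The area is an affine function of its last argument, and the reals of a given sign form a convex
set. -/
theorem convex_sign_eq (u v : ℝ × ℝ) (s : SignType) :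
    Convex ℝ {z | SignType.sign (area u v z) = s} := by
  have hc : Convex ℝ {r : ℝ | SignType.sign r = s} := by
    cases s
    · convert! convex_singleton (𝕜 := ℝ) (0 : ℝ) using 1
      ext r; exact sign_eq_zero_iff
    · convert! convex_Iio (𝕜 := ℝ) (0 : ℝ) using 1
      ext r; exact sign_eq_neg_one_iff
    · convert! convex_Ioi (𝕜 := ℝ) (0 : ℝ) using 1
      ext r; exact sign_eq_one_iff
  intro x hx y hy a b ha hb hab
  have e : area u v (a • x + b • y) = a • area u v x + b • area u v y := by
    simp only [area, Prod.fst_add, Prod.snd_add, Prod.smul_fst, Prod.smul_snd, smul_eq_mul]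
    linear_combination ((v.1 - u.1) * u.2 - (v.2 - u.2) * u.1) * hab
  rw [Set.mem_ofPred_eq, e]
  exact hc hx hy ha hb hab

theorem sign_area_of_mem_hull {Q : Fin 4 → ℝ × ℝ} {u v z : ℝ × ℝ} {s : SignType}
    (h : ∀ c, SignType.sign (area u v (Q c)) = s) (hz : z ∈ convexHull ℝ (Set.range Q)) :
    SignType.sign (area u v z) = s :=
  convexHull_min (Set.range_subset_iff.2 h) (convex_sign_eq u v s) hz

/-- An affine function with opposite signs at the ends of a segment has a zero on it, with explicit
weights. -/
theorem exists_area_eq_zero_of_sign {u v x y : ℝ × ℝ} {s : SignType} (hs : s ≠ 0)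
    (hx : SignType.sign (area u v x) = -s) (hy : SignType.sign (area u v y) = s) :
    ∃ z ∈ segment ℝ x y, area u v z = 0 := by
  have key : ∀ x y : ℝ × ℝ, area u v x < 0 → 0 < area u v y →
      ∃ z ∈ segment ℝ x y, area u v z = 0 := by
    intro x y h1 h2
    have h3 : 0 < area u v y - area u v x := by linarith
    refine ⟨_, ⟨area u v y / (area u v y - area u v x), -area u v x / (area u v y - area u v x),
      by positivity, div_nonneg (by linarith) h3.le, by field_simp; ring, rfl⟩, ?_⟩
    have e : ∀ a b : ℝ, a + b = 1 → area u v (a • x + b • y) = a * area u v x + b * area u v y := by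
      intro a b hab
      simp only [area, Prod.fst_add, Prod.snd_add, Prod.smul_fst, Prod.smul_snd, smul_eq_mul]
      linear_combination ((v.1 - u.1) * u.2 - (v.2 - u.2) * u.1) * hab
    rw [e _ _ (by field_simp; ring)]
    field_simp; ring
  cases s
  · exact absurd rfl hs
  · obtain ⟨z, hz, h⟩ := key y x (sign_eq_neg_one_iff.1 hy) (sign_eq_one_iff.1 hx)
    exact ⟨z, segment_symm ℝ x y ▸ hz, h⟩
  · exact key x y (sign_eq_neg_one_iff.1 hx) (sign_eq_one_iff.1 hy)

/-- Two lines that divide four points into four quadrants cross in the convex hull. -/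
theorem exists_mem_hull_of_quadrants {Q : Fin 4 → ℝ × ℝ} {u v u' v' : ℝ × ℝ} {s t : SignType}
    (hs : s ≠ 0) (ht : t ≠ 0)
    (h : ∀ c, SignType.sign (area u v (Q c)) = SignType.sign (xCoord c) * s)
    (h' : ∀ c, SignType.sign (area u' v' (Q c)) = SignType.sign (yCoord c) * t) :
    ∃ z ∈ convexHull ℝ (Set.range Q), area u v z = 0 ∧ area u' v' z = 0 := by
  have hull : ∀ c, Q c ∈ convexHull ℝ (Set.range Q) :=
    fun c => subset_convexHull ℝ _ (Set.mem_range_self c)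
  have seg : ∀ {x y}, x ∈ convexHull ℝ (Set.range Q) → y ∈ convexHull ℝ (Set.range Q) →
      segment ℝ x y ⊆ convexHull ℝ (Set.range Q) :=
    fun hx hy => (convex_convexHull ℝ _).segment_subset hx hy
  have x0 : SignType.sign (xCoord 0) = -1 := by decide
  have x1 : SignType.sign (xCoord 1) = -1 := by decide
  have x2 : SignType.sign (xCoord 2) = 1 := by decide
  have x3 : SignType.sign (xCoord 3) = 1 := by decide
  have y0 : SignType.sign (yCoord 0) = -1 := by decide
  have y1 : SignType.sign (yCoord 1) = 1 := by decide
  have y2 : SignType.sign (yCoord 2) = -1 := by decide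
  have y3 : SignType.sign (yCoord 3) = 1 := by decide
  -- The points `z` (between cluster points 0 and 1) and `w` (between 2 and 3) are on the second
  -- line and on opposite sides of the first one. So the first line meets the segment from `z` to
  -- `w`, which stays in the second line.
  obtain ⟨z, hz, ez⟩ := exists_area_eq_zero_of_sign ht (by rw [h' 0, y0, neg_one_mul])
    (by rw [h' 1, y1, one_mul])
  obtain ⟨w, hw, ew⟩ := exists_area_eq_zero_of_sign ht (by rw [h' 2, y2, neg_one_mul])
    (by rw [h' 3, y3, one_mul])
  have sz : SignType.sign (area u v z) = -s :=
    (convex_sign_eq u v (-s)).segment_subset (by simp [h, x0]) (by simp [h, x1]) hz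
  have sw : SignType.sign (area u v w) = s :=
    (convex_sign_eq u v s).segment_subset (by simp [h, x2]) (by simp [h, x3]) hw
  obtain ⟨r, hr, er⟩ := exists_area_eq_zero_of_sign hs sz sw
  refine ⟨r, seg (seg (hull _) (hull _) hz) (seg (hull _) (hull _) hw) hr, er, ?_⟩
  exact sign_eq_zero_iff.1 ((convex_sign_eq u' v' 0).segment_subset (by simp [ez]) (by simp [ew]) hr)

theorem chi_self_left (T : ℕ → ℕ → ℕ → SignType) (i k : ℕ) : chi T i k i = 0 := by
  unfold chi
  split_ifs <;> first | omega | rfl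

theorem chi_self_right (T : ℕ → ℕ → ℕ → SignType) (i k : ℕ) : chi T i k k = 0 := by
  unfold chi
  split_ifs <;> first | omega | rfl

theorem chi_swap_right (T : ℕ → ℕ → ℕ → SignType) (i j k : ℕ) : chi T i k j = -chi T i j k := by
  unfold chi
  split_ifs <;> first | omega | simp

section

variable {n : ℕ} {T : ℕ → ℕ → ℕ → SignType} {p : ℕ → ℝ × ℝ} {al be : ℕ → ℕ}

/-- If the two points were distinct, all points would lie on their line, and `0, 1, 2` would be
collinear. -/
theorem Realizes.eq_of_line (hp : Realizes n T p) (hn : 3 ≤ n) (h012 : T 0 1 2 ≠ 0) {i j : ℕ}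
    (hi : i < n) (hj : j < n) (h : ∀ c < n, chi T i j c = 0) : p i = p j := by
  by_contra hne
  have h' : ∀ c < n, area (p i) (p j) (p c) = 0 := fun c hc =>
    (hp.chi_eq_zero hi hj hc).1 (h c hc)
  apply h012
  rw [← hp 0 1 2 (by omega) (by omega) (by omega), sign_eq_zero_iff]
  exact area_eq_zero_of_line hne (h' 0 (by omega)) (h' 1 (by omega)) (h' 2 (by omega))

/-- Nonzero prescribed signs are constant on the cluster and so hold on its whole hull. A zero sign
comes from a coincident pair or from one of two lines, the one through `al m` and the one through
`be m`. The cluster lies around the first line according to `yCoord` and around the second one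
according to `xCoord`, so a suitable point of the hull is on both. -/
theorem exists_next_point {m : ℕ} (hp : Realizes m T p) (hm : 4 ≤ m) (h012 : T 0 1 2 ≠ 0)
    (hg : Good T m (al m) (be m)) {Q : Fin 4 → ℝ × ℝ}
    (hQ : ∀ i j c, i < j → j < m → lineSign T al be i j m c ≠ 0 →
      SignType.sign (area (p i) (p j) (Q c)) = lineSign T al be i j m c) :
    ∃ z ∈ convexHull ℝ (Set.range Q), ∀ i j, i < j → j < m →
      SignType.sign (area (p i) (p j) z) = T i j m := by
  obtain ⟨ha, hb, hab, hg⟩ := hg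
  set α := al m with hα
  set β := be m with hβ
  suffices h : ∃ z ∈ convexHull ℝ (Set.range Q), ∀ i j, i < j → j < m → chi T i j m = 0 →
      p i = p j ∨ area (p i) (p j) z = 0 by
    obtain ⟨z, hz, h⟩ := h
    refine ⟨z, hz, fun i j hij hj => ?_⟩
    rw [← chi_of_lt (T := T) hij hj]
    by_cases h0 : chi T i j m = 0
    · rw [h0, sign_eq_zero_iff]
      rcases h i j hij hj h0 with e | e
      · rw [e, area_self_left]
      · exact e
    · have hl : ∀ c, lineSign T al be i j m c = chi T i j m := fun c => leadSign_of_ne_zero h0 _ _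
      refine sign_area_of_mem_hull (fun c => ?_) hz
      rw [hQ i j c hij hj (by rw [hl]; exact h0), hl]
  -- Pairs with the same collinear indices span the same line of the points already chosen, so it
  -- suffices to treat one pair for each of the two lines.
  have hline : ∀ {i j i' j' e : ℕ} {z : ℝ × ℝ}, i < j → j < m → i' < j' → j' < m → e < m →
      chi T i j e ≠ 0 → (∀ c < m, chi T i j c = 0 ↔ chi T i' j' c = 0) →
      area (p i) (p j) z = 0 → area (p i') (p j') z = 0 := by
    intro i j i' j' e z hij hj hij' hj' he hne hs hz
    have hi : i < m := hij.trans hj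
    have hi' : i' < m := hij'.trans hj'
    exact area_eq_zero_of_line (hp.ne_of_chi_ne_zero hi hj he hne)
      ((hp.chi_eq_zero hi hj hi').1 ((hs _ hi').2 (chi_self_left _ _ _)))
      ((hp.chi_eq_zero hi hj hj').1 ((hs _ hj').2 (chi_self_right _ _ _))) hz
  -- On the line through `α` and `m` the first two coefficients of `lineSign` vanish. As `β` is off
  -- this line, `yCoord` decides.
  have hA : ∀ {i j : ℕ}, i < j → j < m → chi T i j m = 0 →
      (∀ c < m, chi T i j c = 0 ↔ chi T α m c = 0) → chi T i j β ≠ 0 ∧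
      ∀ c, SignType.sign (area (p i) (p j) (Q c)) =
        SignType.sign (yCoord c) * chi T i j β := by
    intro i j hij hj h0 hs
    have h1 : chi T i j α = 0 := (hs α ha).2 (chi_self_left _ _ _)
    have h2 : chi T i j β ≠ 0 := by
      rw [Ne, hs β hb, chi_swap_right, SignType.neg_eq_zero_iff]; exact hab
    have hl : ∀ c, lineSign T al be i j m c = SignType.sign (yCoord c) * chi T i j β := by
      intro c
      rw [lineSign, h0, ← hα, h1, leadSign_zero_left, mul_zero, leadSign_zero_left,
        leadSign_of_ne_zero]
      exact mul_ne_zero (sign_yCoord_ne_zero c) h2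
    refine ⟨h2, fun c => ?_⟩
    rw [hQ i j c hij hj, hl]
    rw [hl]
    exact mul_ne_zero (sign_yCoord_ne_zero c) h2
  -- The line through `β` and `m` misses `α`, so the coefficient with `xCoord` decides.
  have hB : ∀ {i j : ℕ}, i < j → j < m → chi T i j m = 0 →
      (∀ c < m, chi T i j c = 0 ↔ chi T β m c = 0) → chi T i j α ≠ 0 ∧
      ∀ c, SignType.sign (area (p i) (p j) (Q c)) =
        SignType.sign (xCoord c) * chi T i j α := by
    intro i j hij hj h0 hs
    have h2 : chi T i j α ≠ 0 := by
      rw [Ne, hs α ha, chi_swap_right, SignType.neg_eq_zero_iff, chi_swap, SignType.neg_eq_zero_iff]; exact hab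
    have hl : ∀ c, lineSign T al be i j m c = SignType.sign (xCoord c) * chi T i j α := by
      intro c
      rw [lineSign, h0, leadSign_zero_left, leadSign_of_ne_zero]
      exact mul_ne_zero (sign_xCoord_ne_zero c) h2
    refine ⟨h2, fun c => ?_⟩
    rw [hQ i j c hij hj, hl]
    rw [hl]
    exact mul_ne_zero (sign_xCoord_ne_zero c) h2
  have hcases : ∀ i j, i < j → j < m → chi T i j m = 0 → p i = p j ∨
      (∀ c < m, chi T i j c = 0 ↔ chi T α m c = 0) ∨
      (∀ c < m, chi T i j c = 0 ↔ chi T β m c = 0) := by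
    intro i j hij hj h0
    rcases hg i (hij.trans hj) j hj hij h0 with h | h
    · exact Or.inl (hp.eq_of_line (by omega) h012 (hij.trans hj) hj h)
    · exact Or.inr h
  have hull : ∀ c, Q c ∈ convexHull ℝ (Set.range Q) :=
    fun c => subset_convexHull ℝ _ (Set.mem_range_self c)
  have seg : ∀ {x y}, x ∈ convexHull ℝ (Set.range Q) → y ∈ convexHull ℝ (Set.range Q) →
      segment ℝ x y ⊆ convexHull ℝ (Set.range Q) :=
    fun hx hy => (convex_convexHull ℝ _).segment_subset hx hy
  obtain ⟨z, hz, h1, h2⟩ : ∃ z ∈ convexHull ℝ (Set.range Q),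
      (∀ i j, i < j → j < m → chi T i j m = 0 →
        (∀ c < m, chi T i j c = 0 ↔ chi T α m c = 0) → area (p i) (p j) z = 0) ∧
      (∀ i j, i < j → j < m → chi T i j m = 0 →
        (∀ c < m, chi T i j c = 0 ↔ chi T β m c = 0) → area (p i) (p j) z = 0) := by
    by_cases eA : ∃ i j, i < j ∧ j < m ∧ chi T i j m = 0 ∧
        ∀ c < m, chi T i j c = 0 ↔ chi T α m c = 0
    · obtain ⟨i, j, hij, hj, h0, hs⟩ := eA
      obtain ⟨hne, hsg⟩ := hA hij hj h0 hs
      by_cases eB : ∃ i j, i < j ∧ j < m ∧ chi T i j m = 0 ∧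
          ∀ c < m, chi T i j c = 0 ↔ chi T β m c = 0
      · obtain ⟨i', j', hij', hj', h0', hs'⟩ := eB
        obtain ⟨hne', hsg'⟩ := hB hij' hj' h0' hs'
        obtain ⟨z, hz, e', e⟩ := exists_mem_hull_of_quadrants hne' hne hsg' hsg
        refine ⟨z, hz, fun k l hkl hl _ ht => ?_, fun k l hkl hl _ ht => ?_⟩
        · exact hline hij hj hkl hl hb hne (fun c hc => (hs c hc).trans (ht c hc).symm) e
        · exact hline hij' hj' hkl hl ha hne' (fun c hc => (hs' c hc).trans (ht c hc).symm) e'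
      -- With only one line to meet, two cluster points on opposite sides suffice: 0 and 1 differ in
      -- the sign of `yCoord`. In the symmetric case below, 0 and 2 differ in that of `xCoord`.
      · obtain ⟨z, hz, e⟩ := exists_area_eq_zero_of_sign (x := Q 0) (y := Q 1) hne
          (by rw [hsg, show SignType.sign (yCoord 0) = -1 by decide, neg_one_mul])
          (by rw [hsg, show SignType.sign (yCoord 1) = 1 by decide, one_mul])
        refine ⟨z, seg (hull _) (hull _) hz, fun k l hkl hl _ ht => ?_,
          fun k l hkl hl h ht => absurd ⟨k, l, hkl, hl, h, ht⟩ eB⟩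
        exact hline hij hj hkl hl hb hne (fun c hc => (hs c hc).trans (ht c hc).symm) e
    · by_cases eB : ∃ i j, i < j ∧ j < m ∧ chi T i j m = 0 ∧
          ∀ c < m, chi T i j c = 0 ↔ chi T β m c = 0
      · obtain ⟨i', j', hij', hj', h0', hs'⟩ := eB
        obtain ⟨hne', hsg'⟩ := hB hij' hj' h0' hs'
        obtain ⟨z, hz, e⟩ := exists_area_eq_zero_of_sign (x := Q 0) (y := Q 2) hne'
          (by rw [hsg', show SignType.sign (xCoord 0) = -1 by decide, neg_one_mul])
          (by rw [hsg', show SignType.sign (xCoord 2) = 1 by decide, one_mul])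
        refine ⟨z, seg (hull _) (hull _) hz,
          fun k l hkl hl h ht => absurd ⟨k, l, hkl, hl, h, ht⟩ eA, fun k l hkl hl _ ht => ?_⟩
        exact hline hij' hj' hkl hl ha hne' (fun c hc => (hs' c hc).trans (ht c hc).symm) e
      · exact ⟨Q 0, hull 0, fun k l hkl hl h ht => absurd ⟨k, l, hkl, hl, h, ht⟩ eA,
          fun k l hkl hl h ht => absurd ⟨k, l, hkl, hl, h, ht⟩ eB⟩
  refine ⟨z, hz, fun i j hij hj h0 => ?_⟩
  rcases hcases i j hij hj h0 with h | h | h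
  · exact Or.inl h
  · exact Or.inr (h1 i j hij hj h0 h)
  · exact Or.inr (h2 i j hij hj h0 h)

/-- Points with the signs `T` can be recovered from the clusters. -/
theorem exists_realizes_of_clusters
    (hfirst : ∀ i j k, i < j → j < k → k < 4 → k < n → T i j k ≠ 0)
    (hgood : ∀ k, 4 ≤ k → k < n → Good T k (al k) (be k)) {Q : ℕ → Fin 4 → ℝ × ℝ}
    (hQ : ∀ i a j b k c, i < j → j < k → k < n → lineSign T al be i j k c ≠ 0 →
      SignType.sign (area (Q i a) (Q j b) (Q k c)) = lineSign T al be i j k c) :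
    ∃ p, Realizes n T p := by
  suffices h : ∀ m ≤ n, ∃ p : ℕ → ℝ × ℝ,
      (∀ k < m, p k ∈ convexHull ℝ (Set.range (Q k))) ∧ Realizes m T p by
    obtain ⟨p, -, hp⟩ := h n le_rfl
    exact ⟨p, hp⟩
  intro m
  induction m with
  | zero => exact fun _ => ⟨fun _ => 0, fun k hk => by omega, fun i j k _ _ hk => by omega⟩
  | succ m ih =>
    intro hm
    obtain ⟨p, hp1, hp2⟩ := ih (by omega)
    have hQ' : ∀ i j c, i < j → j < m → lineSign T al be i j m c ≠ 0 →
        SignType.sign (area (p i) (p j) (Q m c)) = lineSign T al be i j m c := by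
      intro i j c hij hj hne
      -- The cluster points of `i` and `j` are replaced by `p i` and `p j` one at a time; each
      -- rotation brings the point to be replaced into the last place.
      rw [← area_rotate]
      refine sign_area_of_mem_hull (fun a => ?_) (hp1 i (by omega))
      rw [← area_rotate]
      refine sign_area_of_mem_hull (fun b => ?_) (hp1 j (by omega))
      rw [← area_rotate]
      exact hQ i a j b m c hij hj (by omega) hne
    obtain ⟨z, hz, hsz⟩ : ∃ z ∈ convexHull ℝ (Set.range (Q m)), ∀ i j, i < j → j < m →
        SignType.sign (area (p i) (p j) z) = T i j m := by
      by_cases h4 : m < 4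
      -- Among the first four points no sign is zero, so any cluster point will do.
      · refine ⟨Q m 0, subset_convexHull ℝ _ (Set.mem_range_self 0), fun i j hij hj => ?_⟩
        have h0 := hfirst i j m hij hj h4 (by omega)
        have hl : lineSign T al be i j m 0 = T i j m := by
          rw [← chi_of_lt (T := T) hij hj] at h0 ⊢
          exact leadSign_of_ne_zero h0 _ _
        rw [hQ' i j 0 hij hj (by rw [hl]; exact h0), hl]
      · exact exists_next_point hp2 (by omega) (hfirst 0 1 2 (by omega) (by omega) (by omega)
          (by omega)) (hgood m (by omega) (by omega)) hQ'
    refine ⟨Function.update p m z, fun k hk => ?_, fun i j k hij hjk hk => ?_⟩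
    · rcases Nat.lt_succ_iff_lt_or_eq.1 hk with h | rfl
      · rw [Function.update_of_ne h.ne]; exact hp1 k h
      · rw [Function.update_self]; exact hz
    · rw [Function.update_of_ne (by omega : i ≠ m), Function.update_of_ne (by omega : j ≠ m)]
      rcases Nat.lt_succ_iff_lt_or_eq.1 hk with h | rfl
      · rw [Function.update_of_ne h.ne]; exact hp2 i j k hij hjk h
      · rw [Function.update_self]; exact hsz i j hij hjk

/-! ### Existence of good pairs -/

/-- A good pair exists if at most two lines pass through the point. -/
theorem Realizes.exists_good (hp : Realizes n T p) {k : ℕ} (hk : 4 ≤ k) (hkn : k < n)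
    (h012 : T 0 1 2 ≠ 0)
    (hlines : ∀ i j i' j' i'' j'', i < j → j < k → i' < j' → j' < k → i'' < j'' → j'' < k →
      chi T i j k = 0 → chi T i' j' k = 0 → chi T i'' j'' k = 0 →
      (∃ c < k, chi T i j c ≠ 0) → (∃ c < k, chi T i' j' c ≠ 0) → (∃ c < k, chi T i'' j'' c ≠ 0) →
      (∀ c < k, chi T i j c = 0 ↔ chi T i' j' c = 0) ∨
      (∀ c < k, chi T i'' j'' c = 0 ↔ chi T i j c = 0) ∨
      (∀ c < k, chi T i'' j'' c = 0 ↔ chi T i' j' c = 0)) :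
    ∃ a b, Good T k a b := by
  have z : ∀ {i j l : ℕ}, i ≤ k → j ≤ k → l ≤ k →
      (chi T i j l = 0 ↔ area (p i) (p j) (p l) = 0) :=
    fun hi hj hl => hp.chi_eq_zero (by omega) (by omega) (by omega)
  -- Otherwise all points before `k` would lie on the line through `p a` and `p k`, among them the
  -- noncollinear `0, 1, 2`.
  have hside : ∀ a < k, p a ≠ p k → ∃ b < k, chi T a b k ≠ 0 := by
    intro a ha hne
    by_contra! hcon
    refine hne ((hp.mono (m := k + 1) (by omega)).eq_of_line (by omega) h012 (by omega) (by omega)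
      fun c hc => ?_)
    rcases Nat.lt_succ_iff_lt_or_eq.1 hc with h | rfl
    · rw [chi_swap_right, hcon c h, neg_zero]
    · exact chi_self_right _ _ _
  -- One of the distinct points `p i`, `p j` differs from `p k`. Together with `p k` it spans the
  -- same line.
  have hrep : ∀ i j, i < j → j < k → chi T i j k = 0 → (∃ c < k, chi T i j c ≠ 0) →
      ∃ e < k, p e ≠ p k ∧ ∀ c < k, chi T i j c = 0 ↔ chi T e k c = 0 := by
    intro i j hij hj h0 ⟨d, hd, hne⟩
    have hij' : p i ≠ p j := hp.ne_of_chi_ne_zero (by omega) (by omega) (by omega) hne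
    have key : ∀ e < k, chi T i j e = 0 → p e ≠ p k → ∃ e < k, p e ≠ p k ∧
        ∀ c < k, chi T i j c = 0 ↔ chi T e k c = 0 := by
      intro e he h1 h2
      refine ⟨e, he, h2, fun c hc => ?_⟩
      rw [z (by omega) hj.le le_rfl] at h0
      rw [z (by omega) hj.le he.le] at h1
      rw [z (by omega) hj.le hc.le, z he.le le_rfl hc.le]
      constructor
      · exact fun h => area_eq_zero_of_line hij' h1 h0 h
      · intro h
        have hei : area (p e) (p k) (p i) = 0 :=
          area_eq_zero_of_line hij' h1 h0 (area_self_outer _ _)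
        have hej : area (p e) (p k) (p j) = 0 :=
          area_eq_zero_of_line hij' h1 h0 (area_self_right _ _)
        exact area_eq_zero_of_line h2 hei hej h
    by_cases hik : p i = p k
    · exact key j hj (chi_self_right _ _ _) fun h => hij' (hik.trans h.symm)
    · exact key i (by omega) (chi_self_left _ _ _) hik
  by_cases h1 : ∃ i j, i < j ∧ j < k ∧ chi T i j k = 0 ∧ ∃ c < k, chi T i j c ≠ 0
  · obtain ⟨i, j, hij, hj, h0, hne⟩ := h1
    obtain ⟨a, ha, hak, hs⟩ := hrep i j hij hj h0 hne
    by_cases h2 : ∃ i' j', i' < j' ∧ j' < k ∧ chi T i' j' k = 0 ∧ (∃ c < k, chi T i' j' c ≠ 0) ∧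
        ¬ ∀ c < k, chi T i' j' c = 0 ↔ chi T a k c = 0
    · obtain ⟨i', j', hij', hj', h0', hne', hdiff⟩ := h2
      obtain ⟨b, hb, hbk, hs'⟩ := hrep i' j' hij' hj' h0' hne'
      -- Two different lines through `k` give the pair: if `a, b, k` were collinear, the lines would
      -- agree. The hypothesis `hlines` excludes a third line.
      refine ⟨a, b, ha, hb, fun hab => hdiff fun c hc => ?_, fun i'' _ j'' hj'' hij'' h0'' => ?_⟩
      · rw [hs' c hc, z hb.le le_rfl hc.le, z ha.le le_rfl hc.le]
        rw [z ha.le hb.le le_rfl] at hab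
        have e1 : area (p a) (p k) (p b) = 0 := by
          simp only [area] at *; linarith
        have e2 : area (p b) (p k) (p a) = 0 := by
          simp only [area] at *; linarith
        exact ⟨fun h => area_eq_zero_of_line hbk e2 (area_self_right _ _) h,
          fun h => area_eq_zero_of_line hak e1 (area_self_right _ _) h⟩
      · by_cases ht : ∃ c < k, chi T i'' j'' c ≠ 0
        · right
          rcases hlines i j i' j' i'' j'' hij hj hij' hj' hij'' hj'' h0 h0' h0'' hne hne' ht with
            h | h | h
          · exact absurd (fun c hc => (h c hc).symm.trans (hs c hc)) hdiff
          · exact Or.inl fun c hc => (h c hc).trans (hs c hc)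
          · exact Or.inr fun c hc => (h c hc).trans (hs' c hc)
        · push Not at ht
          exact Or.inl ht
    -- If there is only one line, `b` may be any point off it.
    · obtain ⟨b, hb, hab⟩ := hside a ha hak
      refine ⟨a, b, ha, hb, hab, fun i' _ j' hj' hij' h0' => ?_⟩
      by_cases ht : ∃ c < k, chi T i' j' c ≠ 0
      · right; left
        by_contra hcon
        exact h2 ⟨i', j', hij', hj', h0', ht, hcon⟩
      · push Not at ht
        exact Or.inl ht
  -- If there is no line through `k`, any pair not collinear with `k` is good.
  · obtain ⟨a, ha, hak⟩ : ∃ a < k, p a ≠ p k := by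
      by_contra! hcon
      apply h012
      rw [← hp 0 1 2 (by omega) (by omega) (by omega), hcon 0 (by omega), hcon 1 (by omega),
        area_self_left, sign_zero]
    obtain ⟨b, hb, hab⟩ := hside a ha hak
    refine ⟨a, b, ha, hb, hab, fun i _ j hj hij h0 => Or.inl ?_⟩
    by_contra! hcon
    exact h1 ⟨i, j, hij, hj, h0, hcon⟩

end

end

/-! ### Structured stack programs as Turing machines -/

open Turing

/-- Structured programs on stacks over the alphabet `A`, with internal states `σ`. -/
inductive StackProg (K A σ : Type) : Type
  | push (k : K) (f : σ → A)
  | pop (k : K) (f : σ → Option A → σ)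
  | load (f : σ → σ)
  | seq (P Q : StackProg K A σ)
  | ite (c : σ → Bool) (P Q : StackProg K A σ)
  | whileNonempty (k : K) (P : StackProg K A σ)

namespace StackProg

variable {K A σ : Type}

/-- The labels of the Turing machine that executes a program. -/
def Label : StackProg K A σ → Type
  | push _ _ => Unit
  | pop _ _ => Unit
  | load _ => Unit
  | seq P Q => P.Label ⊕ Q.Label
  | ite _ P Q => Option (P.Label ⊕ Q.Label)
  | whileNonempty _ P => Option P.Label

instance fintypeLabel : (P : StackProg K A σ) → Fintype P.Label
  | push _ _ => inferInstanceAs (Fintype Unit)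
  | pop _ _ => inferInstanceAs (Fintype Unit)
  | load _ => inferInstanceAs (Fintype Unit)
  | seq P Q =>
    letI := fintypeLabel P
    letI := fintypeLabel Q
    inferInstanceAs (Fintype (P.Label ⊕ Q.Label))
  | ite _ P Q =>
    letI := fintypeLabel P
    letI := fintypeLabel Q
    inferInstanceAs (Fintype (Option (P.Label ⊕ Q.Label)))
  | whileNonempty _ P =>
    letI := fintypeLabel P
    inferInstanceAs (Fintype (Option P.Label))

/-- The label at which the execution starts. -/
def start : (P : StackProg K A σ) → P.Label
  | push _ _ => ()
  | pop _ _ => ()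
  | load _ => ()
  | seq P _ => Sum.inl P.start
  | ite _ _ _ => (none : Option _)
  | whileNonempty _ _ => (none : Option _)

/-- The Turing machine statements that execute a program and then go to the label `e`.  The
Boolean component of the state is used by the emptiness tests. -/
def code {L : Type} : (P : StackProg K A σ) → (P.Label → L) → L → P.Label →
    TM2.Stmt (fun _ : K => A) L (σ × Bool)
  | push k f, _, e, _ => .push k (fun v => f v.1) (.goto fun _ => e)
  | pop k f, _, e, _ => .pop k (fun v o => (f v.1 o, v.2)) (.goto fun _ => e)
  | load f, _, e, _ => .load (fun v => (f v.1, v.2)) (.goto fun _ => e)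
  | seq P Q, emb, e, l => Sum.rec (fun l => P.code (fun l => emb (Sum.inl l)) (emb (Sum.inr Q.start)) l)
      (fun l => Q.code (fun l => emb (Sum.inr l)) e l) l
  | ite c P Q, emb, e, l => Option.rec
      (.branch (fun v => c v.1) (.goto fun _ => emb (some (Sum.inl P.start)))
        (.goto fun _ => emb (some (Sum.inr Q.start))))
      (fun l => Sum.rec (fun l => P.code (fun l => emb (some (Sum.inl l))) e l)
        (fun l => Q.code (fun l => emb (some (Sum.inr l))) e l) l) l
  | whileNonempty k P, emb, e, l => Option.rec
      (.peek k (fun v o => (v.1, o.isSome)) (.branch (fun v => v.2)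
        (.load (fun v => (v.1, false)) (.goto fun _ => emb (some P.start)))
        (.goto fun _ => e)))
      (fun l => P.code (fun l => emb (some l)) (emb none) l) l

variable [DecidableEq K]

/-- The program `P` leads from `s` to `s'` in at most `t` steps, in whatever machine it is
embedded. -/
def Runs (P : StackProg K A σ) (s s' : σ × (K → List A)) (t : ℕ) : Prop :=
  ∀ (L : Type) (M : L → TM2.Stmt (fun _ : K => A) L (σ × Bool)) (emb : P.Label → L) (e : L),
    (∀ l, M (emb l) = P.code emb e l) → ∃ t' ≤ t,
      (flip bind (TM2.step M))^[t'] (some ⟨some (emb P.start), (s.1, false), s.2⟩) =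
        some ⟨some e, (s'.1, false), s'.2⟩

theorem Runs.mono {P : StackProg K A σ} {s s' : σ × (K → List A)} {t t' : ℕ} (h : P.Runs s s' t)
    (ht : t ≤ t') : P.Runs s s' t' := by
  intro L M emb e hM
  obtain ⟨u, hu, h⟩ := h L M emb e hM
  exact ⟨u, hu.trans ht, h⟩

theorem Runs.congr_right {P : StackProg K A σ} {s s' s'' : σ × (K → List A)} {t : ℕ}
    (h : P.Runs s s' t) (e : s' = s'') : P.Runs s s'' t := e ▸ h

theorem runs_push (k : K) (f : σ → A) (v : σ) (S : K → List A) :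
    (push k f).Runs (v, S) (v, Function.update S k (f v :: S k)) 1 := by
  intro L M emb e hM
  refine ⟨1, le_rfl, ?_⟩
  have := hM ()
  simp only [code] at this
  simp [flip, start, this]

theorem runs_pop (k : K) (f : σ → Option A → σ) (v : σ) (S : K → List A) :
    (pop k f).Runs (v, S) (f v (S k).head?, Function.update S k (S k).tail) 1 := by
  intro L M emb e hM
  refine ⟨1, le_rfl, ?_⟩
  have := hM ()
  simp only [code] at this
  simp [flip, start, this]

theorem runs_load (f : σ → σ) (v : σ) (S : K → List A) :
    (load f).Runs (v, S) (f v, S) 1 := by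
  intro L M emb e hM
  refine ⟨1, le_rfl, ?_⟩
  have := hM ()
  simp only [code] at this
  simp [flip, start, this]

/-- The quantification over all embeddings in `Runs` pays off here: the first program is run with
the start label of the second one as its exit. -/
theorem Runs.seq {P Q : StackProg K A σ} {s s' s'' : σ × (K → List A)} {t t' : ℕ}
    (hP : P.Runs s s' t) (hQ : Q.Runs s' s'' t') : (P.seq Q).Runs s s'' (t + t') := by
  intro L M emb e hM
  obtain ⟨u, hu, h⟩ := hP L M (fun l => emb (Sum.inl l)) (emb (Sum.inr Q.start))
    fun l => hM (Sum.inl l)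
  obtain ⟨u', hu', h'⟩ := hQ L M (fun l => emb (Sum.inr l)) e fun l => hM (Sum.inr l)
  refine ⟨u' + u, by omega, ?_⟩
  rw [Function.iterate_add_apply]
  exact (congrArg _ h).trans h'

theorem Runs.ite_true {c : σ → Bool} {P Q : StackProg K A σ} {s s' : σ × (K → List A)} {t : ℕ}
    (hc : c s.1 = true) (hP : P.Runs s s' t) : (StackProg.ite c P Q).Runs s s' (1 + t) := by
  intro L M emb e hM
  obtain ⟨u, hu, h⟩ := hP L M (fun l => emb (some (Sum.inl l))) e fun l => hM (some (Sum.inl l))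
  refine ⟨u + 1, by omega, ?_⟩
  rw [Function.iterate_succ_apply]
  have := hM (none : Option _)
  simp only [code] at this
  simp only [flip, start, Option.bind_eq_bind, Option.bind_some, TM2.step]
  rw [this]
  simpa [hc] using h

theorem Runs.ite_false {c : σ → Bool} {P Q : StackProg K A σ} {s s' : σ × (K → List A)} {t : ℕ}
    (hc : c s.1 = false) (hQ : Q.Runs s s' t) : (StackProg.ite c P Q).Runs s s' (1 + t) := by
  intro L M emb e hM
  obtain ⟨u, hu, h⟩ := hQ L M (fun l => emb (some (Sum.inr l))) e fun l => hM (some (Sum.inr l))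
  refine ⟨u + 1, by omega, ?_⟩
  rw [Function.iterate_succ_apply]
  have := hM (none : Option _)
  simp only [code] at this
  simp only [flip, start, Option.bind_eq_bind, Option.bind_some, TM2.step]
  rw [this]
  simpa [hc] using h

theorem runs_while_nil {k : K} {P : StackProg K A σ} (v : σ) {S : K → List A} (hk : S k = []) :
    (whileNonempty k P).Runs (v, S) (v, S) 1 := by
  intro L M emb e hM
  refine ⟨1, le_rfl, ?_⟩
  have := hM (none : Option _)
  simp only [code] at this
  simp only [flip, start, Option.bind_eq_bind, Option.bind_some, TM2.step, Function.iterate_one]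
  rw [this]
  simp [hk]

/-- One step tests the stack, and the body exits to the label of the loop. The test bit is reset to
`false`, as `Runs` demands at both ends. -/
theorem Runs.while_cons {k : K} {P : StackProg K A σ} {s s' s'' : σ × (K → List A)} {t t' : ℕ}
    (hk : s.2 k ≠ []) (hP : P.Runs s s' t) (hW : (whileNonempty k P).Runs s' s'' t') :
    (whileNonempty k P).Runs s s'' (1 + t + t') := by
  intro L M emb e hM
  obtain ⟨u, hu, h⟩ := hP L M (fun l => emb (some l)) (emb none) fun l => hM (some l)
  obtain ⟨u', hu', h'⟩ := hW L M emb e hM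
  refine ⟨u' + (u + 1), by omega, ?_⟩
  rw [Function.iterate_add_apply, Function.iterate_succ_apply]
  have := hM (none : Option _)
  simp only [code] at this
  obtain ⟨a, l, hl⟩ := List.exists_cons_of_ne_nil hk
  refine (congrArg _ ?_).trans h'
  refine (congrArg _ ?_).trans h
  simp only [flip, start, Option.bind_eq_bind, Option.bind_some, TM2.step]
  rw [this]
  simp [hl]

/-- The machine that executes a program and halts. -/
def machine [Fintype K] [Fintype A] [Fintype σ] (P : StackProg K A σ) (k₀ k₁ : K) (v : σ) :
    FinTM2 where
  K := K
  k₀ := k₀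
  k₁ := k₁
  Γ _ := A
  Λ := Option P.Label
  main := some P.start
  σ := σ × Bool
  initialState := (v, false)
  m l := Option.rec TM2.Stmt.halt (P.code some none) l

/-- Only the stack `k₀` is nonempty, and its content is `x`. -/
def singleStack (k₀ : K) (x : List A) : K → List A := fun k => if k = k₀ then x else []

/-- The exit label is `none`, where the machine has the halting statement; executing it is the one
additional step. -/
theorem Runs.outputsInTime [Fintype K] [Fintype A] [Fintype σ] {P : StackProg K A σ} {k₀ k₁ : K}
    {v : σ} {x y : List A} {t : ℕ} (h : P.Runs (v, singleStack k₀ x) (v, singleStack k₁ y) t) :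
    Nonempty (TM2OutputsInTime (P.machine k₀ k₁ v) x (some y) (t + 1)) := by
  obtain ⟨u, hu, h⟩ := h _ (P.machine k₀ k₁ v).m some none fun _ => rfl
  have e : initList (P.machine k₀ k₁ v) x =
      TM2.Cfg.mk (some (some P.start)) (v, false) (singleStack k₀ x) := by
    refine congrArg (TM2.Cfg.mk (some (some P.start)) (v, false)) (funext fun k : K => ?_)
    by_cases hk : k = k₀
    · subst hk
      exact (dif_pos rfl).trans (if_pos rfl).symm
    · exact (dif_neg hk).trans (if_neg hk).symm
  have e' : haltList (P.machine k₀ k₁ v) y =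
      TM2.Cfg.mk none (v, false) (singleStack k₁ y) := by
    refine congrArg (TM2.Cfg.mk none (v, false)) (funext fun k : K => ?_)
    by_cases hk : k = k₁
    · subst hk
      exact (dif_pos rfl).trans (if_pos rfl).symm
    · exact (dif_neg hk).trans (if_neg hk).symm
  refine ⟨{ steps := u + 1, evals_in_steps := ?_, steps_le_m := Nat.succ_le_succ hu }⟩
  rw [Function.iterate_succ_apply']
  refine (congrArg (fun c => flip bind (P.machine k₀ k₁ v).step
    ((flip bind (P.machine k₀ k₁ v).step)^[u] (some c))) e).trans ?_
  refine (congrArg _ h).trans ?_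
  exact (congrArg some e').symm

end StackProg

/-! ### Moving stacks and comparing unary numbers -/

open Turing StackProg

set_option linter.unusedSimpArgs false

/-- The letters of encoded order types; `none` is the unary digit. -/
abbrev Letter := Option SignType

/-- The internal state of the programs below: the result of the last test, a flag, and the last
letter read. -/
@[ext]
structure Flags where
  /-- the result of the last test -/
  res : Bool
  /-- a flag -/
  flag : Bool
  /-- the last letter read -/
  letter : Option Letter

noncomputable instance : Fintype Flags :=
  Fintype.ofInjective (fun v : Flags => (v.res, v.flag, v.letter)) fun v w h => by
    simp only [Prod.mk.injEq] at h
    exact Flags.ext h.1 h.2.1 h.2.2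

/-- The initial internal state. -/
def Flags.init : Flags := ⟨false, false, none⟩

section

variable {K : Type} [DecidableEq K]

/-- Move a stack, reversed, onto another one. -/
def moveProg (k k' : K) : StackProg K Letter Flags :=
  seq (load fun v => ⟨v.res, v.flag, none⟩) (whileNonempty k
    (seq (pop k fun v o => ⟨v.res, v.flag, o⟩) (seq (push k' fun v => v.letter.join)
      (load fun v => ⟨v.res, v.flag, none⟩))))

/-- Each letter costs a test, a pop, a push and a load; the initial load and the last test add two
steps. -/
theorem runs_moveProg {k k' : K} (hk : k ≠ k') (v : Flags) (S : K → List Letter) :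
    (moveProg k k').Runs (v, S) (⟨v.res, v.flag, none⟩,
      Function.update (Function.update S k []) k' ((S k).reverse ++ S k')) (4 * (S k).length + 2) := by
  suffices h : ∀ (l : List Letter) (S : K → List Letter), S k = l →
      (whileNonempty k (seq (pop k fun v o => (⟨v.res, v.flag, o⟩ : Flags))
        (seq (push k' fun v => v.letter.join)
          (load fun v => ⟨v.res, v.flag, none⟩)))).Runs (⟨v.res, v.flag, none⟩, S)
        (⟨v.res, v.flag, none⟩, Function.update (Function.update S k []) k' (l.reverse ++ S k'))
        (4 * l.length + 1) by
    exact Runs.mono (Runs.seq (runs_load _ _ _) (h _ S rfl)) (by omega)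
  intro l
  induction l with
  | nil =>
    intro S hS
    convert! runs_while_nil _ hS using 1
    refine Prod.ext rfl ?_
    simp only [hS, List.reverse_nil, List.nil_append]
    simp [← hS]
  | cons a l ih =>
    intro S hS
    refine Runs.mono (t := 1 + (1 + (1 + 1)) + (4 * l.length + 1)) (Runs.while_cons (by simp [hS])
      (Runs.seq (runs_pop _ _ _ _) (Runs.seq (runs_push _ _ _ _) (runs_load _ _ _))) ?_)
      (by simp; omega)
    convert! ih _ _ using 2
    · funext i
      by_cases h1 : i = k'
      · subst h1; simp [hS, hk.symm]
      · by_cases h2 : i = k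
        · subst h2; simp [hk]
        · simp [h1, h2]
    · simp [hS, hk]

/-- Compare the heights of the stacks `x` and `y`, with auxiliary stacks `s` and `t`. -/
def ltProg (x y s t : K) : StackProg K Letter Flags :=
  seq (load fun v => ⟨false, v.flag, none⟩) (seq (moveProg x s) (seq
    (whileNonempty y (seq (pop y fun v _ => v) (seq (push t fun _ => none)
      (seq (pop s fun v o => ⟨v.res, v.flag, o⟩) (seq
        (ite (fun v => v.letter.isSome) (push x fun _ => none) (load fun v => ⟨true, v.flag, none⟩))
        (load fun v => ⟨v.res, v.flag, none⟩))))))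
    (seq (moveProg s x) (moveProg t y))))

/-- The digits of `x`, moved to `s`, are used up in step with those of `y`. The answer is yes if `s`
runs dry first. Nothing is lost, since digits of `s` return to `x` and those of `y` are kept on `t`.
-/
theorem runs_ltProg {x y s t : K} (hxy : x ≠ y) (hxs : x ≠ s) (hxt : x ≠ t) (hys : y ≠ s)
    (hyt : y ≠ t) (hst : s ≠ t) (v : Flags) (S : K → List Letter) {a b : ℕ}
    (hx : S x = List.replicate a none) (hy : S y = List.replicate b none)
    (hs : S s = []) (ht : S t = []) :
    (ltProg x y s t).Runs (v, S) (⟨decide (a < b), v.flag, none⟩, S) (8 * a + 11 * b + 8) := by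
  let F : ℕ → ℕ → ℕ → ℕ → K → List Letter := fun a b c d => Function.update (Function.update
    (Function.update (Function.update S x (List.replicate a none)) y (List.replicate b none))
    s (List.replicate c none)) t (List.replicate d none)
  have Fx : ∀ a b c d, F a b c d x = List.replicate a none := by intros; simp [F, *]
  have Fy : ∀ a b c d, F a b c d y = List.replicate b none := by intros; simp [F, *]
  have Fs : ∀ a b c d, F a b c d s = List.replicate c none := by intros; simp [F, *]
  have Ft : ∀ a b c d, F a b c d t = List.replicate d none := by intros; simp [F, *]
  have Fo : ∀ a b c d k, k ≠ x → k ≠ y → k ≠ s → k ≠ t → F a b c d k = S k := by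
    intros; simp [F, *]
  have Fext : ∀ (S' : K → List Letter) a b c d, S' x = List.replicate a none →
      S' y = List.replicate b none → S' s = List.replicate c none →
      S' t = List.replicate d none → (∀ k, k ≠ x → k ≠ y → k ≠ s → k ≠ t → S' k = S k) →
      S' = F a b c d := by
    intro S' a b c d h1 h2 h3 h4 h5
    funext k
    by_cases e1 : k = x
    · subst e1; rw [h1, Fx]
    by_cases e2 : k = y
    · subst e2; rw [h2, Fy]
    by_cases e3 : k = s
    · subst e3; rw [h3, Fs]
    by_cases e4 : k = t
    · subst e4; rw [h4, Ft]
    rw [h5 k e1 e2 e3 e4, Fo _ _ _ _ k e1 e2 e3 e4]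
  -- Loop invariant for arbitrary heights: of the `c` digits on `s`, `min b c` return to `x`, all
  -- `b` digits of `y` go to `t`, and the result becomes true when `c < b`.
  have hW : ∀ (b a c d : ℕ) (r : Bool), (whileNonempty y (seq (pop y fun v _ => v) (seq
      (push t fun _ => none) (seq (pop s fun v o => (⟨v.res, v.flag, o⟩ : Flags)) (seq
        (ite (fun v => v.letter.isSome) (push x fun _ => none) (load fun v => ⟨true, v.flag, none⟩))
        (load fun v => ⟨v.res, v.flag, none⟩)))))).Runs (⟨r, v.flag, none⟩, F a b c d)
      (⟨r || decide (c < b), v.flag, none⟩, F (a + min b c) 0 (c - b) (d + b)) (7 * b + 1) := by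
    intro b
    induction b with
    | zero =>
      intro a c d r
      convert! runs_while_nil _ (Fy a 0 c d) using 1
      simp
    | succ b ih =>
      intro a c d r
      cases c with
      | zero =>
        refine Runs.mono (Runs.while_cons (s' := (⟨true, v.flag, none⟩, F a b 0 (d + 1)))
          (t := 1 + (1 + (1 + (1 + 1 + 1)))) (t' := 7 * b + 1) (by simp [Fy]) ?_ ?_) (by omega)
        · refine (Runs.seq (runs_pop _ _ _ _) (Runs.seq (runs_push _ _ _ _)
            (Runs.seq (runs_pop _ _ _ _) (Runs.seq (Runs.ite_false ?_ (runs_load _ _ _)) ?_))))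
          · simp [Function.update_of_ne, hst, hys.symm, Fs]
          · refine (runs_load _ _ _).congr_right ?_
            refine Prod.ext rfl (Fext _ _ _ _ _ ?_ ?_ ?_ ?_ ?_)
            · simp [List.replicate_succ, hxy, hxs, hxt, hys, hyt, hst, hxy.symm, hxs.symm, hxt.symm,
          hys.symm, hyt.symm, hst.symm, Fx, Fy, Fs, Ft, Fo, hx, hy, hs, ht]
            · simp [List.replicate_succ, hxy, hxs, hxt, hys, hyt, hst, hxy.symm, hxs.symm, hxt.symm,
          hys.symm, hyt.symm, hst.symm, Fx, Fy, Fs, Ft, Fo, hx, hy, hs, ht]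
            · simp [List.replicate_succ, hxy, hxs, hxt, hys, hyt, hst, hxy.symm, hxs.symm, hxt.symm,
          hys.symm, hyt.symm, hst.symm, Fx, Fy, Fs, Ft, Fo, hx, hy, hs, ht]
            · simp [List.replicate_succ, hxy, hxs, hxt, hys, hyt, hst, hxy.symm, hxs.symm, hxt.symm,
          hys.symm, hyt.symm, hst.symm, Fx, Fy, Fs, Ft, Fo, hx, hy, hs, ht]
            · intro k h1 h2 h3 h4; simp [h1, h2, h3, h4, Fo]
        · convert! ih a 0 (d + 1) true using 2
          · simp
          · simp only [Nat.min_zero, Nat.zero_sub]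
            congr 1; omega
      | succ c =>
        refine Runs.mono (Runs.while_cons (s' := (⟨r, v.flag, none⟩, F (a + 1) b c (d + 1)))
          (t := 1 + (1 + (1 + (1 + 1 + 1)))) (t' := 7 * b + 1) (by simp [Fy]) ?_ ?_) (by omega)
        · refine (Runs.seq (runs_pop _ _ _ _) (Runs.seq (runs_push _ _ _ _)
            (Runs.seq (runs_pop _ _ _ _) (Runs.seq (Runs.ite_true ?_ (runs_push _ _ _ _)) ?_))))
          · simp [Function.update_of_ne, hst, hys.symm, Fs]
          · refine (runs_load _ _ _).congr_right ?_
            refine Prod.ext rfl (Fext _ _ _ _ _ ?_ ?_ ?_ ?_ ?_)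
            · simp [List.replicate_succ, hxy, hxs, hxt, hys, hyt, hst, hxy.symm, hxs.symm, hxt.symm,
          hys.symm, hyt.symm, hst.symm, Fx, Fy, Fs, Ft, Fo, hx, hy, hs, ht]
            · simp [List.replicate_succ, hxy, hxs, hxt, hys, hyt, hst, hxy.symm, hxs.symm, hxt.symm,
          hys.symm, hyt.symm, hst.symm, Fx, Fy, Fs, Ft, Fo, hx, hy, hs, ht]
            · simp [List.replicate_succ, hxy, hxs, hxt, hys, hyt, hst, hxy.symm, hxs.symm, hxt.symm,
          hys.symm, hyt.symm, hst.symm, Fx, Fy, Fs, Ft, Fo, hx, hy, hs, ht]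
            · simp [List.replicate_succ, hxy, hxs, hxt, hys, hyt, hst, hxy.symm, hxs.symm, hxt.symm,
          hys.symm, hyt.symm, hst.symm, Fx, Fy, Fs, Ft, Fo, hx, hy, hs, ht]
            · intro k h1 h2 h3 h4; simp [h1, h2, h3, h4, Fo]
        · convert! ih (a + 1) c (d + 1) r using 2
          · simp
          · congr 1 <;> omega
  refine Runs.mono (Runs.seq (runs_load _ _ _) (Runs.seq (s' := (⟨false, v.flag, none⟩, F 0 b a 0))
    (t := 4 * a + 2) ?_ (Runs.seq (hW b 0 a 0 false) (Runs.seq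
      (s' := (⟨decide (a < b), v.flag, none⟩, F a 0 0 b)) (t := 4 * (a - b) + 2) ?_
      (t' := 4 * b + 2) ?_)))) (by omega)
  · convert! runs_moveProg hxs _ S using 1
    · refine Prod.ext rfl (Fext _ _ _ _ _ ?_ ?_ ?_ ?_ ?_).symm
      · simp [List.replicate_succ, hxy, hxs, hxt, hys, hyt, hst, hxy.symm, hxs.symm, hxt.symm,
          hys.symm, hyt.symm, hst.symm, Fx, Fy, Fs, Ft, Fo, hx, hy, hs, ht]
      · simp [List.replicate_succ, hxy, hxs, hxt, hys, hyt, hst, hxy.symm, hxs.symm, hxt.symm,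
          hys.symm, hyt.symm, hst.symm, Fx, Fy, Fs, Ft, Fo, hx, hy, hs, ht]
      · simp [List.replicate_succ, hxy, hxs, hxt, hys, hyt, hst, hxy.symm, hxs.symm, hxt.symm,
          hys.symm, hyt.symm, hst.symm, Fx, Fy, Fs, Ft, Fo, hx, hy, hs, ht]
      · simp [List.replicate_succ, hxy, hxs, hxt, hys, hyt, hst, hxy.symm, hxs.symm, hxt.symm,
          hys.symm, hyt.symm, hst.symm, Fx, Fy, Fs, Ft, Fo, hx, hy, hs, ht]
      · intro k h1 h2 h3 h4; simp [h1, h2, h3, h4, Fo]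
    · simp [hx]
  · convert! runs_moveProg hxs.symm _ _ using 1
    · refine Prod.ext (by simp) (Fext _ _ _ _ _ ?_ ?_ ?_ ?_ ?_).symm
      · simp [List.replicate_succ, hxy, hxs, hxt, hys, hyt, hst, hxy.symm, hxs.symm, hxt.symm,
          hys.symm, hyt.symm, hst.symm, Fx, Fy, Fs, Ft, Fo, hx, hy, hs, ht]; omega
      · simp [List.replicate_succ, hxy, hxs, hxt, hys, hyt, hst, hxy.symm, hxs.symm, hxt.symm,
          hys.symm, hyt.symm, hst.symm, Fx, Fy, Fs, Ft, Fo, hx, hy, hs, ht]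
      · simp [List.replicate_succ, hxy, hxs, hxt, hys, hyt, hst, hxy.symm, hxs.symm, hxt.symm,
          hys.symm, hyt.symm, hst.symm, Fx, Fy, Fs, Ft, Fo, hx, hy, hs, ht]
      · simp [List.replicate_succ, hxy, hxs, hxt, hys, hyt, hst, hxy.symm, hxs.symm, hxt.symm,
          hys.symm, hyt.symm, hst.symm, Fx, Fy, Fs, Ft, Fo, hx, hy, hs, ht]
      · intro k h1 h2 h3 h4; simp [h1, h2, h3, h4, Fo]
    · simp [Fs]
  · convert! runs_moveProg hyt.symm _ _ using 1
    · refine Prod.ext (by simp) (funext fun k => ?_)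
      by_cases e1 : k = x
      · subst e1; simp [List.replicate_succ, hxy, hxs, hxt, hys, hyt, hst, hxy.symm, hxs.symm, hxt.symm,
          hys.symm, hyt.symm, hst.symm, Fx, Fy, Fs, Ft, Fo, hx, hy, hs, ht]
      by_cases e2 : k = y
      · subst e2; simp [List.replicate_succ, hxy, hxs, hxt, hys, hyt, hst, hxy.symm, hxs.symm, hxt.symm,
          hys.symm, hyt.symm, hst.symm, Fx, Fy, Fs, Ft, Fo, hx, hy, hs, ht]
      by_cases e3 : k = s
      · subst e3; simp [List.replicate_succ, hxy, hxs, hxt, hys, hyt, hst, hxy.symm, hxs.symm, hxt.symm,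
          hys.symm, hyt.symm, hst.symm, Fx, Fy, Fs, Ft, Fo, hx, hy, hs, ht]
      by_cases e4 : k = t
      · subst e4; simp [List.replicate_succ, hxy, hxs, hxt, hys, hyt, hst, hxy.symm, hxs.symm, hxt.symm,
          hys.symm, hyt.symm, hst.symm, Fx, Fy, Fs, Ft, Fo, hx, hy, hs, ht]
      simp only
      rw [Function.update_of_ne e2, Function.update_of_ne e4, Fo _ _ _ _ _ e1 e2 e3 e4]
    · simp [Ft]

end

/-! ### Loop commands and their compilation -/

/-- The stacks of the machine: two stacks for each register, whose heights add up to the number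
of points, and five others. -/
abbrev Stk (V : ℕ) := (Fin V × Bool) ⊕ Fin 5

namespace Stk

variable {V : ℕ}

/-- the value of a register, in unary -/
abbrev reg (x : Fin V) : Stk V := Sum.inl (x, false)
/-- the complement of a register -/
abbrev co (x : Fin V) : Stk V := Sum.inl (x, true)
/-- an auxiliary stack -/
abbrev tmp : Stk V := Sum.inr 0
/-- an auxiliary stack -/
abbrev tmp' : Stk V := Sum.inr 1
/-- the part of the input that has not been read -/
abbrev inp : Stk V := Sum.inr 2
/-- the part of the input that has been read -/
abbrev used : Stk V := Sum.inr 3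
/-- the output -/
abbrev out : Stk V := Sum.inr 4

end Stk

/-- The part of the memory that commands modify. -/
structure Mem where
  /-- the internal state -/
  v : Flags
  /-- the part of the input that has not been read -/
  inp : List Letter
  /-- the part of the input that has been read, in reverse -/
  used : List Letter
  /-- the output, in reverse -/
  out : List Letter

/-- The contents of the stacks. -/
def Mem.stk {V : ℕ} (m : Mem) (n : ℕ) (env : Fin V → ℕ) : Stk V → List Letter
  | Sum.inl (x, false) => List.replicate (env x) none
  | Sum.inl (x, true) => List.replicate (n - env x) none
  | Sum.inr i => ![[], [], m.inp, m.used, m.out] i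

/-- Programs whose loop variables range over the indices of the points. -/
inductive Cmd (V : ℕ) : Type
  | load (f : Flags → Flags)
  | seq (c d : Cmd V)
  | ite (b : Flags → Bool) (c d : Cmd V)
  | lt (x y : Fin V)
  | loop (x : Fin V) (c : Cmd V)
  | advance
  | rewind
  | emit (f : Flags → Letter)

namespace Cmd

variable {V : ℕ}

/-- The semantics of commands, for `n` points and the values `env` of the loop variables. -/
def exec (n : ℕ) : Cmd V → (Fin V → ℕ) → Mem → Mem
  | load f, _, m => { m with v := f m.v }
  | seq c d, env, m => d.exec n env (c.exec n env m)
  | ite b c d, env, m => if b m.v then c.exec n env m else d.exec n env m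
  | lt x y, env, m => { m with v := ⟨decide (env x < env y), m.v.flag, none⟩ }
  | loop x c, env, m =>
    let m' := (List.range n).foldl (fun m i => c.exec n (Function.update env x i) m) m
    { m' with v := ⟨m'.v.res, m'.v.flag, none⟩ }
  | advance, _, m => ⟨⟨m.v.res, m.v.flag, m.inp.head?⟩, m.inp.tail, m.inp.head?.toList ++ m.used, m.out⟩
  | rewind, _, m => ⟨⟨m.v.res, m.v.flag, none⟩, m.used.reverse ++ m.inp, [], m.out⟩
  | emit f, _, m => { m with out := f m.v :: m.out }

/-- The stack program of a command. -/
def compile : Cmd V → StackProg (Stk V) Letter Flags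
  | load f => .load f
  | seq c d => .seq c.compile d.compile
  | ite b c d => .ite b c.compile d.compile
  | lt x y => if x = y then .load fun v => ⟨false, v.flag, none⟩ else
      ltProg (Stk.reg x) (Stk.reg y) Stk.tmp Stk.tmp'
  | loop x c => .seq (.whileNonempty (Stk.co x) (.seq c.compile (.seq (.pop (Stk.co x) fun v _ => v)
      (.push (Stk.reg x) fun _ => none)))) (moveProg (Stk.reg x) (Stk.co x))
  | advance => .seq (.pop Stk.inp fun v o => ⟨v.res, v.flag, o⟩)
      (.ite (fun v => v.letter.isSome) (.push Stk.used fun v => v.letter.join) (.load id))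
  | rewind => moveProg Stk.used Stk.inp
  | emit f => .push Stk.out f

/-- Nested loops have increasing variables, starting from `lo`. -/
def WF : Cmd V → ℕ → Prop
  | seq c d, lo => c.WF lo ∧ d.WF lo
  | ite _ c d, lo => c.WF lo ∧ d.WF lo
  | loop x c, lo => lo ≤ x ∧ c.WF (x + 1)
  | _, _ => True

/-- A bound for the running time in terms of the length of the input. -/
noncomputable def time : Cmd V → Polynomial ℕ
  | load _ => 1
  | seq c d => c.time + d.time
  | ite _ c d => 1 + c.time + d.time
  | lt _ _ => 19 * Polynomial.X + 8
  | loop _ c => Polynomial.X * (c.time + 7) + 3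
  | advance => 3
  | rewind => 4 * Polynomial.X + 2
  | emit _ => 1

/-- Letters only travel between the unread and the read part of the input, so the cost of `rewind`
is bounded by the input length. -/
theorem exec_length (n : ℕ) (c : Cmd V) (env : Fin V → ℕ) (m : Mem) :
    (c.exec n env m).inp.length + (c.exec n env m).used.length =
      m.inp.length + m.used.length := by
  induction c generalizing env m with
  | load f => rfl
  | seq c d ihc ihd => simp only [exec]; rw [ihd, ihc]
  | ite b c d ihc ihd =>
    simp only [exec]
    split_ifs
    · exact ihc env m
    · exact ihd env m
  | lt x y => rfl
  | loop x c ih =>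
    simp only [exec]
    induction List.range n generalizing m with
    | nil => rfl
    | cons i l ihl => rw [List.foldl_cons, ihl, ih]
  | advance =>
    cases h : m.inp with
    | nil => simp [exec, h]
    | cons a l => simp [exec, h]; omega
  | rewind => simp [exec]; omega
  | emit f => rfl

/-- Each emitted letter costs a step. This bounds the cost of reversing the output at the end. -/
theorem exec_out_length (n : ℕ) (c : Cmd V) (env : Fin V → ℕ) (m : Mem) {N : ℕ} (hn : n ≤ N) :
    (c.exec n env m).out.length ≤ m.out.length + c.time.eval N := by
  induction c generalizing env m with
  | load f => simp [exec]
  | seq c d ihc ihd =>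
    have h1 := ihc env m
    have h2 := ihd env (c.exec n env m)
    simp only [exec, time, Polynomial.eval_add]; omega
  | ite b c d ihc ihd =>
    have h1 := ihc env m
    have h2 := ihd env m
    simp only [exec, time, Polynomial.eval_add]
    split_ifs <;> omega
  | lt x y => simp [exec]
  | loop x c ih =>
    simp only [exec, time, Polynomial.eval_add, Polynomial.eval_mul, Polynomial.eval_X]
    have h : ∀ l : List ℕ, ∀ m : Mem,
        (l.foldl (fun m i => c.exec n (Function.update env x i) m) m).out.length ≤
          m.out.length + l.length * c.time.eval N := by
      intro l
      induction l with
      | nil => simp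
      | cons i l ihl =>
        intro m
        have h1 := ihl (c.exec n (Function.update env x i) m)
        have h2 := ih (Function.update env x i) m
        rw [List.foldl_cons, List.length_cons, Nat.add_one_mul]
        omega
    have h1 := h (List.range n) m
    have h2 : n * c.time.eval N ≤ N * (c.time.eval N + (7 : Polynomial ℕ).eval N) :=
      Nat.mul_le_mul hn (by omega)
    rw [List.length_range] at h1
    omega
  | advance => simp [exec]
  | rewind => simp [exec]
  | emit f => simp [exec, time]

theorem stk_pop_push (m : Mem) (n i : ℕ) (env : Fin V → ℕ) (x : Fin V) :
    Function.update (Function.update (m.stk n (Function.update env x i)) (Stk.co x)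
      (m.stk n (Function.update env x i) (Stk.co x)).tail) (Stk.reg x)
      (none :: m.stk n (Function.update env x i) (Stk.reg x)) =
      m.stk n (Function.update env x (i + 1)) := by
  funext k
  rcases k with ⟨y, _ | _⟩ | j
  · by_cases h : y = x
    · subst h; simp [Mem.stk, List.replicate_succ]
    · simp [Mem.stk, h]
  · by_cases h : y = x
    · subst h; simp [Mem.stk, Nat.sub_sub]
    · simp [Mem.stk, h]
  · simp [Mem.stk]

/-- In a loop the register has height `i` and its complement height `n - i` during the `i`-th
iteration; moving the register back at the end restores the zero. Well-formedness guarantees that a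
loop register is zero on entry. The number `N` bounds both `n` and the length of the stored input.
-/
theorem runs_compile {n N : ℕ} (hn : n ≤ N) (c : Cmd V) {lo : ℕ} (hc : c.WF lo)
    {env : Fin V → ℕ} (hlo : ∀ x, lo ≤ x.val → env x = 0) (henv : ∀ x, env x ≤ n) {m : Mem}
    (hm : m.inp.length + m.used.length ≤ N) :
    c.compile.Runs (m.v, m.stk n env)
      ((c.exec n env m).v, (c.exec n env m).stk n env) (c.time.eval N) := by
  induction c generalizing lo env m with
  | load f => exact (runs_load f m.v (m.stk n env)).mono (by simp [time])
  | seq c d ihc ihd =>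
    simp only [time, Polynomial.eval_add]
    exact Runs.seq (ihc hc.1 hlo henv hm) (ihd hc.2 hlo henv (by rw [exec_length]; exact hm))
  | ite b c d ihc ihd =>
    simp only [time, Polynomial.eval_add, exec]
    by_cases hb : b m.v = true
    · simp only [hb, if_true]
      exact (Runs.ite_true hb (ihc hc.1 hlo henv hm)).mono (by simp)
    · simp only [hb]
      exact (Runs.ite_false (by simpa using hb) (ihd hc.2 hlo henv hm)).mono (by simp)
  | lt x y =>
    by_cases hxy : x = y
    · subst hxy
      simp only [compile, exec, if_true, lt_irrefl, decide_false]
      exact (runs_load _ _ _).mono (by simp [time])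
    · simp only [compile, exec, hxy, if_false]
      refine (runs_ltProg (x := Stk.reg x) (y := Stk.reg y) (by simpa using hxy) (by simp)
        (by simp) (by simp) (by simp) (by simp) m.v (m.stk n env) (a := env x) (b := env y)
        rfl rfl rfl rfl).mono ?_
      have := henv x
      have := henv y
      simp [time]
      omega
  | loop x c ih =>
    obtain ⟨hx, hc⟩ := hc
    have h0 : env x = 0 := hlo x hx
    set M : ℕ → Mem := fun i =>
      (List.range i).foldl (fun m i => c.exec n (Function.update env x i) m) m with hM
    have hMl : ∀ i, (M i).inp.length + (M i).used.length ≤ N := by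
      intro i
      induction i with
      | zero => exact hm
      | succ i ihi =>
        simp only [hM, List.range_succ, List.foldl_append, List.foldl_cons, List.foldl_nil]
        rw [exec_length]; exact ihi
    have hMs : ∀ i, M (i + 1) = c.exec n (Function.update env x i) (M i) := by
      intro i
      simp only [hM, List.range_succ, List.foldl_append, List.foldl_cons, List.foldl_nil]
    have hW : ∀ d i, i + d = n → (StackProg.whileNonempty (Stk.co x) (.seq c.compile
        (.seq (.pop (Stk.co x) fun v _ => v) (.push (Stk.reg x) fun _ => none)))).Runs
        ((M i).v, (M i).stk n (Function.update env x i))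
        ((M n).v, (M n).stk n (Function.update env x n)) (d * (c.time.eval N + 3) + 1) := by
      intro d
      induction d with
      | zero =>
        intro i hi
        obtain rfl : i = n := by omega
        rw [Nat.zero_mul, Nat.zero_add]
        exact runs_while_nil _ (by simp [Mem.stk])
      | succ d ihd =>
        intro i hi
        refine Runs.mono (Runs.while_cons ?_ (Runs.seq (ih hc (fun y hy => ?_) (fun y => ?_)
          (hMl i)) (Runs.seq (runs_pop _ _ _ _) (Runs.congr_right (runs_push _ _ _ _) ?_)))
          (ihd (i + 1) (by omega))) ?_
        · simp [Mem.stk]; omega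
        · rw [Function.update_of_ne (by rintro rfl; omega)]
          exact hlo y (by omega)
        · by_cases h : y = x
          · subst h; simp; omega
          · rw [Function.update_of_ne h]; exact henv y
        · rw [hMs]
          refine Prod.ext rfl ?_
          simp only
          rw [Function.update_of_ne (by simp), stk_pop_push]
        · rw [Nat.add_one_mul]; omega
    have e0 : Function.update env x 0 = env := by rw [← h0, Function.update_eq_self]
    have hW0 := hW n 0 (by omega)
    rw [e0] at hW0
    refine Runs.mono (Runs.seq hW0 (Runs.congr_right (runs_moveProg (by simp) _ _) ?_)) ?_
    · refine Prod.ext rfl (funext fun k => ?_)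
      rcases k with ⟨y, _ | _⟩ | j
      · by_cases h : y = x
        · subst h; simp [Mem.stk, h0]
        · simp [Mem.stk, h]
      · by_cases h : y = x
        · subst h; simp [Mem.stk, h0]
        · simp [Mem.stk, h]
      · simp [Mem.stk, exec, hM]
    -- An iteration adds three steps (test, pop, push) to its body, and moving its digit back costs
    -- four more.
    · have h1 : n * (c.time.eval N + 3) + 4 * n ≤ N * (c.time.eval N + 7) := by
        calc n * (c.time.eval N + 3) + 4 * n = n * (c.time.eval N + 7) := by ring
          _ ≤ _ := Nat.mul_le_mul_right _ hn
      simp [Mem.stk, time]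
      omega
  | advance =>
    simp only [compile, exec]
    cases hi : m.inp with
    | nil =>
      refine Runs.mono (Runs.seq (runs_pop _ _ _ _) (Runs.ite_false ?_
        (Runs.congr_right (runs_load _ _ _) ?_))) (t := 1 + (1 + 1)) (by simp [time])
      · simp [Mem.stk, hi]
      · refine Prod.ext (by simp [Mem.stk, hi]) (funext fun k => ?_)
        rcases k with ⟨y, _ | _⟩ | j
        · simp [Mem.stk]
        · simp [Mem.stk]
        · fin_cases j <;> simp [Mem.stk, hi, Function.update_apply]
    | cons a l =>
      refine Runs.mono (Runs.seq (runs_pop _ _ _ _) (Runs.ite_true ?_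
        (Runs.congr_right (runs_push _ _ _ _) ?_))) (t := 1 + (1 + 1)) (by simp [time])
      · simp [Mem.stk, hi]
      · refine Prod.ext (by simp [Mem.stk, hi]) (funext fun k => ?_)
        rcases k with ⟨y, _ | _⟩ | j
        · simp [Mem.stk]
        · simp [Mem.stk]
        · fin_cases j <;> simp [Mem.stk, hi, Function.update_apply]
  | rewind =>
    refine Runs.mono (Runs.congr_right (runs_moveProg (by simp) _ _) ?_) ?_
    · refine Prod.ext rfl (funext fun k => ?_)
      rcases k with ⟨y, _ | _⟩ | j
      · simp [Mem.stk]
      · simp [Mem.stk]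
      · fin_cases j <;> simp [Mem.stk, exec, Function.update_apply]
    · simp [Mem.stk, time]
      omega
  | emit f =>
    refine Runs.mono (Runs.congr_right (runs_push _ _ _ _) ?_) (t := 1) (by simp [time])
    refine Prod.ext rfl (funext fun k => ?_)
    rcases k with ⟨y, _ | _⟩ | j
    · simp [Mem.stk]
    · simp [Mem.stk]
    · fin_cases j <;> simp [Mem.stk, exec, Function.update_apply]

end Cmd

/-! ### Initialization, cleanup and polynomial-time computability -/

section

variable {K : Type} [DecidableEq K]

/-- Push the unary digit onto each stack of a list. -/
def pushAll (l : List K) : StackProg K Letter Flags :=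
  l.foldr (fun k P => .seq (.push k fun _ => none) P) (.load id)

theorem runs_pushAll {l : List K} (hl : l.Nodup) (v : Flags) (S : K → List Letter) :
    (pushAll l).Runs (v, S) (v, fun k => if k ∈ l then none :: S k else S k) (l.length + 1) := by
  induction l generalizing S with
  | nil => exact (runs_load id v S).congr_right (by simp)
  | cons a l ih =>
    obtain ⟨ha, hl⟩ := List.nodup_cons.1 hl
    refine Runs.mono (Runs.seq (runs_push _ _ _ _) (Runs.congr_right (ih hl _)
      (Prod.ext rfl (funext fun k => ?_)))) (by simp; omega)
    by_cases h : k = a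
    · subst h; simp [ha]
    · simp [h]

/-- Empty each stack of a list. -/
def drainAll (l : List K) : StackProg K Letter Flags :=
  l.foldr (fun k P => .seq (.whileNonempty k (.pop k fun v _ => v)) P) (.load id)

theorem runs_drain (k : K) (v : Flags) (S : K → List Letter) :
    (StackProg.whileNonempty k (.pop k fun v _ => v)).Runs (v, S) (v, Function.update S k [])
      (2 * (S k).length + 1) := by
  induction h : S k generalizing S with
  | nil => exact (runs_while_nil v h).congr_right (by simp [← h])
  | cons a l ih =>
    refine Runs.mono (Runs.while_cons (by simp [h]) (runs_pop _ _ _ _)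
      (Runs.congr_right (ih _ (by simp [h])) ?_)) (by simp; omega)
    simp

theorem runs_drainAll (l : List K) (v : Flags) (S : K → List Letter) {N : ℕ}
    (hN : ∀ k, (S k).length ≤ N) :
    (drainAll l).Runs (v, S) (v, fun k => if k ∈ l then [] else S k)
      (l.length * (2 * N + 1) + 1) := by
  induction l generalizing S with
  | nil => exact ((runs_load id v S).congr_right (by simp)).mono (by simp)
  | cons a l ih =>
    refine Runs.mono (Runs.seq (runs_drain _ _ _) (Runs.congr_right (ih _ (fun k => ?_))
      (Prod.ext rfl (funext fun k => ?_)))) ?_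
    · by_cases h : k = a
      · subst h; simp
      · simpa [h] using hN k
    · by_cases h : k = a
      · subst h; simp
      · simp [h]
    · have := hN a
      have := Nat.add_one_mul l.length (2 * N + 1)
      rw [List.length_cons]
      omega

end

namespace Cmd

variable {V : ℕ}

/-- Read the input and initialize the registers. -/
def initLoop (V : ℕ) : StackProg (Stk V) Letter Flags :=
  .whileNonempty Stk.inp (.seq (.pop Stk.inp fun v o => ⟨v.res, v.flag, o⟩) (.seq
    (.ite (fun v => decide (v.letter = some none)) (pushAll ((List.finRange V).map Stk.co))
      (.push Stk.used fun v => v.letter.join))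
    (.load fun _ => Flags.init)))

theorem runs_initLoop_signs (n : ℕ) (w : List SignType) (u : List Letter) :
    (initLoop V).Runs (Flags.init, (⟨Flags.init, w.map some, u, []⟩ : Mem).stk n fun _ => 0)
      (Flags.init, (⟨Flags.init, [], (w.map some).reverse ++ u, []⟩ : Mem).stk n fun _ => 0)
      (5 * w.length + 1) := by
  induction w generalizing u with
  | nil => exact (runs_while_nil _ rfl).congr_right (by simp)
  | cons a w ih =>
    refine Runs.mono (Runs.while_cons (by simp [Mem.stk]) (Runs.seq (runs_pop _ _ _ _) (Runs.seq
      (Runs.ite_false ?_ (runs_push _ _ _ _)) (Runs.congr_right (runs_load _ _ _) ?_)))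
      (Runs.congr_right (ih (some a :: u)) (by simp))) (by simp; omega)
    · simp [Mem.stk]
    · refine Prod.ext rfl (funext fun k => ?_)
      rcases k with ⟨y, _ | _⟩ | j
      · simp [Mem.stk]
      · simp [Mem.stk]
      · fin_cases j <;> simp [Mem.stk, Function.update_apply]

/-- Each unary digit is pushed onto the complements of all registers, which then have value zero and
range `n`; `i` counts the digits read so far. -/
theorem runs_initLoop (n i : ℕ) (w : List SignType) :
    (initLoop V).Runs
      (Flags.init, (⟨Flags.init, List.replicate n none ++ w.map some, [], []⟩ : Mem).stk i fun _ => 0)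
      (Flags.init, (⟨Flags.init, [], (w.map some).reverse, []⟩ : Mem).stk (n + i) fun _ => 0)
      ((V + 5) * n + (5 * w.length + 1)) := by
  induction n generalizing i with
  | zero =>
    refine ((runs_initLoop_signs i w []).congr_right ?_).mono (by simp)
    simp
  | succ n ih =>
    refine Runs.mono (Runs.while_cons (by simp [Mem.stk, List.replicate_succ])
      (Runs.seq (runs_pop _ _ _ _) (Runs.seq
        (Runs.ite_true ?_ (runs_pushAll ?_ _ _)) (Runs.congr_right (runs_load _ _ _) ?_)))
      (Runs.congr_right (ih (i + 1)) ?_)) ?_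
    · simp [Mem.stk, List.replicate_succ]
    · exact (List.nodup_map_iff (fun x y h => by simpa using h)).2 (List.nodup_finRange V)
    · refine Prod.ext rfl (funext fun k => ?_)
      rcases k with ⟨y, _ | _⟩ | j
      · simp [Mem.stk]
      · simp [Mem.stk, List.replicate_succ]
      · fin_cases j <;> simp [Mem.stk, Function.update_apply, List.replicate_succ]
    · rw [show n + (i + 1) = n + 1 + i by omega]
    · simp only [List.length_map, List.length_finRange]
      rw [Nat.mul_add_one]
      omega

/-- The complete program: initialize the registers, execute the command, delete everything but
the output, and reverse it. -/
def program (c : Cmd V) : StackProg (Stk V) Letter Flags :=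
  .seq (initLoop V) (.seq (moveProg Stk.used Stk.inp) (.seq (.load fun _ => Flags.init)
    (.seq c.compile (.seq (drainAll ((List.finRange V).map Stk.co ++ [Stk.inp, Stk.used]))
      (.seq (moveProg Stk.out Stk.tmp) (.load fun _ => Flags.init))))))

/-- A bound for the running time of the complete program. -/
noncomputable def programTime (c : Cmd V) : Polynomial ℕ :=
  (((V + 15 : ℕ) : Polynomial ℕ) * Polynomial.X + 5 + c.time) +
    (((V + 2 : ℕ) : Polynomial ℕ) * (2 * (Polynomial.X + c.time) + 1) + 4 * c.time + 5)

/-- The command leaves its output in reverse order, and the final move to `tmp` turns it round.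
Since `n` is given in unary, `n + w.length` is the input length. -/
theorem runs_program (c : Cmd V) (hc : c.WF 0) (n : ℕ) (w : List SignType) :
    c.program.Runs (Flags.init, singleStack Stk.inp (List.replicate n none ++ w.map some))
      (Flags.init, singleStack Stk.tmp
        (c.exec n (fun _ => 0) ⟨Flags.init, w.map some, [], []⟩).out.reverse)
      (c.programTime.eval (n + w.length)) := by
  set m := c.exec n (fun _ => 0) ⟨Flags.init, w.map some, [], []⟩ with hm
  set N := n + w.length with hN
  have h1 : m.inp.length + m.used.length ≤ N := by
    rw [hm, exec_length]; simp [hN]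
  have h2 : m.out.length ≤ c.time.eval N := by
    simpa using exec_out_length n c (fun _ => 0) ⟨Flags.init, w.map some, [], []⟩
      (N := N) (by omega)
  have h0 : (singleStack Stk.inp (List.replicate n none ++ w.map some) : Stk V → List Letter) =
      (⟨Flags.init, List.replicate n none ++ w.map some, [], []⟩ : Mem).stk 0 fun _ => 0 := by
    funext k
    rcases k with ⟨y, _ | _⟩ | j
    · simp [Mem.stk, singleStack]
    · simp [Mem.stk, singleStack]
    · fin_cases j <;> simp [Mem.stk, singleStack]
  rw [h0]
  refine Runs.mono (Runs.seq (runs_initLoop n 0 w)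
    (Runs.seq (runs_moveProg (by simp) _ _) (Runs.seq (Runs.congr_right (runs_load _ _ _) ?_)
      (Runs.seq (runs_compile (n := n) (N := N) (by omega) c hc (env := fun _ => 0)
        (m := ⟨Flags.init, w.map some, [], []⟩) (by simp) (by simp) (by simp [hN]))
        (Runs.seq (runs_drainAll _ _ _ (N := N + c.time.eval N) ?_)
          (Runs.seq (runs_moveProg (by simp) _ _) (Runs.congr_right (runs_load _ _ _) ?_))))))) ?_
  · refine Prod.ext rfl (funext fun k => ?_)
    rcases k with ⟨y, _ | _⟩ | j
    · simp [Mem.stk]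
    · simp [Mem.stk]
    · fin_cases j <;> simp [Mem.stk, Function.update_apply]
  · intro k
    rcases k with ⟨y, _ | _⟩ | j
    · simp [Mem.stk]
    · simp [Mem.stk]; omega
    · rw [← hm]
      fin_cases j <;> simp [Mem.stk] <;> omega
  · refine Prod.ext rfl (funext fun k => ?_)
    rcases k with ⟨y, _ | _⟩ | j
    · simp [Mem.stk, singleStack]
    · simp [Mem.stk, singleStack]
    · fin_cases j <;> simp [Mem.stk, singleStack, Function.update_apply, ← hm]
  · rw [← hm]
    -- A unary digit costs `V + 5` steps; a sign costs 5 steps for reading and 4 for moving it back.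
    have e1 : (V + 5) * n + 9 * w.length ≤ (V + 15) * N := by
      rw [hN]; nlinarith [Nat.zero_le (V * w.length)]
    simp [programTime, Mem.stk]
    generalize (V + 2) * (2 * (N + Polynomial.eval N c.time) + 1) = z at *
    omega

/-- A function that is computed by a command is computable in polynomial time. -/
theorem computableInPolyTime {α β : Type} {ea : α → List Letter} {eb : β → List Letter} {f : α → β}
    (c : Cmd V) (hc : c.WF 0)
    (h : ∀ a, ∃ (n : ℕ) (w : List SignType), ea a = List.replicate n none ++ w.map some ∧
      eb (f a) = (c.exec n (fun _ => 0) ⟨Flags.init, w.map some, [], []⟩).out.reverse) :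
    Nonempty (TM2ComputableInPolyTime ea eb f) := by
  have key : ∀ a, ∀ x y : List Letter, x = ea a → y = eb (f a) →
      Nonempty (TM2OutputsInTime (c.program.machine Stk.inp Stk.tmp Flags.init) x (some y)
        ((c.programTime + 1).eval (ea a).length)) := by
    rintro a _ _ rfl rfl
    obtain ⟨n, w, h1, h2⟩ := h a
    have := (runs_program c hc n w).outputsInTime
    rw [h1, h2]
    simpa using this
  refine ⟨{ tm := c.program.machine Stk.inp Stk.tmp Flags.init
            inputAlphabet := Equiv.refl Letter
            outputAlphabet := Equiv.refl Letter
            time := c.programTime + 1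
            outputsFun := fun a => ?_ }⟩
  exact (key a _ _ (List.map_id _) (List.map_id _)).some

end Cmd

/-! ### Evaluating first-order formulas by commands -/

/-- Names of variables. -/
abbrev Var := Fin 24

/-- The signs of the increasing triples in lexicographic order. -/
def signs (n : ℕ) (T : ℕ → ℕ → ℕ → SignType) : List SignType :=
  (List.range n).flatMap fun i => (List.range n).flatMap fun j => (List.range n).flatMap fun k =>
    if i < j ∧ j < k then [T i j k] else []

/-- First-order formulas about combinatorial order types. -/
inductive Fm : Type
  | const (b : Bool)
  | lt (x y : Var)
  | sgn (s : SignType) (x y z : Var)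
  | not (φ : Fm)
  | and (φ ψ : Fm)
  | ex (x : Var) (φ : Fm)

namespace Fm

/-- The truth value of a formula, for `n` points with signs `T`. -/
def Holds (n : ℕ) (T : ℕ → ℕ → ℕ → SignType) : Fm → (Var → ℕ) → Prop
  | const b, _ => b = true
  | lt x y, env => env x < env y
  | sgn s x y z, env => env x < env y ∧ env y < env z ∧ env z < n ∧ T (env x) (env y) (env z) = s
  | not φ, env => ¬φ.Holds n T env
  | and φ ψ, env => φ.Holds n T env ∧ ψ.Holds n T env
  | ex x φ, env => ∃ i < n, φ.Holds n T (Function.update env x i)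

/-- Nested quantifiers have increasing variables, starting from `lo`, and the last three variables
are not used. -/
def wf : Fm → ℕ → Bool
  | const _, _ => true
  | lt x y, _ => decide (x.val < 21) && decide (y.val < 21)
  | sgn _ x y z, _ => decide (x.val < 21) && decide (y.val < 21) && decide (z.val < 21)
  | not φ, lo => φ.wf lo
  | and φ ψ, lo => φ.wf lo && ψ.wf lo
  | ex x φ, lo => decide (lo ≤ x.val) && decide (x.val < 21) && φ.wf (x.val + 1)

/-- Test that no pair of a list is increasing. -/
def noneLt : List (Var × Var) → Cmd 24
  | [] => .load fun v => ⟨true, v.flag, none⟩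
  | (x, y) :: l => .seq (.lt x y) (.ite Flags.res (.load fun v => ⟨false, v.flag, none⟩) (noneLt l))

/-- Read a letter; set the flag if it is `s` and no pair of a list is increasing. -/
def readSign (s : SignType) (l : List (Var × Var)) : Cmd 24 :=
  .seq (noneLt l) (.seq .advance
    (.load fun v => ⟨false, v.flag || (v.res && decide (v.letter = some (some s))), none⟩))

/-- Execute a command if the last test was successful. -/
def ifRes (c : Cmd 24) : Cmd 24 :=
  .seq (.ite Flags.res (.seq (.load fun v => ⟨false, v.flag, none⟩) c) (.load id))
    (.load fun v => ⟨false, v.flag, none⟩)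

/-- Read the signs of all triples. -/
def readAll (s : SignType) (x y z : Var) : Cmd 24 :=
  .loop 21 (.loop 22 (.seq (.lt 21 22) (ifRes (.loop 23 (.seq (.lt 22 23) (ifRes
    (readSign s [(21, x), (x, 21), (22, y), (y, 22), (23, z), (z, 23)])))))))

/-- The command that evaluates a formula. -/
def toCmd : Fm → Cmd 24
  | const b => .load fun _ => ⟨b, false, none⟩
  | lt x y => .seq (.lt x y) (.load fun v => ⟨v.res, false, none⟩)
  | sgn s x y z => .seq (.load fun _ => ⟨false, false, none⟩) (.seq (readAll s x y z)
      (.seq .rewind (.load fun v => ⟨v.flag, false, none⟩)))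
  | not φ => .seq φ.toCmd (.load fun v => ⟨!v.res, false, none⟩)
  | and φ ψ => .seq φ.toCmd (.ite Flags.res ψ.toCmd (.load id))
  | ex x φ => .seq (.load fun _ => ⟨false, false, none⟩)
      (.loop x (.ite Flags.res (.load id) φ.toCmd))

theorem wf_noneLt (l : List (Var × Var)) (lo : ℕ) : (noneLt l).WF lo := by
  induction l with
  | nil => trivial
  | cons a l ih => exact ⟨trivial, trivial, ih⟩

theorem wf_toCmd {φ : Fm} {lo : ℕ} (h : φ.wf lo = true) (hlo : lo ≤ 21) : φ.toCmd.WF lo := by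
  induction φ generalizing lo with
  | const b => trivial
  | lt x y => exact ⟨trivial, trivial⟩
  | sgn s x y z =>
    refine ⟨trivial, ⟨hlo, ⟨by simp, ⟨trivial, ⟨⟨⟨trivial, by simp, ⟨trivial,
      ⟨⟨⟨trivial, wf_noneLt _ _, trivial, trivial⟩, trivial⟩, trivial⟩⟩⟩, trivial⟩, trivial⟩⟩⟩⟩,
      trivial, trivial⟩
  | not φ ih => exact ⟨ih h hlo, trivial⟩
  | and φ ψ ih ih' =>
    simp only [wf, Bool.and_eq_true] at h
    exact ⟨ih h.1 hlo, ih' h.2 hlo, trivial⟩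
  | ex x φ ih =>
    simp only [wf, Bool.and_eq_true, decide_eq_true_eq] at h
    exact ⟨trivial, h.1.1, trivial, ih h.2 (by omega)⟩

theorem exec_noneLt (n : ℕ) (l : List (Var × Var)) (env : Var → ℕ) (m : Mem) :
    (noneLt l).exec n env m =
      { m with v := ⟨l.all fun p => decide (¬ env p.1 < env p.2), m.v.flag, none⟩ } := by
  induction l generalizing m with
  | nil => rfl
  | cons a l ih =>
    obtain ⟨x, y⟩ := a
    by_cases h : env x < env y
    · simp [noneLt, Cmd.exec, h]
    · simp only [noneLt, Cmd.exec, h, decide_false, Bool.false_eq_true, if_false, ih]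
      simp only [List.all_cons, h, not_false_eq_true, decide_true, Bool.true_and]

/-- The command reads the letters of a list of signs, and sets the flag if one of the signs that
are marked is `s`. -/
def Consumes (n : ℕ) (s : SignType) (c : Cmd 24) (env : Var → ℕ) (l : List (SignType × Bool)) :
    Prop :=
  ∀ fl rest used out, c.exec n env ⟨⟨false, fl, none⟩, l.map (fun p => some p.1) ++ rest, used, out⟩ =
    ⟨⟨false, fl || l.any (fun p => p.2 && decide (p.1 = s)), none⟩, rest,
      (l.map fun p => some p.1).reverse ++ used, out⟩

theorem Consumes.loop {n : ℕ} {s : SignType} {c : Cmd 24} {env : Var → ℕ} {x : Var}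
    {l : ℕ → List (SignType × Bool)} (h : ∀ i < n, Consumes n s c (Function.update env x i) (l i)) :
    Consumes n s (.loop x c) env ((List.range n).flatMap l) := by
  have key : ∀ L : List ℕ, (∀ i ∈ L, i < n) → ∀ fl rest used out,
      L.foldl (fun m i => c.exec n (Function.update env x i) m)
        ⟨⟨false, fl, none⟩, (L.flatMap l).map (fun p => some p.1) ++ rest, used, out⟩ =
      ⟨⟨false, fl || (L.flatMap l).any (fun p => p.2 && decide (p.1 = s)), none⟩, rest,
        ((L.flatMap l).map fun p => some p.1).reverse ++ used, out⟩ := by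
    intro L
    induction L with
    | nil => simp
    | cons i L ih =>
      intro hL fl rest used out
      rw [List.foldl_cons, List.flatMap_cons, List.map_append, List.append_assoc,
        h i (hL i (by simp)), ih fun j hj => hL j (by simp [hj])]
      simp [Bool.or_assoc]
  intro fl rest used out
  simp only [Cmd.exec]
  rw [key _ fun i hi => List.mem_range.1 hi]

theorem Consumes.ifLt {n : ℕ} {s : SignType} {c : Cmd 24} {env : Var → ℕ} {x y : Var}
    {l : List (SignType × Bool)} (h : Consumes n s c env l) (hxy : env x < env y) :
    Consumes n s (.seq (.lt x y) (ifRes c)) env l := by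
  intro fl rest used out
  have := h fl rest used out
  simp only [Cmd.exec, ifRes, hxy, decide_true, if_true]
  rw [this]

theorem consumes_readSign {n : ℕ} {s t : SignType} {env : Var → ℕ} {l : List (Var × Var)}
    (fl r : Bool) (rest used out : List Letter) :
    (readSign s l).exec n env ⟨⟨r, fl, none⟩, some t :: rest, used, out⟩ =
      ⟨⟨false, fl || ((l.all fun p => decide (¬ env p.1 < env p.2)) && decide (t = s)), none⟩, rest,
        some t :: used, out⟩ := by
  simp [readSign, Cmd.exec, exec_noneLt]

/-- The nested loops visit the increasing triples in the order in which their signs are listed, so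
the registers always name the triple of the next letter. Equality with `x, y, z` is tested by the
absence of strict inequalities in both directions. -/
theorem consumes_readAll {n : ℕ} {T : ℕ → ℕ → ℕ → SignType} {s : SignType} {x y z : Var}
    (hx : x.val < 21) (hy : y.val < 21) (hz : z.val < 21) (env : Var → ℕ) :
    Consumes n s (readAll s x y z) env
      ((List.range n).flatMap fun i => (List.range n).flatMap fun j => (List.range n).flatMap fun k =>
        if i < j ∧ j < k then [(T i j k, decide (i = env x ∧ j = env y ∧ k = env z))] else []) := by
  refine Consumes.loop fun i _ => Consumes.loop fun j _ => ?_
  have hx1 : x ≠ 21 := by rintro rfl; simp at hx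
  have hx2 : x ≠ 22 := by rintro rfl; simp at hx
  have hx3 : x ≠ 23 := by rintro rfl; simp at hx
  have hy1 : y ≠ 21 := by rintro rfl; simp at hy
  have hy2 : y ≠ 22 := by rintro rfl; simp at hy
  have hy3 : y ≠ 23 := by rintro rfl; simp at hy
  have hz1 : z ≠ 21 := by rintro rfl; simp at hz
  have hz2 : z ≠ 22 := by rintro rfl; simp at hz
  have hz3 : z ≠ 23 := by rintro rfl; simp at hz
  set e := Function.update (Function.update env 21 i) 22 j with he
  have e1 : e 21 = i := by simp [he]
  have e2 : e 22 = j := by simp [he]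
  by_cases hij : i < j
  · have hl : Consumes n s (.loop 23 (.seq (.lt 22 23) (ifRes
        (readSign s [(21, x), (x, 21), (22, y), (y, 22), (23, z), (z, 23)])))) e
        ((List.range n).flatMap fun k => if i < j ∧ j < k then
          [(T i j k, decide (i = env x ∧ j = env y ∧ k = env z))] else []) := by
      refine Consumes.loop fun k _ => ?_
      intro fl rest used out
      by_cases hjk : j < k
      · have hd : (decide (env x ≤ i) && (decide (i ≤ env x) && (decide (env y ≤ j) &&
            (decide (j ≤ env y) && (decide (env z ≤ k) && decide (k ≤ env z)))))) =
            (decide (i = env x) && (decide (j = env y) && decide (k = env z))) := by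
          rw [Bool.eq_iff_iff]
          simp only [Bool.and_eq_true, decide_eq_true_eq]
          omega
        simp only [hij, hjk, and_self, if_true, List.map_cons, List.map_nil, List.cons_append,
          List.nil_append, Cmd.exec, ifRes, Function.update_self, e2,
          Function.update_of_ne (show (22 : Var) ≠ 23 by decide), decide_true, consumes_readSign]
        simp [he, hx1, hx2, hx3, hy1, hy2, hy3, hz1, hz2, hz3, hd]
      · simp [hij, hjk, Cmd.exec, ifRes, e2]
    exact hl.ifLt (by rw [e1, e2]; exact hij)
  · intro fl rest used out
    simp [hij, Cmd.exec, ifRes, e1, e2]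

/-- The truth value of a formula as a Boolean. -/
noncomputable def val (n : ℕ) (T : ℕ → ℕ → ℕ → SignType) (φ : Fm) (env : Var → ℕ) : Bool :=
  @decide (φ.Holds n T env) (Classical.propDecidable _)

theorem val_eq_true {n : ℕ} {T : ℕ → ℕ → ℕ → SignType} {φ : Fm} {env : Var → ℕ} :
    φ.val n T env = true ↔ φ.Holds n T env := by
  simp [val]

/-- Each evaluation ends with the input rewound and the flag cleared, so evaluations compose.
Variables 21 to 23 are reserved for reading, so the inner loops do not disturb the variables of a
formula. -/
theorem exec_toCmd {n : ℕ} {T : ℕ → ℕ → ℕ → SignType} {φ : Fm} {lo : ℕ} (h : φ.wf lo = true)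
    (env : Var → ℕ) {m : Mem} (hinp : m.inp = (signs n T).map some) (hused : m.used = []) :
    φ.toCmd.exec n env m =
      { m with v := ⟨φ.val n T env, false, none⟩ } := by
  induction φ generalizing lo env m with
  | const b =>
    simp only [toCmd, Cmd.exec, Mem.mk.injEq, Flags.mk.injEq, and_true]
    rw [Bool.eq_iff_iff, val_eq_true, Holds]
  | lt x y =>
    simp only [toCmd, Cmd.exec, Mem.mk.injEq, Flags.mk.injEq, and_true]
    rw [Bool.eq_iff_iff, val_eq_true, decide_eq_true_eq, Holds]
  | sgn s x y z =>
    simp only [wf, Bool.and_eq_true, decide_eq_true_eq] at h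
    obtain ⟨⟨hx, hy⟩, hz⟩ := h
    have hc := consumes_readAll (n := n) (T := T) (s := s) hx hy hz env false [] [] m.out
    set l := (List.range n).flatMap fun i => (List.range n).flatMap fun j =>
      (List.range n).flatMap fun k =>
        if i < j ∧ j < k then [(T i j k, decide (i = env x ∧ j = env y ∧ k = env z))] else []
      with hl
    have hw : (signs n T).map (some : SignType → Letter) = l.map fun p => some p.1 := by
      simp only [signs, hl, List.map_flatMap]
      congr! 6 with i j k
      split_ifs <;> simp
    have hany : (l.any fun p => p.2 && decide (p.1 = s)) =
        (Fm.sgn s x y z).val n T env := by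
      rw [Bool.eq_iff_iff, val_eq_true]
      simp only [hl, List.any_eq_true, List.mem_flatMap, List.mem_range, Bool.and_eq_true,
        decide_eq_true_eq, Holds]
      constructor
      · rintro ⟨p, ⟨i, hi, j, hj, k, hk, hp⟩, h1, h2⟩
        split_ifs at hp with hijk
        · simp only [List.mem_singleton] at hp
          subst hp
          simp only [decide_eq_true_eq] at h1 h2
          obtain ⟨rfl, rfl, rfl⟩ := h1
          exact ⟨hijk.1, hijk.2, hk, h2⟩
        · simp at hp
      · rintro ⟨h1, h2, h3, h4⟩
        exact ⟨(T (env x) (env y) (env z), true), ⟨env x, by omega, env y, by omega, env z, h3,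
          by simp [h1, h2]⟩, rfl, h4⟩
    simp only [toCmd, Cmd.exec, hinp, hused, hw] at hc ⊢
    rw [List.append_nil] at hc
    rw [hc, hany]
    simp
  | not φ ih =>
    simp only [toCmd, Cmd.exec, ih h env hinp hused, Mem.mk.injEq, Flags.mk.injEq, and_true]
    rw [Bool.eq_iff_iff, val_eq_true, Holds, ← val_eq_true]
    simp
  | and φ ψ ih ih' =>
    simp only [wf, Bool.and_eq_true] at h
    have hv : (φ.and ψ).val n T env = (φ.val n T env && ψ.val n T env) := by
      rw [Bool.eq_iff_iff, val_eq_true, Bool.and_eq_true, val_eq_true, val_eq_true, Holds]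
    simp only [toCmd, Cmd.exec, ih h.1 env hinp hused, hv]
    cases φ.val n T env with
    | true => simp [ih' (m := ⟨⟨true, false, none⟩, m.inp, m.used, m.out⟩) h.2 env hinp hused]
    | false => simp
  | ex x φ ih =>
    simp only [wf, Bool.and_eq_true] at h
    -- Once a witness is found the remaining iterations do nothing, so the result is a running
    -- disjunction.
    have key : ∀ L : List ℕ, ∀ r : Bool, L.foldl (fun m i => (Cmd.ite Flags.res (.load id)
        φ.toCmd).exec n (Function.update env x i) m) ⟨⟨r, false, none⟩, m.inp, m.used, m.out⟩ =
        ⟨⟨r || L.any (fun i => φ.val n T (Function.update env x i)), false, none⟩, m.inp, m.used,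
          m.out⟩ := by
      intro L
      induction L with
      | nil => simp
      | cons i L ihL =>
        intro r
        rw [List.foldl_cons]
        cases r with
        | true =>
          rw [show (Cmd.ite Flags.res (.load id) φ.toCmd).exec n (Function.update env x i)
            ⟨⟨true, false, none⟩, m.inp, m.used, m.out⟩ = ⟨⟨true, false, none⟩, m.inp, m.used, m.out⟩
            from rfl, ihL]
          simp
        | false =>
          rw [show (Cmd.ite Flags.res (.load id) φ.toCmd).exec n (Function.update env x i)
            ⟨⟨false, false, none⟩, m.inp, m.used, m.out⟩ = φ.toCmd.exec n (Function.update env x i)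
            ⟨⟨false, false, none⟩, m.inp, m.used, m.out⟩ from rfl,
            ih (m := ⟨⟨false, false, none⟩, m.inp, m.used, m.out⟩) h.2 _ hinp hused, ihL]
          simp
    have := key (List.range n) false
    simp only [toCmd, Cmd.exec] at this ⊢
    rw [this]
    simp only [Mem.mk.injEq, Flags.mk.injEq, and_true, Bool.false_or]
    rw [Bool.eq_iff_iff, val_eq_true, Holds]
    simp [val_eq_true]

end Fm

/-! ### First-order definitions of the cluster signs -/

/-- The lexicographically first good pair. -/
def First (n : ℕ) (T : ℕ → ℕ → ℕ → SignType) (k a b : ℕ) : Prop :=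
  Good T k a b ∧ ∀ a' < n, ∀ b' < n, Good T k a' b' → a < a' ∨ (a = a' ∧ b ≤ b')

/-- The sign of two points and a cluster point is positive. -/
def LinePos (n : ℕ) (T : ℕ → ℕ → ℕ → SignType) (i j k : ℕ) (c : Fin 4) : Prop :=
  chi T i j k = 1 ∨ (chi T i j k = 0 ∧ ∃ a < n, ∃ b < n, First n T k a b ∧
    (chi T i j a = SignType.sign (xCoord c) ∨
      (chi T i j a = 0 ∧ chi T i j b = SignType.sign (yCoord c))))

/-- The sign of three cluster points, in lexicographic order, is positive. -/
def ClusterPos (n : ℕ) (T : ℕ → ℕ → ℕ → SignType) (i : ℕ) (a : Fin 4) (j : ℕ) (b : Fin 4) (k : ℕ)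
    (c : Fin 4) : Prop :=
  (i < j ∧ j < k ∧ (LinePos n T i j k c ∨ (¬LinePos n T j i k c ∧ ∃ s < n, ∃ t < n, First n T j s t ∧
    ((SignType.sign (xCoord b) = 1 ∧ LinePos n T j s k c) ∨
      (SignType.sign (xCoord b) = -1 ∧ LinePos n T s j k c))))) ∨
  (i = j ∧ j < k ∧ ∃ s < n, ∃ t < n, First n T j s t ∧ LinePos n T j s k c) ∨
  (i < j ∧ j = k ∧ ∃ s < n, ∃ t < n, First n T k s t ∧ (chi T i k s = 1 ∨ (chi T i k s = 0 ∧
    (chi T i k t = SignType.sign (yCoord c - yCoord b) ∨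
      (chi T i k t = 0 ∧ chi T s t k = crossSign b c))))) ∨
  (i = j ∧ j = k ∧ ∃ s < n, ∃ t < n, First n T k s t ∧ chi T s t k = triSign a b c)

namespace Fm

/-- Disjunction. -/
def or (φ ψ : Fm) : Fm := .not (.and (.not φ) (.not ψ))

/-- Implication. -/
def imp (φ ψ : Fm) : Fm := .not (.and φ (.not ψ))

/-- Equivalence. -/
def iff (φ ψ : Fm) : Fm := .and (.imp φ ψ) (.imp ψ φ)

/-- Universal quantification. -/
def all (x : Var) (φ : Fm) : Fm := .not (.ex x (.not φ))

/-- Equality. -/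
def eq (x y : Var) : Fm := .and (.not (.lt x y)) (.not (.lt y x))

section

variable {n : ℕ} {T : ℕ → ℕ → ℕ → SignType} {env : Var → ℕ}

@[simp] theorem holds_const {b : Bool} : (const b).Holds n T env ↔ b = true := Iff.rfl

@[simp] theorem holds_lt {x y : Var} : (lt x y).Holds n T env ↔ env x < env y := Iff.rfl

@[simp] theorem holds_not {φ : Fm} : φ.not.Holds n T env ↔ ¬φ.Holds n T env := Iff.rfl

@[simp] theorem holds_and {φ ψ : Fm} : (φ.and ψ).Holds n T env ↔ φ.Holds n T env ∧ ψ.Holds n T env :=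
  Iff.rfl

@[simp] theorem holds_ex {x : Var} {φ : Fm} :
    (ex x φ).Holds n T env ↔ ∃ i < n, φ.Holds n T (Function.update env x i) := Iff.rfl

@[simp] theorem holds_or {φ ψ : Fm} : (φ.or ψ).Holds n T env ↔ φ.Holds n T env ∨ ψ.Holds n T env := by
  simp only [or, holds_not, holds_and]; tauto

@[simp] theorem holds_imp {φ ψ : Fm} : (φ.imp ψ).Holds n T env ↔ (φ.Holds n T env → ψ.Holds n T env) := by
  simp only [imp, holds_not, holds_and]; tauto

@[simp] theorem holds_iff {φ ψ : Fm} : (φ.iff ψ).Holds n T env ↔ (φ.Holds n T env ↔ ψ.Holds n T env) := by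
  simp only [iff, holds_imp, holds_and]; tauto

@[simp] theorem holds_all {x : Var} {φ : Fm} :
    (all x φ).Holds n T env ↔ ∀ i < n, φ.Holds n T (Function.update env x i) := by
  simp [all]

@[simp] theorem holds_eq {x y : Var} : (eq x y).Holds n T env ↔ env x = env y := by
  simp only [eq, holds_and, holds_not, holds_lt]; omega

end

/-- The triple is positively oriented. -/
def pos (x y z : Var) : Fm :=
  .or (.sgn 1 x y z) (.or (.sgn 1 y z x) (.or (.sgn 1 z x y) (.or (.sgn (-1) x z y)
    (.or (.sgn (-1) z y x) (.sgn (-1) y x z)))))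

/-- The triple has the sign `s`. -/
def chi (s : SignType) (x y z : Var) : Fm :=
  .or (.and (.const (decide (s = 1))) (pos x y z))
    (.or (.and (.const (decide (s = -1))) (pos y x z))
      (.and (.const (decide (s = 0))) (.and (.not (pos x y z)) (.not (pos y x z)))))

/-- The pair `a, b` is good for `k`. -/
def good (k a b : Var) : Fm :=
  .and (.lt a k) (.and (.lt b k) (.and (.not (chi 0 a b k))
    (.all 18 (.all 19 (.imp (.and (.lt 18 k) (.and (.lt 19 k) (.and (.lt 18 19) (chi 0 18 19 k))))
      (.or (.all 20 (.imp (.lt 20 k) (chi 0 18 19 20)))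
        (.or (.all 20 (.imp (.lt 20 k) (.iff (chi 0 18 19 20) (chi 0 a k 20))))
          (.all 20 (.imp (.lt 20 k) (.iff (chi 0 18 19 20) (chi 0 b k 20)))))))))))

/-- The pair `a, b` is the first good pair for `k`. -/
def first (k a b : Var) : Fm :=
  .and (good k a b) (.all 16 (.all 17 (.imp (good k 16 17)
    (.or (.lt a 16) (.and (.eq a 16) (.not (.lt 17 b)))))))

/-- The index is at least four. -/
def geFour (x : Var) : Fm :=
  .ex 16 (.ex 17 (.ex 18 (.ex 19 (.and (.lt 16 17) (.and (.lt 17 18) (.and (.lt 18 19) (.lt 19 x)))))))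

/-- The formula for `LinePos`. -/
noncomputable def linePos (i j k : Var) (c : Fin 4) : Fm :=
  .or (chi 1 i j k) (.and (chi 0 i j k) (.ex 10 (.ex 11 (.and (first k 10 11)
    (.or (chi (SignType.sign (xCoord c)) i j 10)
      (.and (chi 0 i j 10) (chi (SignType.sign (yCoord c)) i j 11)))))))

/-- The formula for `ClusterPos`. -/
noncomputable def clusterPos (a b c : Fin 4) : Fm :=
  .or (.and (.lt 0 1) (.and (.lt 1 2) (.or (linePos 0 1 2 c) (.and (.not (linePos 1 0 2 c))
    (.ex 5 (.ex 6 (.and (first 1 5 6)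
      (.or (.and (.const (decide (SignType.sign (xCoord b) = 1))) (linePos 1 5 2 c))
        (.and (.const (decide (SignType.sign (xCoord b) = -1))) (linePos 5 1 2 c))))))))))
  (.or (.and (.eq 0 1) (.and (.lt 1 2) (.ex 5 (.ex 6 (.and (first 1 5 6) (linePos 1 5 2 c))))))
  (.or (.and (.lt 0 1) (.and (.eq 1 2) (.ex 5 (.ex 6 (.and (first 2 5 6) (.or (chi 1 0 2 5)
    (.and (chi 0 0 2 5) (.or (chi (SignType.sign (yCoord c - yCoord b)) 0 2 6)
      (.and (chi 0 0 2 6) (chi (crossSign b c) 5 6 2))))))))))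
  (.and (.eq 0 1) (.and (.eq 1 2) (.ex 5 (.ex 6 (.and (first 2 5 6)
    (chi (triSign a b c) 5 6 2))))))))

/-- Every index from the fourth one on has a good pair. -/
def allGood : Fm := .all 0 (.imp (geFour 0) (.ex 10 (.ex 11 (good 0 10 11))))

theorem wf_clusterPos (a b c : Fin 4) : (clusterPos a b c).wf 3 = true := rfl

theorem wf_allGood : allGood.wf 0 = true := rfl

theorem wf_geFour (x : Var) (h : x.val < 4) : (geFour x).wf 3 = true := by
  simp [geFour, wf]; omega

section

variable {n : ℕ} {T : ℕ → ℕ → ℕ → SignType} (hT : ∀ i j k, i < j → j < k → T i j k ≠ 0 → k < n)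

include hT

/-- The value 1 arises from the six orders of the indices. Since `T` is nonzero only on triples
below `n`, the bound in the atomic formulas costs nothing. -/
theorem holds_pos (x y z : Var) (env : Var → ℕ) :
    (pos x y z).Holds n T env ↔ _root_.chi T (env x) (env y) (env z) = 1 := by
  have h : ∀ s : SignType, s ≠ 0 → ∀ x y z : Var, (sgn s x y z).Holds n T env ↔
      (env x < env y ∧ env y < env z) ∧ T (env x) (env y) (env z) = s := by
    intro s hs x y z
    exact ⟨fun h => ⟨⟨h.1, h.2.1⟩, h.2.2.2⟩, fun h => ⟨h.1.1, h.1.2, hT _ _ _ h.1.1 h.1.2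
      (by rw [h.2]; exact hs), h.2⟩⟩
  have hneg : ∀ t : SignType, -t = 1 ↔ t = -1 := by decide
  simp only [pos, holds_or, h 1 (by decide), h (-1) (by decide)]
  generalize env x = x; generalize env y = y; generalize env z = z
  unfold _root_.chi
  split_ifs with h1 h2 h3 h4 h5 h6
  · simp [h1, show ¬ z < x by omega, show ¬ y < x by omega, show ¬ z < y by omega]
  · simp [h2, show ¬ x < y by omega, show ¬ x < z by omega, show ¬ z < y by omega]
  · simp [h3, show ¬ y < x by omega, show ¬ x < z by omega, show ¬ y < z by omega]
  · simp [h4, hneg, show ¬ y < x by omega, show ¬ z < x by omega, show ¬ y < z by omega, show ¬ z < x by omega]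
  · simp [h5, hneg, show ¬ x < y by omega, show ¬ x < z by omega, show ¬ y < z by omega]
  · simp [h6, hneg, show ¬ x < y by omega, show ¬ z < x by omega, show ¬ z < y by omega]
  · simp only [h1, h2, h3, h4, h5, h6, false_and, or_self, false_iff]

theorem holds_chi (s : SignType) (x y z : Var) (env : Var → ℕ) :
    (chi s x y z).Holds n T env ↔ _root_.chi T (env x) (env y) (env z) = s := by
  simp only [chi, holds_or, holds_and, holds_not, holds_const, holds_pos hT,
    chi_swap T (env x) (env y), decide_eq_true_eq]
  generalize _root_.chi T (env x) (env y) (env z) = t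
  revert s t
  decide

/-- Quantifiers over indices below `k` are quantifiers over all indices with a guard, because `k <
n`; the bound variables 18 to 20 are distinct from `k, a, b`. -/
theorem holds_good {k a b : Var} (hk : k.val < 18) (ha : a.val < 18) (hb : b.val < 18) {env : Var → ℕ}
    (hn : env k < n) :
    (good k a b).Holds n T env ↔ Good T (env k) (env a) (env b) := by
  have ne : ∀ {x : Var}, x.val < 18 → x ≠ 18 ∧ x ≠ 19 ∧ x ≠ 20 := by
    rintro x hx
    refine ⟨?_, ?_, ?_⟩ <;> rintro rfl <;> simp at hx
  obtain ⟨k1, k2, k3⟩ := ne hk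
  obtain ⟨a1, a2, a3⟩ := ne ha
  obtain ⟨b1, b2, b3⟩ := ne hb
  simp only [good, holds_and, holds_lt, holds_not, holds_chi hT, holds_all, holds_imp, holds_or,
    holds_iff, Good, ne_eq, Function.update_self, Function.update_of_ne k1, Function.update_of_ne k2,
    Function.update_of_ne k3, Function.update_of_ne a1, Function.update_of_ne a2,
    Function.update_of_ne a3, Function.update_of_ne b1, Function.update_of_ne b2,
    Function.update_of_ne b3, Function.update_of_ne (show (18 : Var) ≠ 19 by decide),
    Function.update_of_ne (show (18 : Var) ≠ 20 by decide),
    Function.update_of_ne (show (19 : Var) ≠ 20 by decide)]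
  have hb : ∀ P : ℕ → Prop, (∀ i < n, i < env k → P i) ↔ ∀ i < env k, P i :=
    fun P => ⟨fun h i hi => h i (hi.trans hn) hi, fun h i _ hi => h i hi⟩
  simp only [hb, and_imp]
  refine and_congr_right fun _ => and_congr_right fun _ => and_congr_right fun _ => ?_
  exact ⟨fun h i hi j hj => h i (hi.trans hn) j (hj.trans hn) hi hj,
    fun h i _ j _ hi hj => h i hi j hj⟩

theorem holds_first {k a b : Var} (hk : k.val < 16) (ha : a.val < 16) (hb : b.val < 16)
    {env : Var → ℕ} (hn : env k < n) :
    (first k a b).Holds n T env ↔ First n T (env k) (env a) (env b) := by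
  have ne : ∀ {x : Var}, x.val < 16 → x ≠ 16 ∧ x ≠ 17 := by
    rintro x hx
    refine ⟨?_, ?_⟩ <;> rintro rfl <;> simp at hx
  obtain ⟨k1, k2⟩ := ne hk
  obtain ⟨a1, a2⟩ := ne ha
  obtain ⟨b1, b2⟩ := ne hb
  have hg : ∀ i j, (good k 16 17).Holds n T (Function.update (Function.update env 16 i) 17 j) ↔
      Good T (env k) i j := by
    intro i j
    rw [holds_good hT (by omega) (by decide) (by decide) (by simpa [k1, k2] using hn)]
    simp [k1, k2]
  simp [first, holds_good hT (show k.val < 18 by omega) (show a.val < 18 by omega)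
    (show b.val < 18 by omega) hn, hg, First, a1, a2, b1, b2]

omit hT in
theorem holds_geFour {x : Var} (hx : x.val < 16) {env : Var → ℕ} (hn : env x < n) :
    (geFour x).Holds n T env ↔ 4 ≤ env x := by
  have x1 : x ≠ 16 := by rintro rfl; simp at hx
  have x2 : x ≠ 17 := by rintro rfl; simp at hx
  have x3 : x ≠ 18 := by rintro rfl; simp at hx
  have x4 : x ≠ 19 := by rintro rfl; simp at hx
  simp only [geFour, holds_ex, holds_and, holds_lt, Function.update_self, Function.update_of_ne x1,
    Function.update_of_ne x2, Function.update_of_ne x3, Function.update_of_ne x4,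
    Function.update_of_ne (show (16 : Var) ≠ 17 by decide),
    Function.update_of_ne (show (16 : Var) ≠ 18 by decide),
    Function.update_of_ne (show (16 : Var) ≠ 19 by decide),
    Function.update_of_ne (show (17 : Var) ≠ 18 by decide),
    Function.update_of_ne (show (17 : Var) ≠ 19 by decide),
    Function.update_of_ne (show (18 : Var) ≠ 19 by decide)]
  exact ⟨fun ⟨a, _, b, _, c, _, d, _, h⟩ => by omega, fun h => ⟨0, by omega, 1, by omega, 2, by omega,
    3, by omega, by omega⟩⟩

theorem holds_linePos {i j k : Var} (hi : i.val < 10) (hj : j.val < 10) (hk : k.val < 10) (c : Fin 4)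
    {env : Var → ℕ} (hn : env k < n) :
    (linePos i j k c).Holds n T env ↔ LinePos n T (env i) (env j) (env k) c := by
  have ne : ∀ {x : Var}, x.val < 10 → x ≠ 10 ∧ x ≠ 11 := by
    rintro x hx
    refine ⟨?_, ?_⟩ <;> rintro rfl <;> simp at hx
  obtain ⟨k1, k2⟩ := ne hk
  obtain ⟨i1, i2⟩ := ne hi
  obtain ⟨j1, j2⟩ := ne hj
  have hf : ∀ s t, (first k 10 11).Holds n T (Function.update (Function.update env 10 s) 11 t) ↔
      First n T (env k) s t := by
    intro i j
    rw [holds_first hT (by omega) (by decide) (by decide) (by simpa [k1, k2] using hn)]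
    simp [k1, k2]
  simp [linePos, holds_chi hT, hf, LinePos, k1, k2, i1, i2, j1, j2]

theorem holds_clusterPos (a b c : Fin 4) {env : Var → ℕ} (h1 : env 1 < n) (h2 : env 2 < n) :
    (clusterPos a b c).Holds n T env ↔ ClusterPos n T (env 0) a (env 1) b (env 2) c := by
  have f1 : ∀ s t, (first 1 5 6).Holds n T (Function.update (Function.update env 5 s) 6 t) ↔
      First n T (env 1) s t := by
    intro s t
    rw [holds_first hT (by decide) (by decide) (by decide) (by simpa using h1)]
    simp
  have f2 : ∀ s t, (first 2 5 6).Holds n T (Function.update (Function.update env 5 s) 6 t) ↔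
      First n T (env 2) s t := by
    intro s t
    rw [holds_first hT (by decide) (by decide) (by decide) (by simpa using h2)]
    simp
  have l1 : ∀ s t, (linePos 1 5 2 c).Holds n T (Function.update (Function.update env 5 s) 6 t) ↔
      LinePos n T (env 1) s (env 2) c := by
    intro s t
    rw [holds_linePos hT (by decide) (by decide) (by decide) c (by simpa using h2)]
    simp
  have l2 : ∀ s t, (linePos 5 1 2 c).Holds n T (Function.update (Function.update env 5 s) 6 t) ↔
      LinePos n T s (env 1) (env 2) c := by
    intro s t
    rw [holds_linePos hT (by decide) (by decide) (by decide) c (by simpa using h2)]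
    simp
  have l3 := holds_linePos hT (i := 0) (j := 1) (k := 2) (by decide) (by decide) (by decide) c h2
  have l4 := holds_linePos hT (i := 1) (j := 0) (k := 2) (by decide) (by decide) (by decide) c h2
  simp [clusterPos, ClusterPos, holds_chi hT, f1, f2, l1, l2, l3, l4]

theorem holds_allGood (env : Var → ℕ) : allGood.Holds n T env ↔
    ∀ k < n, 4 ≤ k → ∃ a b, Good T k a b := by
  simp only [allGood, holds_all, holds_imp, holds_ex]
  refine forall₂_congr fun k hk => ?_
  rw [holds_geFour (by decide) (by simpa using hk)]
  simp only [Function.update_self]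
  refine imp_congr_right fun _ => ?_
  have hg : ∀ i j, (good 0 10 11).Holds n T
      (Function.update (Function.update (Function.update env 0 k) 10 i) 11 j) ↔ Good T k i j := by
    intro i j
    rw [holds_good hT (by decide) (by decide) (by decide) (by simpa using hk)]
    simp
  simp only [hg]
  exact ⟨fun ⟨a, _, b, _, h⟩ => ⟨a, b, h⟩, fun ⟨a, b, h⟩ => ⟨a, h.1.trans hk, b, h.2.1.trans hk, h⟩⟩

end

end Fm

/-! ### Listing the cluster points and writing their signs -/

/-- The cluster points: one for each of the first four points, and four for each other point. -/
def points (n : ℕ) : List (ℕ × Fin 4) :=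
  (List.range n).flatMap fun i => (List.finRange 4).flatMap fun a =>
    if a = 0 ∨ 4 ≤ i then [(i, a)] else []

theorem mem_points {n : ℕ} {P : ℕ × Fin 4} : P ∈ points n ↔ P.1 < n ∧ (P.2 = 0 ∨ 4 ≤ P.1) := by
  obtain ⟨i, a⟩ := P
  simp only [points, List.mem_flatMap, List.mem_range, List.mem_finRange, true_and]
  constructor
  · rintro ⟨j, hj, b, h⟩
    split_ifs at h with hb
    · simp only [List.mem_singleton, Prod.mk.injEq] at h
      obtain ⟨rfl, rfl⟩ := h
      exact ⟨hj, hb⟩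
    · simp at h
  · rintro ⟨h1, h2⟩
    exact ⟨i, h1, a, by simp [h2]⟩

theorem pairwise_flatMap_of_forall {ι α : Type*} {r : ι → ι → Prop} {s : α → α → Prop} {l : List ι}
    {f : ι → List α} (hl : l.Pairwise r) (h : ∀ i, (f i).Pairwise s)
    (h' : ∀ i j, r i j → ∀ x ∈ f i, ∀ y ∈ f j, s x y) : (l.flatMap f).Pairwise s :=
  List.pairwise_flatMap.2 ⟨fun i _ => h i, hl.imp fun hij => h' _ _ hij⟩

theorem pairwise_points (n : ℕ) : (points n).Pairwise PtLt := by
  refine pairwise_flatMap_of_forall List.pairwise_lt_range (fun i => ?_) ?_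
  · refine pairwise_flatMap_of_forall (List.pairwise_lt_finRange 4) (fun a => ?_) ?_
    · split_ifs <;> simp
    · intro a b hab x hx y hy
      split_ifs at hx with h1
      · split_ifs at hy with h2
        · simp only [List.mem_singleton] at hx hy
          subst hx hy
          exact Or.inr ⟨rfl, hab⟩
        · simp at hy
      · simp at hx
  · intro i j hij x hx y hy
    have h : ∀ i x, (x ∈ (List.finRange 4).flatMap fun a : Fin 4 =>
        if a = 0 ∨ 4 ≤ i then [(i, a)] else []) → x.1 = i := by
      intro i x hx
      simp only [List.mem_flatMap] at hx
      obtain ⟨a, -, h⟩ := hx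
      split_ifs at h
      · simp only [List.mem_singleton] at h; rw [h]
      · simp at h
    exact Or.inl (by rw [h i x hx, h j y hy]; exact hij)

section

variable (n : ℕ) (T : ℕ → ℕ → ℕ → SignType)

/-- The command writes a given list, if it is applied to the list of signs. -/
def Emits (c : Cmd 24) (env : Var → ℕ) (l : List Letter) : Prop :=
  ∀ v out, ∃ v', c.exec n env ⟨v, (signs n T).map some, [], out⟩ =
    ⟨v', (signs n T).map some, [], l.reverse ++ out⟩

variable {n T} {env : Var → ℕ} {c d : Cmd 24}

theorem Emits.out_eq {l : List Letter} (h : Emits n T c env l) (v : Flags) :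
    (c.exec n env ⟨v, (signs n T).map some, [], []⟩).out.reverse = l := by
  obtain ⟨v', h⟩ := h v []
  simp [h]

theorem emits_emit (f : Flags → Letter) {a : Letter} (h : ∀ v, f v = a) :
    Emits n T (.emit f) env [a] :=
  fun v _ => ⟨v, by simp [Cmd.exec, h]⟩

theorem Emits.seq {l l' : List Letter} (hc : Emits n T c env l) (hd : Emits n T d env l') :
    Emits n T (.seq c d) env (l ++ l') := by
  intro v out
  obtain ⟨v1, h1⟩ := hc v out
  obtain ⟨v2, h2⟩ := hd v1 (l.reverse ++ out)
  exact ⟨v2, by simp [Cmd.exec, h1, h2]⟩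

theorem Emits.loop {x : Var} {l : ℕ → List Letter}
    (h : ∀ i < n, Emits n T c (Function.update env x i) (l i)) :
    Emits n T (.loop x c) env ((List.range n).flatMap l) := by
  have key : ∀ L : List ℕ, (∀ i ∈ L, i < n) → ∀ v out, ∃ v',
      L.foldl (fun m i => c.exec n (Function.update env x i) m)
        ⟨v, (signs n T).map some, [], out⟩ =
      ⟨v', (signs n T).map some, [], (L.flatMap l).reverse ++ out⟩ := by
    intro L
    induction L with
    | nil => exact fun _ v out => ⟨v, rfl⟩
    | cons i L ih =>
      intro hL v out
      obtain ⟨v1, h1⟩ := h i (hL i (by simp)) v out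
      obtain ⟨v2, h2⟩ := ih (fun j hj => hL j (by simp [hj])) v1 ((l i).reverse ++ out)
      exact ⟨v2, by rw [List.foldl_cons, h1, h2]; simp⟩
  intro v out
  obtain ⟨v', h'⟩ := key _ (fun i hi => List.mem_range.1 hi) v out
  refine ⟨⟨v'.res, v'.flag, none⟩, ?_⟩
  simp only [Cmd.exec]
  rw [h']

/-- Execute a command if a formula holds. -/
def Fm.ifHolds (φ : Fm) (c : Cmd 24) : Cmd 24 := .seq φ.toCmd (.ite Flags.res c (.load id))

theorem Emits.ifHolds {φ : Fm} {lo : ℕ} {l : List Letter} (hφ : φ.wf lo = true) {P : Prop}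
    [Decidable P] (hP : φ.Holds n T env ↔ P) (h : P → Emits n T c env l) :
    Emits n T (φ.ifHolds c) env (if P then l else []) := by
  intro v out
  simp only [Fm.ifHolds, Cmd.exec]
  rw [Fm.exec_toCmd (n := n) (T := T) hφ env rfl rfl]
  by_cases hp : P
  · obtain ⟨v', h'⟩ := h hp ⟨true, false, none⟩ out
    have : φ.val n T env = true := Fm.val_eq_true.2 (hP.2 hp)
    simp [this, h', hp]
  · have : φ.val n T env = false := by
      rw [Bool.eq_false_iff, ne_eq, Fm.val_eq_true, hP]; exact hp
    simp [this, hp]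

/-- Write the truth value of a formula as a sign. -/
def Fm.emitSign (φ : Fm) : Cmd 24 := .seq φ.toCmd (.emit fun v => some (if v.res then 1 else -1))

theorem emits_emitSign {φ : Fm} {lo : ℕ} (hφ : φ.wf lo = true) {P : Prop}
    [Decidable P] (hP : φ.Holds n T env ↔ P) :
    Emits n T φ.emitSign env [some (if P then 1 else -1)] := by
  intro v out
  simp only [Fm.emitSign, Cmd.exec]
  rw [Fm.exec_toCmd (n := n) (T := T) hφ env rfl rfl]
  by_cases hp : P
  · have : φ.val n T env = true := Fm.val_eq_true.2 (hP.2 hp)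
    simp [this, hp]
  · have : φ.val n T env = false := by
      rw [Bool.eq_false_iff, ne_eq, Fm.val_eq_true, hP]; exact hp
    simp [this, hp]

/-- Execute commands for all points of a cluster. -/
def forColors (c : Fin 4 → Cmd 24) : Cmd 24 := .seq (c 0) (.seq (c 1) (.seq (c 2) (c 3)))

theorem Emits.forColors {c : Fin 4 → Cmd 24} {l : Fin 4 → List Letter}
    (h : ∀ a, Emits n T (c a) env (l a)) : Emits n T (forColors c) env ((List.finRange 4).flatMap l) := by
  have := (h 0).seq ((h 1).seq ((h 2).seq (h 3)))
  rw [show List.finRange 4 = [0, 1, 2, 3] by decide]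
  simpa [_root_.forColors] using this

/-- Execute commands for all cluster points. -/
def forPoints (x : Var) (c : Fin 4 → Cmd 24) : Cmd 24 :=
  .loop x (forColors fun a => (Fm.or (.const (decide (a = 0))) (.geFour x)).ifHolds (c a))

theorem Emits.forPoints {x : Var} (hx : x.val < 4) {c : Fin 4 → Cmd 24}
    {l : ℕ × Fin 4 → List Letter}
    (h : ∀ i a, i < n → Emits n T (c a) (Function.update env x i) (l (i, a))) :
    Emits n T (forPoints x c) env ((points n).flatMap l) := by
  have : (points n).flatMap l = (List.range n).flatMap fun i => (List.finRange 4).flatMap fun a =>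
      if a = 0 ∨ 4 ≤ i then l (i, a) else [] := by
    rw [points, List.flatMap_assoc]
    congr! 2 with i
    rw [List.flatMap_assoc]
    congr! 2 with a
    split_ifs <;> simp
  rw [this]
  refine Emits.loop fun i hi => Emits.forColors fun a => Emits.ifHolds (lo := 3) ?_ ?_ fun _ => h i a hi
  · have := Fm.wf_geFour x hx
    simp [Fm.or, Fm.wf, this]
  · rw [Fm.holds_or, Fm.holds_geFour (by omega) (by simpa using hi)]
    simp

/-- The order on the cluster points. -/
def Fm.ptLt (x : Var) (a : Fin 4) (y : Var) (b : Fin 4) : Fm :=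
  .or (.lt x y) (.and (.eq x y) (.const (decide (a < b))))

theorem Fm.holds_ptLt (x : Var) (a : Fin 4) (y : Var) (b : Fin 4) :
    (Fm.ptLt x a y b).Holds n T env ↔ PtLt (env x, a) (env y, b) := by
  simp [Fm.ptLt, PtLt]

/-- Write the signs of all triples of cluster points. -/
noncomputable def writeSigns : Cmd 24 :=
  forPoints 0 fun a => forPoints 1 fun b => forPoints 2 fun c =>
    (Fm.and (.ptLt 0 a 1 b) (.ptLt 1 b 2 c)).ifHolds (Fm.clusterPos a b c).emitSign

/-- Write the order type of the cluster points. -/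
noncomputable def writeClusters : Cmd 24 := .seq (forPoints 0 fun _ => .emit fun _ => none) writeSigns

/-- Write a simple order type on four points that is not realizable. -/
def writeBad : Cmd 24 :=
  .seq (.emit fun _ => none) (.seq (.emit fun _ => none) (.seq (.emit fun _ => none)
    (.seq (.emit fun _ => none) (.seq (.emit fun _ => some 1) (.seq (.emit fun _ => some (-1))
      (.seq (.emit fun _ => some 1) (.emit fun _ => some (-1))))))))

/-- Write the simple order type. -/
noncomputable def reduction : Cmd 24 := .seq Fm.allGood.toCmd (.ite Flags.res writeClusters writeBad)

theorem wf_reduction : reduction.WF 0 := by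
  have h1 : ∀ φ : Fm, φ.wf 3 = true → φ.toCmd.WF 3 := fun φ h => Fm.wf_toCmd h (by omega)
  have hcol : ∀ (c : Fin 4 → Cmd 24) (lo : ℕ), (∀ a, (c a).WF lo) → (forColors c).WF lo :=
    fun c lo h => ⟨h 0, h 1, h 2, h 3⟩
  have hpt : ∀ (x : Var) (lo : ℕ) (c : Fin 4 → Cmd 24), x.val < 4 → lo ≤ x.val →
      (∀ a, (c a).WF (x.val + 1)) → (forPoints x c).WF lo := by
    intro x lo c hx hlo h
    refine ⟨hlo, hcol _ _ fun a => ⟨Fm.wf_toCmd (lo := x.val + 1) ?_ (by omega), h a, trivial⟩⟩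
    simp [Fm.or, Fm.wf, Fm.geFour]
    omega
  refine ⟨Fm.wf_toCmd Fm.wf_allGood (by omega), ⟨hpt _ _ _ (by decide) (by decide) fun a => trivial,
    hpt _ _ _ (by decide) (by decide) fun a => hpt _ _ _ (by decide) (by decide) fun b =>
    hpt _ _ _ (by decide) (by decide) fun c => ⟨h1 _ rfl, ⟨h1 _ (Fm.wf_clusterPos a b c), trivial⟩, trivial⟩⟩, ?_⟩
  simp [writeBad, Cmd.WF]

open Classical in
theorem emits_writeClusters (hT : ∀ i j k, i < j → j < k → T i j k ≠ 0 → k < n) (env : Var → ℕ) :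
    Emits n T writeClusters env (List.replicate (points n).length none ++
      (points n).flatMap fun P => (points n).flatMap fun Q => (points n).flatMap fun R =>
        if PtLt P Q ∧ PtLt Q R then
          [some (if ClusterPos n T P.1 P.2 Q.1 Q.2 R.1 R.2 then 1 else -1)] else []) := by
  refine Emits.seq ?_ ?_
  · have := Emits.forPoints (n := n) (T := T) (env := env) (x := 0) (by decide)
      (c := fun _ => .emit fun _ => none) (l := fun _ => [none])
      fun i a _ => emits_emit _ fun _ => rfl
    rwa [← List.map_eq_flatMap, List.map_const'] at this
  · refine Emits.forPoints (by decide) fun i a hi => Emits.forPoints (by decide) fun j b hj =>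
      Emits.forPoints (by decide) fun k c hk => Emits.ifHolds (lo := 3) rfl ?_ fun _ =>
        emits_emitSign (Fm.wf_clusterPos a b c) ?_
    · rw [Fm.holds_and, Fm.holds_ptLt, Fm.holds_ptLt]
      simp
    · rw [Fm.holds_clusterPos hT a b c (by simpa using hj) (by simpa using hk)]
      simp

open Classical in
theorem emits_reduction (hT : ∀ i j k, i < j → j < k → T i j k ≠ 0 → k < n) (env : Var → ℕ) :
    Emits n T reduction env (if ∀ k < n, 4 ≤ k → ∃ a b, Good T k a b then
      List.replicate (points n).length none ++
        (points n).flatMap fun P => (points n).flatMap fun Q => (points n).flatMap fun R =>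
          if PtLt P Q ∧ PtLt Q R then
            [some (if ClusterPos n T P.1 P.2 Q.1 Q.2 R.1 R.2 then 1 else -1)] else []
      else [none, none, none, none, some 1, some (-1), some 1, some (-1)]) := by
  have e : ∀ a : Letter, Emits n T (.emit fun _ => a) env [a] := fun a => emits_emit _ fun _ => rfl
  have hbad := (e none).seq ((e none).seq ((e none).seq ((e none).seq ((e (some 1)).seq
    ((e (some (-1))).seq ((e (some 1)).seq (e (some (-1)))))))))
  have hgood := emits_writeClusters hT env
  intro v out
  simp only [reduction, Cmd.exec]
  rw [Fm.exec_toCmd (n := n) (T := T) Fm.wf_allGood env rfl rfl]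
  by_cases h : ∀ k < n, 4 ≤ k → ∃ a b, Good T k a b
  · rw [if_pos h, Fm.val_eq_true.2 ((Fm.holds_allGood hT env).2 h)]
    exact hgood _ out
  · rw [if_neg h, Bool.eq_false_iff.2 fun h' => h ((Fm.holds_allGood hT env).1 (Fm.val_eq_true.1 h'))]
    exact hbad _ out

end

/-! ### The formulas compute the prescribed signs -/

section

variable {n : ℕ} {T : ℕ → ℕ → ℕ → SignType} {al be : ℕ → ℕ}

/-- Minimize the first component, then the second. This makes the choice of the pair canonical,
hence definable by a formula. -/
theorem Good.exists_first {k a b : ℕ} (h : Good T k a b) : ∃ s t, First n T k s t := by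
  classical
  have h1 : ∃ s t, Good T k s t := ⟨a, b, h⟩
  have h2 := Nat.find_spec h1
  refine ⟨Nat.find h1, Nat.find h2, Nat.find_spec h2, fun s _ t _ hst => ?_⟩
  rcases (Nat.find_min' h1 ⟨t, hst⟩).lt_or_eq with h | h
  · exact Or.inl h
  · exact Or.inr ⟨h, Nat.find_min' h2 (by rw [h]; exact hst)⟩

theorem First.unique {k a b s t : ℕ} (h : First n T k a b) (h' : First n T k s t) (hk : k ≤ n) :
    s = a ∧ t = b := by
  have h1 := h.2 s (h'.1.1.trans_le hk) t (h'.1.2.1.trans_le hk) h'.1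
  have h2 := h'.2 a (h.1.1.trans_le hk) b (h.1.2.1.trans_le hk) h.1
  omega

/-- `LinePos` reports only positivity; a negative sign is read off as positivity of the swapped
pair. -/
theorem lineSign_swap (i j k : ℕ) (c : Fin 4) :
    lineSign T al be j i k c = -lineSign T al be i j k c := by
  simp only [lineSign, chi_swap T i j, mul_neg]
  generalize chi T i j k = x
  generalize SignType.sign (xCoord c) * chi T i j (al k) = y
  generalize SignType.sign (yCoord c) * chi T i j (be k) = z
  revert x y z
  decide

/-- The first pair is unique, so quantifying over it amounts to substituting `al k` and `be k`. -/
theorem exists_first_iff {k : ℕ} (hF : First n T k (al k) (be k)) (hk : k < n) {P : ℕ → ℕ → Prop} :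
    (∃ a < n, ∃ b < n, First n T k a b ∧ P a b) ↔ P (al k) (be k) := by
  constructor
  · rintro ⟨a, -, b, -, h, hP⟩
    obtain ⟨rfl, rfl⟩ := hF.unique h hk.le
    exact hP
  · exact fun h => ⟨_, hF.1.1.trans hk, _, hF.1.2.1.trans hk, hF, h⟩

/-- Meant for `k < 4`, where no good pair is available but all signs are nonzero. -/
theorem linePos_iff_of_ne_zero {i j k : ℕ} (h : chi T i j k ≠ 0) (c : Fin 4) :
    LinePos n T i j k c ↔ lineSign T al be i j k c = 1 := by
  rw [lineSign, leadSign_of_ne_zero h]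
  simp [LinePos, h]

theorem linePos_iff {k : ℕ} (hF : First n T k (al k) (be k)) (hk : k < n) (i j : ℕ) (c : Fin 4) :
    LinePos n T i j k c ↔ lineSign T al be i j k c = 1 := by
  rw [LinePos, exists_first_iff hF hk, lineSign]
  have hx := sign_xCoord_ne_zero c
  have hy := sign_yCoord_ne_zero c
  generalize SignType.sign (xCoord c) = x at *
  generalize SignType.sign (yCoord c) = y at *
  generalize chi T i j k = A
  generalize chi T i j (al k) = B
  generalize chi T i j (be k) = C
  revert A B C x y
  decide

/-- No three of the first four points are collinear. -/
def FirstFour (n : ℕ) (T : ℕ → ℕ → ℕ → SignType) : Prop :=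
  ∀ i j k, i < j → j < k → k < 4 → k < n → T i j k ≠ 0

/-- For `4 ≤ j` both sides are Boolean functions of a few signs, compared by exhaustion where they
do not agree outright. For `j < 4` there is no pair for `j`, so `lineSign` alone has to decide,
whence the last hypothesis. -/
theorem clusterPos_iff (h4 : FirstFour n T) (hF : ∀ k < n, 4 ≤ k → First n T k (al k) (be k))
    {i j k : ℕ} {a b c : Fin 4} (h1 : PtLt (i, a) (j, b)) (h2 : PtLt (j, b) (k, c)) (hk : k < n)
    (ha : a = 0 ∨ 4 ≤ i) (hb : b = 0 ∨ 4 ≤ j) (hc : c = 0 ∨ 4 ≤ k)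
    (hne : j < 4 → lineSign T al be i j k c ≠ 0) :
    ClusterPos n T i a j b k c ↔ clusterSign T al be i a j b k c = 1 := by
  have hij : i ≤ j := by rcases h1 with h | h <;> simp at h <;> omega
  have hjk : j ≤ k := by rcases h2 with h | h <;> simp at h <;> omega
  by_cases hj : 4 ≤ j
  · have Fj := hF j (by omega) hj
    have Fk := hF k hk (by omega)
    simp only [ClusterPos, exists_first_iff Fj (by omega : j < n), exists_first_iff Fk hk,
      linePos_iff Fk hk, clusterSign]
    rcases hij.lt_or_eq with hij | rfl
    · rcases hjk.lt_or_eq with hjk | rfl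
      · simp only [hij, hjk, hij.ne, hjk.ne, true_and, false_and, or_false, if_true,
          lineSign_swap (T := T) (al := al) (be := be) i j, and_false,
          lineSign_swap (T := T) (al := al) (be := be) j (al j)]
        have hx := sign_xCoord_ne_zero b
        generalize SignType.sign (xCoord b) = x at *
        generalize lineSign T al be i j k c = A
        generalize lineSign T al be j (al j) k c = B
        revert x A B
        decide
      · simp only [hij, hij.ne, lt_irrefl, true_and, false_and, and_false, false_or, or_false, if_true,
          if_false]
        have hx := sign_yCoord_sub_ne_zero (b := b) (c := c) (by
          rcases h2 with h | h
          · simp at h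
          · exact h.2)
        have hz := crossSign_ne_zero (b := b) (c := c) (by
          rcases h2 with h | h
          · simp at h
          · exact h.2)
        generalize SignType.sign (yCoord c - yCoord b) = x at *
        generalize crossSign b c = z at *
        generalize chi T i j (al j) = A
        generalize chi T i j (be j) = B
        generalize chi T (al j) (be j) j = C
        revert A B C x z
        decide
    · rcases hjk.lt_or_eq with hjk | rfl
      · simp only [hjk, hjk.ne, lt_irrefl, true_and, false_and, and_false, false_or, or_false, if_true,
          if_false, lineSign_swap (T := T) (al := al) (be := be) i (al i), neg_neg]
      · simp only [lt_irrefl, true_and, false_and, and_false, false_or, or_false, if_true,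
          if_false]
        have hz := triSign_ne_zero (a := a) (b := b) (c := c) (by
          rcases h1 with h | h
          · simp at h
          · exact h.2) (by
          rcases h2 with h | h
          · simp at h
          · exact h.2)
        generalize triSign a b c = z at *
        generalize chi T (al i) (be i) i = C
        revert C z
        decide
  -- The middle point belongs to a one-point cluster, and this forces `i < j < k`.
  · have b0 : b = 0 := by tauto
    subst b0
    have hij : i < j := by
      rcases h1 with h | ⟨h, h'⟩
      · exact h
      · simp at h'
    have hjk' : j < k ∨ k = j ∧ 4 ≤ k := by
      rcases h2 with h | ⟨h, h'⟩
      · exact Or.inl h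
      · simp at h h'
        refine Or.inr ⟨h.symm, hc.resolve_left h'.ne'⟩
    have hjk : j < k := by omega
    have hl := hne (by omega)
    have e : clusterSign T al be i a j 0 k c = lineSign T al be i j k c := by
      simp only [clusterSign, hij, hjk, if_true]
      rw [leadSign_of_ne_zero hl]
    have e1 : LinePos n T i j k c ↔ lineSign T al be i j k c = 1 := by
      by_cases hk4 : 4 ≤ k
      · exact linePos_iff (hF k hk hk4) hk _ _ _
      · exact linePos_iff_of_ne_zero (by rw [chi_of_lt hij hjk]; exact h4 _ _ _ hij hjk (by omega) hk) _
    have e2 : LinePos n T j i k c ↔ lineSign T al be j i k c = 1 := by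
      by_cases hk4 : 4 ≤ k
      · exact linePos_iff (hF k hk hk4) hk _ _ _
      · refine linePos_iff_of_ne_zero ?_ _
        rw [chi_swap, chi_of_lt hij hjk]
        exact (by decide : ∀ s : SignType, s ≠ 0 → -s ≠ 0) _ (h4 _ _ _ hij hjk (by omega) hk)
    rw [e, ClusterPos, e1, e2, lineSign_swap i j]
    have : lineSign T al be i j k c = 1 ∨ lineSign T al be i j k c = -1 := by
      revert hl; generalize lineSign T al be i j k c = s; revert s; decide
    rcases this with h | h
    · simp [h, hij, hjk]
    · simp [h, hij.ne, hjk.ne]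

end

/-! ### The simple order type of the cluster points -/

theorem pairwise_get_lt_iff {α : Type*} {r : α → α → Prop} {l : List α} (h : l.Pairwise r)
    (hr : ∀ x y, r x y → ¬r y x) {i j : Fin l.length} : r (l.get i) (l.get j) ↔ i < j := by
  have h' := List.pairwise_iff_get.1 h
  refine ⟨fun hij => ?_, h' i j⟩
  by_contra hc
  rcases (not_lt.1 hc).lt_or_eq with h1 | h1
  · exact hr _ _ hij (h' j i h1)
  · subst h1
    exact hr _ _ hij hij

theorem flatMap_eq_flatMap_finRange {α β : Type*} (l : List α) (f : α → List β) :
    l.flatMap f = (List.finRange l.length).flatMap fun i => f (l.get i) := by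
  conv_lhs => rw [← List.map_get_finRange l]
  rw [List.flatMap_map]

theorem flatMap_range_eq_flatMap_finRange {β : Type*} (n : ℕ) (f : ℕ → List β) :
    (List.range n).flatMap f = (List.finRange n).flatMap fun i : Fin n => f i := by
  rw [← List.map_coe_finRange_eq_range, List.flatMap_map]

theorem PtLt.asymm {P Q : ℕ × Fin 4} (h : PtLt P Q) : ¬PtLt Q P := by
  simp only [PtLt] at *
  omega

open Classical in
/-- The order type of the cluster points. -/
noncomputable def clusterType (n : ℕ) (T : ℕ → ℕ → ℕ → SignType) : CombOrderType (points n).length where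
  sign i j k _ _ := if ClusterPos n T ((points n).get i).1 ((points n).get i).2 ((points n).get j).1
    ((points n).get j).2 ((points n).get k).1 ((points n).get k).2 then 1 else -1

section

variable {n : ℕ} {T : ℕ → ℕ → ℕ → SignType} {al be : ℕ → ℕ} {p : ℕ → ℝ × ℝ}

theorem simple_clusterType : (clusterType n T).Simple := by
  intro i j k hij hjk
  simp only [clusterType]
  split_ifs <;> decide

open Classical in
theorem encode_clusterType : (clusterType n T).encode = List.replicate (points n).length none ++
    (points n).flatMap fun P => (points n).flatMap fun Q => (points n).flatMap fun R =>
      if PtLt P Q ∧ PtLt Q R then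
        [some (if ClusterPos n T P.1 P.2 Q.1 Q.2 R.1 R.2 then 1 else -1)] else [] := by
  rw [CombOrderType.encode, CombOrderType.signList, flatMap_eq_flatMap_finRange (points n)]
  simp only [flatMap_eq_flatMap_finRange (points n), List.map_flatMap]
  congr! 7 with i j k
  have hlt : ∀ i j : Fin (points n).length, PtLt ((points n).get i) ((points n).get j) ↔ i < j :=
    fun i j => pairwise_get_lt_iff (pairwise_points n) fun _ _ => PtLt.asymm
  rw [hlt, hlt]
  split_ifs <;> simp_all [clusterType]

/-- The positions of cluster points realize the prescribed signs. -/
def RealizesClusters (n : ℕ) (T : ℕ → ℕ → ℕ → SignType) (Q : ℕ → Fin 4 → ℝ × ℝ) : Prop :=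
  ∀ i a j b k c, (i, a) ∈ points n → (j, b) ∈ points n → (k, c) ∈ points n → PtLt (i, a) (j, b) →
    PtLt (j, b) (k, c) → SignType.sign (area (Q i a) (Q j b) (Q k c)) ≠ 0 ∧
    (SignType.sign (area (Q i a) (Q j b) (Q k c)) = 1 ↔ ClusterPos n T i a j b k c)

/-- The list `points n` is strictly increasing for `PtLt`, so positions in it correspond bijectively
to cluster points, in the same order. -/
theorem realizable_clusterType : (clusterType n T).Realizable ↔ ∃ Q, RealizesClusters n T Q := by
  classical
  have hlt : ∀ {i j : Fin (points n).length}, PtLt ((points n).get i) ((points n).get j) ↔ i < j :=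
    pairwise_get_lt_iff (pairwise_points n) fun _ _ => PtLt.asymm
  have hsgn : ∀ (s : SignType) (P : Prop) [Decidable P],
      (s = if P then 1 else -1) ↔ s ≠ 0 ∧ (s = 1 ↔ P) := by
    intro s P _
    by_cases h : P <;> simp only [h, if_true, if_false] <;> revert s <;> decide
  constructor
  · rintro ⟨q, hq⟩
    -- Pairs outside the list get the irrelevant value `0`.
    refine ⟨fun i a => if h : ∃ x, (points n).get x = (i, a) then q h.choose else 0, ?_⟩
    have hQ : ∀ x : Fin (points n).length, (if h : ∃ y, (points n).get y =
        (((points n).get x).1, ((points n).get x).2) then q h.choose else 0) = q x := by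
      intro x
      have h : ∃ y, (points n).get y = (points n).get x := ⟨x, rfl⟩
      have e : h.choose = x := by
        have := h.choose_spec
        rcases lt_trichotomy h.choose x with h1 | h1 | h1
        · have := hlt.2 h1
          rw [h.choose_spec] at this
          exact absurd this this.asymm
        · exact h1
        · have := hlt.2 h1
          rw [h.choose_spec] at this
          exact absurd this this.asymm
      rw [dif_pos h, e]
    intro i a j b k c hi hj hk hij hjk
    obtain ⟨x, hx⟩ := List.mem_iff_get.1 hi
    obtain ⟨y, hy⟩ := List.mem_iff_get.1 hj
    obtain ⟨z, hz⟩ := List.mem_iff_get.1 hk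
    have hxy : x < y := hlt.1 (by rw [hx, hy]; exact hij)
    have hyz : y < z := hlt.1 (by rw [hy, hz]; exact hjk)
    have h := congrFun (congrFun (congrFun (congrFun (congrFun (congrArg CombOrderType.sign hq) x) y)
      z) hxy) hyz
    have ex := hQ x
    have ey := hQ y
    have ez := hQ z
    simp only [hx, hy, hz] at ex ey ez
    simp only [orderType, orientation_eq_sign_area, clusterType, hx, hy, hz, hsgn] at h
    simp only [ex, ey, ez]
    exact h
  · rintro ⟨Q, hQ⟩
    refine ⟨fun x => Q ((points n).get x).1 ((points n).get x).2, ?_⟩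
    ext x y z hxy hyz
    simp only [orderType, orientation_eq_sign_area, clusterType, hsgn]
    exact hQ _ _ _ _ _ _ (List.get_mem _ _) (List.get_mem _ _) (List.get_mem _ _) (hlt.2 hxy) (hlt.2 hyz)

theorem Realizes.exists_realizesClusters (hp : Realizes n T p) (h4 : FirstFour n T)
    (hF : ∀ k < n, 4 ≤ k → First n T k (al k) (be k)) : ∃ Q, RealizesClusters n T Q := by
  -- Expansion stops at index 4; the minimum covers `n < 4`.
  obtain ⟨Q, -, hQ⟩ := exists_placed (al := al) (be := be) hp (Nat.min_le_right 4 n)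
    fun k hk hkn => (hF k hkn (by omega)).1
  refine ⟨Q, fun i a j b k c hi hj hk hij hjk => ?_⟩
  obtain ⟨hi, ha⟩ := mem_points.1 hi
  obtain ⟨hj, hb⟩ := mem_points.1 hj
  obtain ⟨hk, hc⟩ := mem_points.1 hk
  simp only at hi hj hk ha hb hc
  have hj4 : j < 4 → i < j ∧ j < k := by
    intro h
    have b0 : b = 0 := hb.resolve_right (by omega)
    subst b0
    have h1 : i < j := by
      rcases hij with h | ⟨h, h'⟩
      · exact h
      · simp at h'
    refine ⟨h1, ?_⟩
    rcases hjk with h' | ⟨h', h''⟩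
    · exact h'
    · simp only at h' h''
      rw [hc.resolve_right (by omega)] at h''
      simp at h''
  -- If two of the first four points coincided, a third one would form a triple of sign zero with
  -- them.
  have hpne : j < 4 → 4 ≤ k → p i ≠ p j := by
    intro hj' hk' e
    obtain ⟨h1, h2⟩ := hj4 hj'
    by_cases h3 : j < 3
    · refine h4 i j 3 h1 h3 (by omega) (by omega) ?_
      rw [← hp i j 3 h1 h3 (by omega), e, area_self_left, sign_zero]
    · have h3 : j = 3 := by omega
      subst h3
      by_cases h0 : i = 0
      · subst h0
        refine h4 0 1 3 (by omega) (by omega) (by omega) (by omega) ?_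
        rw [← hp 0 1 3 (by omega) (by omega) (by omega), e, area_self_outer, sign_zero]
      · refine h4 0 i 3 (by omega) (by omega) (by omega) (by omega) ?_
        rw [← hp 0 i 3 (by omega) (by omega) (by omega), e, area_self_right, sign_zero]
  have hchi : j < 4 → k < 4 → chi T i j k ≠ 0 := by
    intro hj' hk'
    obtain ⟨h1, h2⟩ := hj4 hj'
    rw [chi_of_lt h1 h2]
    exact h4 _ _ _ h1 h2 hk' hk
  obtain ⟨h1, h2⟩ := hQ i a j b k c hij hjk hk (by
    by_cases h : 4 ≤ j
    · exact Or.inl (by omega)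
    · obtain ⟨h1, h2⟩ := hj4 (by omega)
      refine Or.inr ⟨h1, h2, ?_⟩
      by_cases h' : 4 ≤ k
      · exact Or.inr ⟨by omega, hpne (by omega) h'⟩
      · exact Or.inl (hchi (by omega) (by omega)))
  rw [clusterPos_iff h4 hF hij hjk hk ha hb hc, ← h1]
  · exact ⟨by rw [h1]; exact h2, Iff.rfl⟩
  · intro h
    obtain ⟨h5, h6⟩ := hj4 h
    by_cases h' : 4 ≤ k
    · exact lineSign_ne_zero hp (hF k hk h').1 h5 h6 hk (hpne h h') c
    · rw [lineSign, leadSign_of_ne_zero (hchi h (by omega))]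
      exact hchi h (by omega)

theorem RealizesClusters.exists_realizes {Q : ℕ → Fin 4 → ℝ × ℝ} (hQ : RealizesClusters n T Q)
    (h4 : FirstFour n T) (hF : ∀ k < n, 4 ≤ k → First n T k (al k) (be k)) :
    ∃ p, Realizes n T p := by
  refine exists_realizes_of_clusters (al := al) (be := be) h4 (fun k hk hkn => (hF k hkn hk).1)
    -- The single point of each of the first four clusters is used in all four positions.
    (Q := fun i a => Q i (if 4 ≤ i then a else 0)) ?_
  intro i a j b k c hij hjk hk hne
  have hmem : ∀ i (a : Fin 4), i < n → (i, if 4 ≤ i then a else 0) ∈ points n := by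
    intro i a hi
    rw [mem_points]
    refine ⟨hi, ?_⟩
    by_cases h : 4 ≤ i
    · exact Or.inr h
    · left; simp [h]
  have m1 := hmem i a (by omega)
  have m2 := hmem j b (by omega)
  have m3 := hmem k c hk
  have hl : lineSign T al be i j k (if 4 ≤ k then c else 0) = lineSign T al be i j k c := by
    by_cases h : 4 ≤ k
    · simp [h]
    · have : chi T i j k ≠ 0 := by
        rw [chi_of_lt hij hjk]; exact h4 _ _ _ hij hjk (by omega) hk
      rw [lineSign, lineSign, leadSign_of_ne_zero this, leadSign_of_ne_zero this]
  rw [← hl] at hne ⊢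
  obtain ⟨h1, h2⟩ := hQ _ _ _ _ _ _ m1 m2 m3 (Or.inl hij) (Or.inl hjk)
  rw [clusterPos_iff h4 hF (Or.inl hij) (Or.inl hjk) hk (mem_points.1 m1).2 (mem_points.1 m2).2
    (mem_points.1 m3).2 fun _ => hne] at h2
  have e : clusterSign T al be i (if 4 ≤ i then a else 0) j (if 4 ≤ j then b else 0) k
      (if 4 ≤ k then c else 0) = lineSign T al be i j k (if 4 ≤ k then c else 0) := by
    simp only [clusterSign, hij, hjk, if_true]
    rw [leadSign_of_ne_zero hne]
  rw [e] at h2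
  revert h1 h2 hne
  generalize SignType.sign (area _ _ _) = s
  generalize lineSign _ _ _ _ _ _ _ = t
  revert s t
  decide

theorem realizable_clusterType_iff (h4 : FirstFour n T) (hgood : ∀ k < n, 4 ≤ k → ∃ a b, Good T k a b) :
    (clusterType n T).Realizable ↔ ∃ p, Realizes n T p := by
  have h : ∀ k, ∃ P : ℕ × ℕ, k < n → 4 ≤ k → First n T k P.1 P.2 := by
    intro k
    by_cases hk : k < n ∧ 4 ≤ k
    · obtain ⟨a, b, h⟩ := hgood k hk.1 hk.2
      obtain ⟨s, t, h⟩ := h.exists_first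
      exact ⟨(s, t), fun _ _ => h⟩
    · exact ⟨(0, 0), fun h h' => absurd ⟨h, h'⟩ hk⟩
  choose P hP using h
  rw [realizable_clusterType]
  exact ⟨fun ⟨Q, hQ⟩ => hQ.exists_realizes (al := fun k => (P k).1) (be := fun k => (P k).2) h4 hP,
    fun ⟨p, hp⟩ => hp.exists_realizesClusters (al := fun k => (P k).1) (be := fun k => (P k).2) h4 hP⟩

end

/-! ### Translation from combinatorial order types -/

namespace CombOrderType

variable {n : ℕ} (τ : CombOrderType n)

/-- The signs of an order type as a function on triples of natural numbers. -/
def extend (i j k : ℕ) : SignType :=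
  if h : i < j ∧ j < k ∧ k < n then
    τ.sign ⟨i, by omega⟩ ⟨j, by omega⟩ ⟨k, h.2.2⟩ h.1 h.2.1 else 0

variable {τ}

theorem extend_coe {i j k : Fin n} (hij : i < j) (hjk : j < k) :
    τ.extend i j k = τ.sign i j k hij hjk := by
  have h : (i : ℕ) < j ∧ (j : ℕ) < k ∧ (k : ℕ) < n := ⟨hij, hjk, k.2⟩
  rw [extend, dif_pos h]

theorem lt_of_extend_ne_zero {i j k : ℕ} (h : τ.extend i j k ≠ 0) : k < n := by
  unfold extend at h
  split_ifs at h with h'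
  · exact h'.2.2
  · exact absurd rfl h

theorem encode_eq : τ.encode = List.replicate n none ++ (signs n τ.extend).map some := by
  rw [encode, signList, signs, flatMap_range_eq_flatMap_finRange]
  simp only [flatMap_range_eq_flatMap_finRange]
  congr! 8 with i j k
  by_cases h : i < j ∧ j < k
  · have h' : (i : ℕ) < j ∧ (j : ℕ) < k := h
    rw [dif_pos h, if_pos h', extend_coe h.1 h.2]
  · have h' : ¬((i : ℕ) < j ∧ (j : ℕ) < k) := h
    rw [dif_neg h, if_neg h']

theorem realizable_iff : τ.Realizable ↔ ∃ p, Realizes n τ.extend p := by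
  constructor
  · rintro ⟨p, hp⟩
    refine ⟨fun i => if h : i < n then p ⟨i, h⟩ else 0, fun i j k hij hjk hk => ?_⟩
    have hj := hjk.trans hk
    have hi := hij.trans hj
    simp only [hi, hj, hk, dif_pos]
    rw [extend, dif_pos ⟨hij, hjk, hk⟩, ← hp]
    exact (orientation_eq_sign_area _ _ _).symm
  · rintro ⟨p, hp⟩
    refine ⟨fun i => p i, ?_⟩
    ext i j k hij hjk
    rw [← extend_coe (τ := τ) hij hjk, ← hp i j k hij hjk k.2]
    exact orientation_eq_sign_area _ _ _

/-- Permuting the arguments changes `chi` only by a sign, so its vanishing depends only on the set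
of indices. -/
theorem collinear_iff {a b c : Fin n} :
    τ.Collinear a b c ↔ a ≠ b ∧ a ≠ c ∧ b ≠ c ∧ chi τ.extend a b c = 0 := by
  have hneg : ∀ s : SignType, -s = 0 ↔ s = 0 := by decide
  constructor
  · rintro ⟨i, j, k, hij, hjk, h, h0⟩
    have e0 := extend_coe (τ := τ) hij hjk
    rw [h0] at e0
    have ha : a ∈ ({i, j, k} : Finset (Fin n)) := h ▸ by simp
    have hb : b ∈ ({i, j, k} : Finset (Fin n)) := h ▸ by simp
    have hc : c ∈ ({i, j, k} : Finset (Fin n)) := h ▸ by simp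
    have hi : i ∈ ({a, b, c} : Finset (Fin n)) := h.symm ▸ by simp
    have hj : j ∈ ({a, b, c} : Finset (Fin n)) := h.symm ▸ by simp
    have hk : k ∈ ({a, b, c} : Finset (Fin n)) := h.symm ▸ by simp
    simp only [Finset.mem_insert, Finset.mem_singleton, Fin.ext_iff] at ha hb hc hi hj hk
    simp only [Fin.lt_def] at hij hjk
    refine ⟨?_, ?_, ?_, ?_⟩
    · rw [ne_eq, Fin.ext_iff]; omega
    · rw [ne_eq, Fin.ext_iff]; omega
    · rw [ne_eq, Fin.ext_iff]; omega
    · have key : ∀ x y z : ℕ, x = i → y = j → z = k → τ.extend x y z = 0 := by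
        rintro _ _ _ rfl rfl rfl
        exact e0
      unfold chi
      split_ifs with h1 h2 h3 h4 h5 h6
      · exact key _ _ _ (by omega) (by omega) (by omega)
      · exact key _ _ _ (by omega) (by omega) (by omega)
      · exact key _ _ _ (by omega) (by omega) (by omega)
      · rw [hneg]; exact key _ _ _ (by omega) (by omega) (by omega)
      · rw [hneg]; exact key _ _ _ (by omega) (by omega) (by omega)
      · rw [hneg]; exact key _ _ _ (by omega) (by omega) (by omega)
      · rfl
  · rintro ⟨hab, hac, hbc, h⟩
    rw [ne_eq, Fin.ext_iff] at hab hac hbc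
    have key : ∀ i j k : Fin n, (i : ℕ) < j ∧ (j : ℕ) < k → τ.extend i j k = 0 →
        ({a, b, c} : Finset (Fin n)) = {i, j, k} → τ.Collinear a b c :=
      fun i j k hijk h0 h => ⟨i, j, k, hijk.1, hijk.2, h, by
        rw [← extend_coe (τ := τ) (i := i) (j := j) (k := k) hijk.1 hijk.2, h0]⟩
    unfold chi at h
    split_ifs at h with h1 h2 h3 h4 h5 h6
    · exact key a b c h1 h rfl
    · exact key b c a h2 h (by ext; simp; tauto)
    · exact key c a b h3 h (by ext; simp; tauto)
    · exact key a c b h4 (by rwa [hneg] at h) (by ext; simp; tauto)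
    · exact key c b a h5 (by rwa [hneg] at h) (by ext; simp; tauto)
    · exact key b a c h6 (by rwa [hneg] at h) (by ext; simp; tauto)
    · omega

theorem mem_line_iff {t a b c : Fin n} (hab : a ≠ b) :
    c ∈ τ.line t a b ↔ c < t ∧ chi τ.extend a b c = 0 := by
  simp only [line, Set.mem_ofPred_eq, collinear_iff]
  refine and_congr_right fun _ => ?_
  constructor
  · rintro (rfl | rfl | h)
    · exact chi_self_left _ _ _
    · exact chi_self_right _ _ _
    · exact h.2.2.2
  · intro h
    by_cases h1 : c = a
    · exact Or.inl h1
    by_cases h2 : c = b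
    · exact Or.inr (Or.inl h2)
    exact Or.inr (Or.inr ⟨hab, Ne.symm h1, Ne.symm h2, h⟩)

theorem Constructible.firstFour (h : τ.Constructible) : FirstFour n τ.extend := by
  intro i j k hij hjk hk hkn
  rw [extend, dif_pos ⟨hij, hjk, hkn⟩]
  exact h.1 _ _ _ _ _ hk

/-- Three pairs that span lines through `k` give three members of `linesThrough`, which has at most
two elements. So two of these sets agree, which says that the two pairs have the same collinear
indices. -/
theorem Constructible.exists_good (h : τ.Constructible) {p : ℕ → ℝ × ℝ} (hp : Realizes n τ.extend p)
    {k : ℕ} (hkn : k < n) (hk : 4 ≤ k) : ∃ a b, Good τ.extend k a b := by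
  refine hp.exists_good hk hkn (h.firstFour 0 1 2 (by omega) (by omega) (by omega) (by omega)) ?_
  set t : Fin n := ⟨k, hkn⟩ with ht
  have key : ∀ {i j : ℕ} (hij : i < j) (hjk : j < k), chi τ.extend i j k = 0 →
      (∃ c < k, chi τ.extend i j c ≠ 0) →
      τ.line t ⟨i, by omega⟩ ⟨j, by omega⟩ ∈ τ.linesThrough t := by
    intro i j hij hjk h0 ⟨c, hck, hc⟩
    have hne : (⟨i, by omega⟩ : Fin n) ≠ ⟨j, by omega⟩ := by simp [hij.ne]
    refine ⟨⟨i, by omega⟩, ⟨j, by omega⟩, Fin.lt_def.2 (hij.trans hjk), Fin.lt_def.2 hjk, hne, rfl,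
      ⟨⟨c, by omega⟩, Fin.lt_def.2 hck, ?_⟩, ?_⟩
    · rw [mem_line_iff hne]
      exact fun h => hc h.2
    · rw [collinear_iff]
      refine ⟨hne, ?_, ?_, h0⟩ <;> simp [ht] <;> omega
  have heq : ∀ {i j i' j' : ℕ} (hij : i < j) (hjk : j < k) (hij' : i' < j') (hjk' : j' < k),
      τ.line t ⟨i, by omega⟩ ⟨j, by omega⟩ = τ.line t ⟨i', by omega⟩ ⟨j', by omega⟩ →
      ∀ c < k, chi τ.extend i j c = 0 ↔ chi τ.extend i' j' c = 0 := by
    intro i j i' j' hij hjk hij' hjk' e c hc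
    have hne : (⟨i, by omega⟩ : Fin n) ≠ ⟨j, by omega⟩ := by simp [hij.ne]
    have hne' : (⟨i', by omega⟩ : Fin n) ≠ ⟨j', by omega⟩ := by simp [hij'.ne]
    have := Set.ext_iff.1 e ⟨c, by omega⟩
    rw [mem_line_iff hne, mem_line_iff hne'] at this
    simpa [ht, hc] using this
  intro i j i' j' i'' j'' hij hjk hij' hjk' hij'' hjk'' h1 h2 h3 s1 s2 s3
  have m1 := key hij hjk h1 s1
  have m2 := key hij' hjk' h2 s2
  have m3 := key hij'' hjk'' h3 s3
  by_contra hcon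
  simp only [not_or] at hcon
  have n1 := fun e => hcon.1 (heq hij hjk hij' hjk' e)
  have n2 := fun e => hcon.2.1 (heq hij'' hjk'' hij hjk e)
  have n3 := fun e => hcon.2.2 (heq hij'' hjk'' hij' hjk' e)
  have h2 := h.2 t hk
  have hsub : ({τ.line t ⟨i, by omega⟩ ⟨j, by omega⟩, τ.line t ⟨i', by omega⟩ ⟨j', by omega⟩,
      τ.line t ⟨i'', by omega⟩ ⟨j'', by omega⟩} : Set (Set (Fin n))) ⊆ τ.linesThrough t := by
    rintro L (rfl | rfl | rfl)
    · exact m1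
    · exact m2
    · exact m3
  have h3 := Set.ncard_le_ncard hsub (Set.toFinite _)
  rw [Set.ncard_eq_three.2 ⟨_, _, _, n1, fun e => n2 e.symm, fun e => n3 e.symm, rfl⟩] at h3
  omega

/-- A simple order type on four points that is not realizable. -/
def bad : CombOrderType 4 where
  sign i j k _ _ := if ((i : ℕ) + j + k) % 2 = 1 then 1 else -1

theorem simple_bad : bad.Simple := by
  intro i j k hij hjk
  simp only [bad]
  split_ifs <;> decide

theorem encode_bad : bad.encode = [none, none, none, none, some 1, some (-1), some 1, some (-1)] := by
  decide

/-- The two triangulations of a quadrilateral give `area 012 + area 023 = area 013 + area 123`; the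
prescribed signs make the left side positive and the right side negative. -/
theorem not_realizable_bad : ¬bad.Realizable := by
  rintro ⟨p, hp⟩
  have h : ∀ (i j k : Fin 4) (hij : i < j) (hjk : j < k),
      SignType.sign (area (p i) (p j) (p k)) = bad.sign i j k hij hjk := by
    intro i j k hij hjk
    rw [← hp]
    exact (orientation_eq_sign_area _ _ _).symm
  have h1 := sign_eq_one_iff.1 (h 0 1 2 (by decide) (by decide))
  have h2 := sign_eq_neg_one_iff.1 (h 0 1 3 (by decide) (by decide))
  have h3 := sign_eq_one_iff.1 (h 0 2 3 (by decide) (by decide))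
  have h4 := sign_eq_neg_one_iff.1 (h 1 2 3 (by decide) (by decide))
  simp only [area] at h1 h2 h3 h4
  linarith

end CombOrderType

/-! ### The reduction -/

open Classical in
/-- The simple order type for a constructible one. -/
noncomputable def simplification
    (τ : {τ : (n : ℕ) × CombOrderType n // CombOrderType.Constructible τ.2}) :
    {τ : (n : ℕ) × CombOrderType n // CombOrderType.Simple τ.2} :=
  if ∀ k < τ.1.1, 4 ≤ k → ∃ a b, Good τ.1.2.extend k a b then
    ⟨⟨_, clusterType τ.1.1 τ.1.2.extend⟩, simple_clusterType⟩
  else ⟨⟨4, CombOrderType.bad⟩, CombOrderType.simple_bad⟩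

section

variable {τ : {τ : (n : ℕ) × CombOrderType n // CombOrderType.Constructible τ.2}}

theorem simplification_of_good (h : ∀ k < τ.1.1, 4 ≤ k → ∃ a b, Good τ.1.2.extend k a b) :
    simplification τ = ⟨⟨_, clusterType τ.1.1 τ.1.2.extend⟩, simple_clusterType⟩ :=
  if_pos h

theorem simplification_of_not_good (h : ¬∀ k < τ.1.1, 4 ≤ k → ∃ a b, Good τ.1.2.extend k a b) :
    simplification τ = ⟨⟨4, CombOrderType.bad⟩, CombOrderType.simple_bad⟩ :=
  if_neg h

variable (τ)

/-- If some index lacks a good pair, neither side is realizable: a realizable constructible order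
type would have one. -/
theorem realizable_simplification : τ.1.2.Realizable ↔ (simplification τ).1.2.Realizable := by
  by_cases h : ∀ k < τ.1.1, 4 ≤ k → ∃ a b, Good τ.1.2.extend k a b
  · rw [simplification_of_good h]
    exact CombOrderType.realizable_iff.trans (realizable_clusterType_iff τ.2.firstFour h).symm
  · rw [simplification_of_not_good h]
    refine iff_of_false (fun hr => h ?_) CombOrderType.not_realizable_bad
    obtain ⟨p, hp⟩ := CombOrderType.realizable_iff.1 hr
    exact fun k hkn hk => τ.2.exists_good hp hkn hk

theorem encode_simplification : (simplification τ).1.2.encode = (reduction.exec τ.1.1 (fun _ => 0)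
      ⟨Flags.init, (signs τ.1.1 τ.1.2.extend).map some, [], []⟩).out.reverse := by
  rw [(emits_reduction (fun i j k _ _ h => CombOrderType.lt_of_extend_ne_zero h) _).out_eq]
  by_cases h : ∀ k < τ.1.1, 4 ≤ k → ∃ a b, Good τ.1.2.extend k a b
  · rw [simplification_of_good h, if_pos h]
    exact encode_clusterType
  · rw [simplification_of_not_good h, if_neg h]
    exact CombOrderType.encode_bad

end

theorem propositionp :
    constructibleOrderTypeRealizability.ReducesTo simpleOrderTypeRealizability :=
  ⟨simplification, reduction.computableInPolyTime wf_reduction fun τ =>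
    ⟨τ.1.1, signs τ.1.1 τ.1.2.extend, CombOrderType.encode_eq, encode_simplification τ⟩,
    realizable_simplification⟩
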